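/- **Setting.** All categories have a set of objects in some universe and hom-sets in some universe. The statement is made for two meanings of the word "category" (fixed throughout): (a) arbitrary categories, compared up to equivalence (the set-theoretic counterpart of univalent categories); (b) categories that are literally univalent, i.e. for all objects $x,y$ the map from equalities $x=y$ to isomorphisms $x\cong y$ is bijective. In case (b) the same is required of all fibres of the displayed categories of types. * $\mathbf{FinLim}$ is the bicategory of categories with finite limits, functors that preserve finite limits, and natural transformations. $\mathbf{LCCC}$ is the bicategory of those $\mathcal C\in\mathbf{FinLim}$ for which all pullback functors $f^*:\mathcal C/y\to\mathcal C/x$ have right adjoints, with those functors $F$ for which, for every $f:x\to y$, the mate (with respect to the right adjoints of $f^*$ and $(Ff)^*$) of the canonical isomorphism $(Ff)^*\circ F/y\cong F/x\circ f^*$ is invertible, and with all natural transformations. * A *comprehension category* is a category $\mathcal C$ with a terminal object, a displayed category $\mathcal D$ over $\mathcal C$ with a cleaving, and a Cartesian displayed functor $\chi:\mathcal D\to\mathrm{Arr}(\mathcal C)$ over $\mathrm{id}_{\mathcal C}$; for a type $A\in\mathcal D_\Gamma$ write $\pi_A:\Gamma.A\to\Gamma$ for $\chi(A)$. It is *full*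 if $\chi$ is fully faithful. A morphism is a triple $(F,\bar F,F_\chi)$ of a functor that preserves the terminal object, a Cartesian displayed functor over it, and a displayed natural isomorphism with components $F(\Gamma.A)\to F\Gamma.\bar FA$ over the identity; a 2-cell is a natural transformation together with a displayed natural transformation over it that is compatible with the $F_\chi$. * $\mathbf{DFLCompCat}$ is the bicategory of full comprehension categories such that: all fibres have terminal objects, binary products and equalizers, and these are preserved by substitution; $\pi_A$ is invertible whenever $A$ is terminal in its fibre; the functors $\pi_A^*$ have left adjoints $\Sigma_A$ that satisfy the Beck–Chevalley condition for every pullback square between projections, and the canonical maps $\Gamma.A.B\to\Gamma.\Sigma_AB$ are invertible; and every context is isomorphic to $1.A$ for some type $A$ over the terminal context $1$. Its morphisms are those for which $\bar F$ preserves terminal objects, binary products and equalizers on all fibres. * $\mathbf{DFLCompCat}^{\Pi}$ is the bicategory of those DFL comprehension categories for which the functors $\pi_A^*$ have right adjoints that satisfy the Beck–Chevalley condition for every pullback square between projections, with those morphisms for which, for every $f:x\to y$ in $\mathcal C_1$, the mate (with respect to the right adjoints of $f^*$ and $(Ff)^*$) of $(Ff)^*\circ\bar F_y\cong\bar F_x\circ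 f^*$ is invertible, and with all 2-cells. **Theorem.** 1. Sending $\mathcal C$ to $\mathrm{id}:\mathrm{Arr}(\mathcal C)\to\mathrm{Arr}(\mathcal C)$ (and $F$ to $(F,\mathrm{Arr}(F),\mathrm{id})$, $\tau$ to $(\tau,\mathrm{Arr}(\tau))$) gives a pseudofunctor $H:\mathbf{FinLim}\to\mathbf{DFLCompCat}$; sending a comprehension category to its category of contexts gives a pseudofunctor $U:\mathbf{DFLCompCat}\to\mathbf{FinLim}$. There is a biequivalence $e=(H,U,\zeta,\xi)$, that is, $\zeta:\mathrm{id}\Rightarrow H\circ U$ and $\xi:U\circ H\Rightarrow\mathrm{id}$ are adjoint equivalences in the bicategories of pseudofunctors, pseudonatural transformations and modifications, where $\zeta$ has components $(\mathrm{id},\chi,\mathrm{id})$ and naturality cells given by the $F_\chi$, and $\xi$ is pointwise the identity. 2. There is a displayed biequivalence over $e$ between the displayed bicategories of $\mathbf{LCCC}$ over $\mathbf{FinLim}$ and of $\mathbf{DFLCompCat}^{\Pi}$ over $\mathbf{DFLCompCat}$: $H$ and $U$ send objects and 1-cells of $\mathbf{LCCC}$ to those of $\mathbf{DFLCompCat}^{\Pi}$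 and conversely, and the components of $\zeta$ and $\xi$ and of their inverses are 1-cells of these bicategories. 3. The induced pseudofunctors between $\mathbf{LCCC}$ and $\mathbf{DFLCompCat}^{\Pi}$ form a biequivalence $\mathbf{LCCC}\simeq\mathbf{DFLCompCat}^{\Pi}$, whose unit and counit (and their inverses) have the same components as those of $e$. -/

import Mathlib

open CategoryTheory CategoryTheory.Limits CategoryTheory.Bicategory

universe v u

set_option linter.checkUnivs false

namespace LCCCBiequiv

/-! ### Displayed categories -/

/-- A displayed category over `C`: objects over objects, morphisms over morphisms, and the
category laws, which hold over the corresponding laws of `C`. -/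
structure DispCat (C : Type u) [Category.{v} C] where
  Ob : C → Type (max u v)
  Hom : ∀ {x y : C}, (x ⟶ y) → Ob x → Ob y → Type v
  id : ∀ {x : C} (X : Ob x), Hom (𝟙 x) X X
  comp : ∀ {x y z : C} {f : x ⟶ y} {g : y ⟶ z} {X : Ob x} {Y : Ob y} {Z : Ob z},
    Hom f X Y → Hom g Y Z → Hom (f ≫ g) X Z
  id_comp : ∀ {x y : C} {f : x ⟶ y} {X : Ob x} {Y : Ob y} (a : Hom f X Y),
    HEq (comp (id X) a) a
  comp_id : ∀ {x y : C} {f : x ⟶ y} {X : Ob x} {Y : Ob y} (a : Hom f X Y),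
    HEq (comp a (id Y)) a
  assoc : ∀ {w x y z : C} {f : w ⟶ x} {g : x ⟶ y} {h : y ⟶ z}
    {W : Ob w} {X : Ob x} {Y : Ob y} {Z : Ob z} (a : Hom f W X) (b : Hom g X Y) (c : Hom h Y Z),
    HEq (comp (comp a b) c) (comp a (comp b c))

namespace DispCat

variable {C : Type u} [Category.{v} C] (D : DispCat.{v, u} C)

/-- Transport of a displayed morphism along an equality of morphisms of the base. -/
def tr {x y : C} {f g : x ⟶ y} {X : D.Ob x} {Y : D.Ob y} (h : f = g) (a : D.Hom f X Y) :
    D.Hom g X Y :=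
  h ▸ a

/-- Objects of the total category. -/
structure Tot where
  pt : C
  ob : D.Ob pt

/-- Morphisms of the total category. -/
structure TotHom (X Y : D.Tot) where
  base : X.pt ⟶ Y.pt
  hom : D.Hom base X.ob Y.ob

variable {D} in
theorem totHom_eq {X Y : D.Tot} {f g : X.pt ⟶ Y.pt} {a : D.Hom f X.ob Y.ob}
    {b : D.Hom g X.ob Y.ob} (h : f = g) (h' : HEq a b) :
    (⟨f, a⟩ : D.TotHom X Y) = ⟨g, b⟩ := by
  subst h
  cases h'
  rfl

/-- The total category of a displayed category. -/
instance : Category D.Tot where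
  Hom X Y := D.TotHom X Y
  id X := ⟨𝟙 X.pt, D.id X.ob⟩
  comp a b := ⟨a.base ≫ b.base, D.comp a.hom b.hom⟩
  id_comp a := totHom_eq (Category.id_comp a.base) (D.id_comp a.hom)
  comp_id a := totHom_eq (Category.comp_id a.base) (D.comp_id a.hom)
  assoc a b c := totHom_eq (Category.assoc a.base b.base c.base) (D.assoc a.hom b.hom c.hom)

/-- A displayed morphism as a morphism of the total category. -/
def tot {x y : C} {f : x ⟶ y} {X : D.Ob x} {Y : D.Ob y} (a : D.Hom f X Y) :
    (⟨x, X⟩ : D.Tot) ⟶ ⟨y, Y⟩ :=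
  ⟨f, a⟩

variable {D}

@[simp] theorem tot_id {x : C} (X : D.Ob x) : D.tot (D.id X) = 𝟙 _ := rfl

@[simp] theorem tot_comp {x y z : C} {f : x ⟶ y} {g : y ⟶ z} {X : D.Ob x} {Y : D.Ob y}
    {Z : D.Ob z} (a : D.Hom f X Y) (b : D.Hom g Y Z) :
    D.tot (D.comp a b) = D.tot a ≫ D.tot b := rfl

@[simp] theorem tot_tr {x y : C} {f g : x ⟶ y} {X : D.Ob x} {Y : D.Ob y} (h : f = g)
    (a : D.Hom f X Y) : D.tot (D.tr h a) = D.tot a := by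
  subst h; rfl

theorem tot_inj {x y : C} {f : x ⟶ y} {X : D.Ob x} {Y : D.Ob y} {a b : D.Hom f X Y}
    (h : D.tot a = D.tot b) : a = b := by
  unfold tot at h
  injection h

theorem heq_of_tot {x y : C} {f g : x ⟶ y} {X : D.Ob x} {Y : D.Ob y} {a : D.Hom f X Y}
    {b : D.Hom g X Y} (h : D.tot a = D.tot b) : HEq a b := by
  unfold tot at h
  injection h

theorem tot_of_heq {x y : C} {f g : x ⟶ y} {X : D.Ob x} {Y : D.Ob y} {a : D.Hom f X Y}
    {b : D.Hom g X Y} (e : f = g) (h : HEq a b) : D.tot a = D.tot b :=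
  totHom_eq e h

/-- Cartesian morphisms. -/
def IsCartesian {x y : C} {f : x ⟶ y} {X : D.Ob x} {Y : D.Ob y} (a : D.Hom f X Y) : Prop :=
  ∀ ⦃w : C⦄ ⦃W : D.Ob w⦄ (g : w ⟶ x) (h : D.Hom (g ≫ f) W Y),
    ∃! k : D.Hom g W X, D.comp k a = h

variable (D) in
/-- A cleaving: a choice of a Cartesian lift of every morphism of the base. -/
structure Cleaving where
  obj : ∀ {x y : C}, (x ⟶ y) → D.Ob y → D.Ob x
  lift : ∀ {x y : C} (f : x ⟶ y) (Y : D.Ob y), D.Hom f (obj f Y) Y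
  cartesian : ∀ {x y : C} (f : x ⟶ y) (Y : D.Ob y), IsCartesian (lift f Y)

variable (D) in
/-- The fibre of a displayed category over `x`: its objects are the objects over `x`. -/
structure Fiber (x : C) where
  ob : D.Ob x

/-- Morphisms of the fibre over `x` are the displayed morphisms over `𝟙 x`. -/
@[ext]
structure FiberHom {x : C} (X Y : D.Fiber x) where
  hom : D.Hom (𝟙 x) X.ob Y.ob

instance (x : C) : Category (D.Fiber x) where
  Hom X Y := D.FiberHom X Y
  id X := ⟨D.id X.ob⟩
  comp a b := ⟨D.tr (Category.comp_id _) (D.comp a.hom b.hom)⟩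
  id_comp a := FiberHom.ext (tot_inj (by simp))
  comp_id a := FiberHom.ext (tot_inj (by simp))
  assoc a b c := FiberHom.ext (tot_inj (by simp))

@[ext]
theorem fiber_hom_ext {x : C} {X Y : D.Fiber x} {a b : X ⟶ Y}
    (h : D.tot a.hom = D.tot b.hom) : a = b :=
  FiberHom.ext (tot_inj h)

@[simp]
theorem fiber_tot_id {x : C} (X : D.Fiber x) : D.tot (𝟙 X : X ⟶ X).hom = 𝟙 _ := rfl

@[simp]
theorem fiber_tot_comp {x : C} {X Y Z : D.Fiber x} (a : X ⟶ Y) (b : Y ⟶ Z) :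
    D.tot (a ≫ b).hom = D.tot a.hom ≫ D.tot b.hom :=
  tot_tr _ _

/-- The factorization through a Cartesian morphism. -/
noncomputable def IsCartesian.fac {x y : C} {f : x ⟶ y} {X : D.Ob x} {Y : D.Ob y}
    {a : D.Hom f X Y} (ha : IsCartesian a) {w : C} {W : D.Ob w} (g : w ⟶ x) {k : w ⟶ y}
    (e : k = g ≫ f) (h : D.Hom k W Y) : D.Hom g W X :=
  (ha g (D.tr e h)).choose

theorem IsCartesian.fac_tot {x y : C} {f : x ⟶ y} {X : D.Ob x} {Y : D.Ob y}
    {a : D.Hom f X Y} (ha : IsCartesian a) {w : C} {W : D.Ob w} (g : w ⟶ x) {k : w ⟶ y}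
    (e : k = g ≫ f) (h : D.Hom k W Y) : D.tot (ha.fac g e h) ≫ D.tot a = D.tot h := by
  have := (ha g (D.tr e h)).choose_spec.1
  calc D.tot (ha.fac g e h) ≫ D.tot a = D.tot (D.tr e h) := congrArg D.tot this
    _ = _ := tot_tr _ _

theorem IsCartesian.fac_tot_assoc {x y : C} {f : x ⟶ y} {X : D.Ob x} {Y : D.Ob y}
    {a : D.Hom f X Y} (ha : IsCartesian a) {w : C} {W : D.Ob w} (g : w ⟶ x) {k : w ⟶ y}
    (e : k = g ≫ f) (h : D.Hom k W Y) {T : D.Tot} (t : (⟨y, Y⟩ : D.Tot) ⟶ T) :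
    D.tot (ha.fac g e h) ≫ D.tot a ≫ t = D.tot h ≫ t := by
  rw [← Category.assoc, ha.fac_tot]

theorem IsCartesian.tot_ext {x y : C} {f : x ⟶ y} {X : D.Ob x} {Y : D.Ob y}
    {a : D.Hom f X Y} (ha : IsCartesian a) {w : C} {W : D.Ob w}
    {t t' : (⟨w, W⟩ : D.Tot) ⟶ ⟨x, X⟩} (hb : t.base = t'.base)
    (h : t ≫ D.tot a = t' ≫ D.tot a) : t = t' := by
  obtain ⟨g, k⟩ := t
  obtain ⟨g', l⟩ := t'
  dsimp at hb
  subst hb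
  exact congrArg D.tot ((ha g (D.comp l a)).unique (tot_inj h) rfl)

theorem IsCartesian.hom_ext {x y : C} {f : x ⟶ y} {X : D.Ob x} {Y : D.Ob y}
    {a : D.Hom f X Y} (ha : IsCartesian a) {w : C} {W : D.Ob w} {g : w ⟶ x}
    {k l : D.Hom g W X} (h : D.tot k ≫ D.tot a = D.tot l ≫ D.tot a) : k = l :=
  (ha g (D.comp l a)).unique (tot_inj h) rfl

/-- The reindexing (substitution) functor `f^*` between fibres. -/
noncomputable def Cleaving.reindex (c : D.Cleaving) {x y : C} (f : x ⟶ y) :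
    D.Fiber y ⥤ D.Fiber x where
  obj Y := ⟨c.obj f Y.ob⟩
  map {Y Z} a := ⟨(c.cartesian f Z.ob).fac (𝟙 x) (k := f ≫ 𝟙 y) (by simp)
    (D.comp (c.lift f Y.ob) a.hom)⟩
  map_id Y := FiberHom.ext ((c.cartesian f Y.ob).hom_ext (by
    rw [IsCartesian.fac_tot, tot_comp, fiber_tot_id, fiber_tot_id]; simp))
  map_comp {X Y Z} a b := FiberHom.ext ((c.cartesian f Z.ob).hom_ext (by
    rw [IsCartesian.fac_tot, tot_comp, fiber_tot_comp, fiber_tot_comp, Category.assoc,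
      IsCartesian.fac_tot, tot_comp, ← Category.assoc, ← Category.assoc,
      IsCartesian.fac_tot, tot_comp]))

/-- The Cartesian lift of `f` at an object of the fibre. -/
def Cleaving.liftAt (c : D.Cleaving) {x y : C} (f : x ⟶ y) (Y : D.Fiber y) :
    D.Hom f ((c.reindex f).obj Y).ob Y.ob :=
  c.lift f Y.ob

theorem Cleaving.liftAt_cartesian (c : D.Cleaving) {x y : C} (f : x ⟶ y) (Y : D.Fiber y) :
    IsCartesian (c.liftAt f Y) :=
  c.cartesian f Y.ob

theorem Cleaving.reindex_map_lift (c : D.Cleaving) {x y : C} (f : x ⟶ y) {Y Z : D.Fiber y}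
    (a : Y ⟶ Z) :
    D.tot ((c.reindex f).map a).hom ≫ D.tot (c.liftAt f Z) =
      D.tot (c.liftAt f Y) ≫ D.tot a.hom := by
  dsimp only [Cleaving.reindex, Cleaving.liftAt]
  rw [IsCartesian.fac_tot, tot_comp]

theorem Cleaving.reindex_map_lift_assoc (c : D.Cleaving) {x y : C} (f : x ⟶ y) {Y Z : D.Fiber y}
    (a : Y ⟶ Z) {T : D.Tot} (t : (⟨y, Z.ob⟩ : D.Tot) ⟶ T) :
    D.tot ((c.reindex f).map a).hom ≫ D.tot (c.liftAt f Z) ≫ t =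
      D.tot (c.liftAt f Y) ≫ D.tot a.hom ≫ t := by
  rw [← Category.assoc, c.reindex_map_lift, Category.assoc]

/-- For a commuting square `p ≫ q = r ≫ s` in the base, the component at `Z` of the canonical
comparison `p^* q^* ⟶ r^* s^*`, given by the universal property of Cartesian lifts. -/
noncomputable def Cleaving.squareApp (c : D.Cleaving) {w x y z : C} {p : w ⟶ x} {q : x ⟶ z}
    {r : w ⟶ y} {s : y ⟶ z} (h : p ≫ q = r ≫ s) (Z : D.Fiber z) :
    (c.reindex p).obj ((c.reindex q).obj Z) ⟶ (c.reindex r).obj ((c.reindex s).obj Z) :=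
  FiberHom.mk ((c.liftAt_cartesian r ((c.reindex s).obj Z)).fac (𝟙 w) (k := r) (by simp)
    ((c.liftAt_cartesian s Z).fac r h
      (D.comp (c.liftAt p ((c.reindex q).obj Z)) (c.liftAt q Z))))

theorem Cleaving.squareApp_lift (c : D.Cleaving) {w x y z : C} {p : w ⟶ x} {q : x ⟶ z}
    {r : w ⟶ y} {s : y ⟶ z} (h : p ≫ q = r ≫ s) (Z : D.Fiber z) :
    D.tot (c.squareApp h Z).hom ≫ D.tot (c.liftAt r ((c.reindex s).obj Z)) ≫
      D.tot (c.liftAt s Z) =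
    D.tot (c.liftAt p ((c.reindex q).obj Z)) ≫ D.tot (c.liftAt q Z) := by
  dsimp only [Cleaving.squareApp]
  rw [IsCartesian.fac_tot_assoc, IsCartesian.fac_tot, tot_comp]

theorem Cleaving.squareApp_lift_assoc (c : D.Cleaving) {w x y z : C} {p : w ⟶ x} {q : x ⟶ z}
    {r : w ⟶ y} {s : y ⟶ z} (h : p ≫ q = r ≫ s) (Z : D.Fiber z) {T : D.Tot}
    (t : (⟨z, Z.ob⟩ : D.Tot) ⟶ T) :
    D.tot (c.squareApp h Z).hom ≫ D.tot (c.liftAt r ((c.reindex s).obj Z)) ≫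
      D.tot (c.liftAt s Z) ≫ t =
    D.tot (c.liftAt p ((c.reindex q).obj Z)) ≫ D.tot (c.liftAt q Z) ≫ t := by
  have h' := congrArg (· ≫ t) (c.squareApp_lift h Z)
  simpa only [Category.assoc] using h'

/-- For a commuting square `p ≫ q = r ≫ s` in the base, the canonical comparison
`p^* q^* ⟶ r^* s^*` given by the universal property of Cartesian lifts
(it is always invertible). -/
noncomputable def Cleaving.square (c : D.Cleaving) {w x y z : C} {p : w ⟶ x} {q : x ⟶ z}
    {r : w ⟶ y} {s : y ⟶ z} (h : p ≫ q = r ≫ s) :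
    c.reindex q ⋙ c.reindex p ⟶ c.reindex s ⋙ c.reindex r where
  app Z := c.squareApp h Z
  naturality Y Z a := by
    refine FiberHom.ext ((c.liftAt_cartesian r _).hom_ext
      ((c.liftAt_cartesian s _).tot_ext ?_ ?_))
    · change (𝟙 w) ≫ r = (𝟙 w) ≫ r
      rfl
    · dsimp only [Functor.comp_map]
      rw [Category.assoc, Category.assoc]
      erw [fiber_tot_comp, fiber_tot_comp]
      rw [Category.assoc, Category.assoc, c.squareApp_lift, c.reindex_map_lift_assoc p,
        c.reindex_map_lift q, c.reindex_map_lift_assoc r, c.reindex_map_lift s,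
        c.squareApp_lift_assoc]

end DispCat

/-! ### Displayed functors and displayed natural transformations -/

section Functors

variable {C₁ C₂ C₃ : Type u} [Category.{v} C₁] [Category.{v} C₂] [Category.{v} C₃]

/-- A displayed functor over `F`. -/
structure DispFunctor (F : C₁ ⥤ C₂) (D₁ : DispCat.{v, u} C₁) (D₂ : DispCat.{v, u} C₂) where
  obj : ∀ {x : C₁}, D₁.Ob x → D₂.Ob (F.obj x)
  map : ∀ {x y : C₁} {f : x ⟶ y} {X : D₁.Ob x} {Y : D₁.Ob y},
    D₁.Hom f X Y → D₂.Hom (F.map f) (obj X) (obj Y)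
  map_id : ∀ {x : C₁} (X : D₁.Ob x), HEq (map (D₁.id X)) (D₂.id (obj X))
  map_comp : ∀ {x y z : C₁} {f : x ⟶ y} {g : y ⟶ z} {X : D₁.Ob x} {Y : D₁.Ob y} {Z : D₁.Ob z}
    (a : D₁.Hom f X Y) (b : D₁.Hom g Y Z),
    HEq (map (D₁.comp a b)) (D₂.comp (map a) (map b))

namespace DispFunctor

variable {F : C₁ ⥤ C₂} {D₁ : DispCat.{v, u} C₁} {D₂ : DispCat.{v, u} C₂}

theorem tot_map_id (G : DispFunctor F D₁ D₂) {x : C₁} (X : D₁.Ob x) :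
    D₂.tot (G.map (D₁.id X)) = 𝟙 _ :=
  DispCat.tot_of_heq (F.map_id x) (G.map_id X)

theorem tot_map_comp (G : DispFunctor F D₁ D₂) {x y z : C₁} {f : x ⟶ y} {g : y ⟶ z}
    {X : D₁.Ob x} {Y : D₁.Ob y} {Z : D₁.Ob z} (a : D₁.Hom f X Y) (b : D₁.Hom g Y Z) :
    D₂.tot (G.map (D₁.comp a b)) = D₂.tot (G.map a) ≫ D₂.tot (G.map b) :=
  DispCat.tot_of_heq (F.map_comp f g) (G.map_comp a b)

/-- The functor between total categories. -/
def total (G : DispFunctor F D₁ D₂) : D₁.Tot ⥤ D₂.Tot where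
  obj X := ⟨F.obj X.pt, G.obj X.ob⟩
  map a := ⟨F.map a.base, G.map a.hom⟩
  map_id X := G.tot_map_id X.ob
  map_comp a b := G.tot_map_comp a.hom b.hom

theorem tot_map (G : DispFunctor F D₁ D₂) {x y : C₁} {f : x ⟶ y} {X : D₁.Ob x} {Y : D₁.Ob y}
    (a : D₁.Hom f X Y) : D₂.tot (G.map a) = G.total.map (D₁.tot a) := rfl

/-- A displayed functor is Cartesian if it preserves Cartesian morphisms. -/
def IsCartesian (G : DispFunctor F D₁ D₂) : Prop :=
  ∀ ⦃x y : C₁⦄ ⦃f : x ⟶ y⦄ ⦃X : D₁.Ob x⦄ ⦃Y : D₁.Ob y⦄ (a : D₁.Hom f X Y),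
    DispCat.IsCartesian a → DispCat.IsCartesian (G.map a)

/-- The identity displayed functor. -/
def id (D : DispCat.{v, u} C₁) : DispFunctor (𝟭 C₁) D D where
  obj X := X
  map a := a
  map_id _ := HEq.rfl
  map_comp _ _ := HEq.rfl

variable {K : C₂ ⥤ C₃} {D₃ : DispCat.{v, u} C₃}

/-- Composition of displayed functors. -/
def comp (G : DispFunctor F D₁ D₂) (H : DispFunctor K D₂ D₃) :
    DispFunctor (F ⋙ K) D₁ D₃ where
  obj X := H.obj (G.obj X)
  map a := H.map (G.map a)
  map_id X := DispCat.heq_of_tot (by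
    rw [H.tot_map, G.tot_map_id, CategoryTheory.Functor.map_id]; rfl)
  map_comp a b := DispCat.heq_of_tot (by
    rw [H.tot_map, G.tot_map_comp, Functor.map_comp]; rfl)

/-- The functor between fibres induced by a displayed functor. -/
def fiber (G : DispFunctor F D₁ D₂) (x : C₁) : D₁.Fiber x ⥤ D₂.Fiber (F.obj x) where
  obj X := ⟨G.obj X.ob⟩
  map a := DispCat.FiberHom.mk (D₂.tr (F.map_id x) (G.map a.hom))
  map_id X := DispCat.fiber_hom_ext (by
    dsimp only
    rw [DispCat.tot_tr, G.tot_map, DispCat.fiber_tot_id, CategoryTheory.Functor.map_id]; rfl)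
  map_comp a b := DispCat.fiber_hom_ext (by
    dsimp only
    rw [DispCat.tot_tr, G.tot_map, DispCat.fiber_tot_comp, Functor.map_comp,
      DispCat.fiber_tot_comp, DispCat.tot_tr, DispCat.tot_tr]; rfl)

theorem tot_fiber_map (G : DispFunctor F D₁ D₂) {x : C₁} {X Y : D₁.Fiber x} (a : X ⟶ Y) :
    D₂.tot ((G.fiber x).map a).hom = G.total.map (D₁.tot a.hom) :=
  DispCat.tot_tr _ _

/-- The image of a Cartesian lift, as a morphism between objects of fibres. -/
noncomputable def mapLift (G : DispFunctor F D₁ D₂) (c₁ : D₁.Cleaving) {x y : C₁} (f : x ⟶ y)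
    (Y : D₁.Fiber y) :
    D₂.Hom (F.map f) ((G.fiber x).obj ((c₁.reindex f).obj Y)).ob ((G.fiber y).obj Y).ob :=
  G.map (c₁.liftAt f Y)

/-- The component at `Y` of the comparison `(F f)^* (G Y) ⟶ G (f^* Y)`, for a Cartesian
displayed functor `G` over `F`. -/
noncomputable def reindexApp (G : DispFunctor F D₁ D₂) (hG : G.IsCartesian) (c₁ : D₁.Cleaving)
    (c₂ : D₂.Cleaving) {x y : C₁} (f : x ⟶ y) (Y : D₁.Fiber y) :
    (c₂.reindex (F.map f)).obj ((G.fiber y).obj Y) ⟶ (G.fiber x).obj ((c₁.reindex f).obj Y) :=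
  DispCat.FiberHom.mk (DispCat.IsCartesian.fac (a := G.mapLift c₁ f Y)
    (hG _ (c₁.liftAt_cartesian f Y)) (𝟙 _) (k := F.map f) (by simp)
    (c₂.liftAt (F.map f) ((G.fiber y).obj Y)))

theorem reindexApp_lift (G : DispFunctor F D₁ D₂) (hG : G.IsCartesian) (c₁ : D₁.Cleaving)
    (c₂ : D₂.Cleaving) {x y : C₁} (f : x ⟶ y) (Y : D₁.Fiber y) :
    D₂.tot (G.reindexApp hG c₁ c₂ f Y).hom ≫ D₂.tot (G.mapLift c₁ f Y) =
      D₂.tot (c₂.liftAt (F.map f) ((G.fiber y).obj Y)) :=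
  DispCat.IsCartesian.fac_tot (a := G.mapLift c₁ f Y) (hG _ (c₁.liftAt_cartesian f Y)) (𝟙 _) _ _

theorem reindexApp_lift_assoc (G : DispFunctor F D₁ D₂) (hG : G.IsCartesian) (c₁ : D₁.Cleaving)
    (c₂ : D₂.Cleaving) {x y : C₁} (f : x ⟶ y) (Y : D₁.Fiber y) {T : D₂.Tot}
    (t : (⟨F.obj y, ((G.fiber y).obj Y).ob⟩ : D₂.Tot) ⟶ T) :
    D₂.tot (G.reindexApp hG c₁ c₂ f Y).hom ≫ D₂.tot (G.mapLift c₁ f Y) ≫ t =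
      D₂.tot (c₂.liftAt (F.map f) ((G.fiber y).obj Y)) ≫ t := by
  rw [← Category.assoc, G.reindexApp_lift]

/-- For a Cartesian displayed functor `G` over `F` and a morphism `f : x ⟶ y`, the canonical
comparison `(F f)^* (G Y) ⟶ G (f^* Y)` (it is always invertible). -/
noncomputable def reindexSquare (G : DispFunctor F D₁ D₂) (hG : G.IsCartesian)
    (c₁ : D₁.Cleaving) (c₂ : D₂.Cleaving) {x y : C₁} (f : x ⟶ y) :
    G.fiber y ⋙ c₂.reindex (F.map f) ⟶ c₁.reindex f ⋙ G.fiber x where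
  app Y := G.reindexApp hG c₁ c₂ f Y
  naturality Y Z a := by
    refine DispCat.FiberHom.ext (DispCat.IsCartesian.hom_ext (a := G.mapLift c₁ f Z)
      (hG _ (c₁.liftAt_cartesian f Z)) ?_)
    dsimp only [Functor.comp_map]
    erw [DispCat.fiber_tot_comp, DispCat.fiber_tot_comp]
    rw [Category.assoc, Category.assoc, G.reindexApp_lift, c₂.reindex_map_lift,
      G.tot_fiber_map, G.tot_fiber_map]
    have h : G.total.map (D₁.tot ((c₁.reindex f).map a).hom) ≫ D₂.tot (G.mapLift c₁ f Z) =
        D₂.tot (G.mapLift c₁ f Y) ≫ G.total.map (D₁.tot a.hom) := by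
      change G.total.map _ ≫ G.total.map (D₁.tot (c₁.liftAt f Z)) =
        G.total.map (D₁.tot (c₁.liftAt f Y)) ≫ _
      rw [← Functor.map_comp, ← Functor.map_comp, c₁.reindex_map_lift]
    erw [h, G.reindexApp_lift_assoc]

end DispFunctor

/-- A displayed natural transformation over `τ`. -/
@[ext]
structure DispNatTrans {F G : C₁ ⥤ C₂} (τ : F ⟶ G) {D₁ : DispCat.{v, u} C₁}
    {D₂ : DispCat.{v, u} C₂} (F' : DispFunctor F D₁ D₂) (G' : DispFunctor G D₁ D₂) where
  app : ∀ {x : C₁} (X : D₁.Ob x), D₂.Hom (τ.app x) (F'.obj X) (G'.obj X)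
  naturality : ∀ {x y : C₁} {f : x ⟶ y} {X : D₁.Ob x} {Y : D₁.Ob y} (a : D₁.Hom f X Y),
    HEq (D₂.comp (F'.map a) (app Y)) (D₂.comp (app X) (G'.map a))

namespace DispNatTrans

variable {F G H : C₁ ⥤ C₂} {τ : F ⟶ G} {σ : G ⟶ H} {D₁ : DispCat.{v, u} C₁}
  {D₂ : DispCat.{v, u} C₂} {F' : DispFunctor F D₁ D₂} {G' : DispFunctor G D₁ D₂}
  {H' : DispFunctor H D₁ D₂}

theorem tot_naturality (t : DispNatTrans τ F' G') {x y : C₁} {f : x ⟶ y} {X : D₁.Ob x}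
    {Y : D₁.Ob y} (a : D₁.Hom f X Y) :
    D₂.tot (F'.map a) ≫ D₂.tot (t.app Y) = D₂.tot (t.app X) ≫ D₂.tot (G'.map a) :=
  DispCat.tot_of_heq (τ.naturality f) (t.naturality a)

theorem tot_naturality_assoc (t : DispNatTrans τ F' G') {x y : C₁} {f : x ⟶ y} {X : D₁.Ob x}
    {Y : D₁.Ob y} (a : D₁.Hom f X Y) {T : D₂.Tot} (s : (⟨G.obj y, G'.obj Y⟩ : D₂.Tot) ⟶ T) :
    D₂.tot (F'.map a) ≫ D₂.tot (t.app Y) ≫ s = D₂.tot (t.app X) ≫ D₂.tot (G'.map a) ≫ s := by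
  rw [← Category.assoc, t.tot_naturality, Category.assoc]

/-- The identity displayed natural transformation. -/
def id (F' : DispFunctor F D₁ D₂) : DispNatTrans (𝟙 F) F' F' where
  app X := D₂.id (F'.obj X)
  naturality a := DispCat.heq_of_tot (by simp)

/-- Vertical composition of displayed natural transformations. -/
def comp (t : DispNatTrans τ F' G') (s : DispNatTrans σ G' H') :
    DispNatTrans (τ ≫ σ) F' H' where
  app X := D₂.comp (t.app X) (s.app X)
  naturality a := DispCat.heq_of_tot (by
    simp [t.tot_naturality_assoc, s.tot_naturality])

/-- Whiskering on the left. -/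
def whiskerLeft {K : C₃ ⥤ C₁} {D₃ : DispCat.{v, u} C₃} (K' : DispFunctor K D₃ D₁)
    (t : DispNatTrans τ F' G') :
    DispNatTrans (Functor.whiskerLeft K τ) (K'.comp F') (K'.comp G') where
  app X := t.app (K'.obj X)
  naturality a := t.naturality (K'.map a)

/-- Whiskering on the right. -/
def whiskerRight {K : C₂ ⥤ C₃} {D₃ : DispCat.{v, u} C₃} (t : DispNatTrans τ F' G')
    (K' : DispFunctor K D₂ D₃) :
    DispNatTrans (Functor.whiskerRight τ K) (F'.comp K') (G'.comp K') where
  app X := K'.map (t.app X)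
  naturality a := DispCat.heq_of_tot (by
    have h := congrArg K'.total.map (t.tot_naturality a)
    rw [Functor.map_comp, Functor.map_comp] at h
    exact h)

end DispNatTrans

end Functors

/-! ### The arrow category -/

section Arrow

variable (C : Type u) [Category.{v} C]

variable {C} in
/-- An object over `y` of the arrow category: a morphism with codomain `y`. -/
structure ArrOb (y : C) : Type (max u v) where
  dom : C
  hom : dom ⟶ y

variable {C} in
/-- A morphism over `f` of the arrow category: a commuting square with `f` as lower side. -/
@[ext]
structure ArrHom {x y : C} (f : x ⟶ y) (g : ArrOb x) (h : ArrOb y) : Type v where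
  top : g.dom ⟶ h.dom
  comm : top ≫ h.hom = g.hom ≫ f

variable {C} in
theorem arrHom_heq {x y : C} {f f' : x ⟶ y} (e : f = f') {g : ArrOb x} {h : ArrOb y}
    {a : ArrHom f g h} {b : ArrHom f' g h} (w : a.top = b.top) : HEq a b := by
  subst e
  exact heq_of_eq (ArrHom.ext w)

/-- The displayed category of arrows of `C`, over their codomain. -/
def arrDisp : DispCat.{v, u} C where
  Ob y := ArrOb y
  Hom f g h := ArrHom f g h
  id X := ⟨𝟙 _, by simp⟩
  comp a b := ⟨a.top ≫ b.top, by rw [Category.assoc, b.comm, ← Category.assoc, a.comm,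
    Category.assoc]⟩
  id_comp a := arrHom_heq (Category.id_comp _) (Category.id_comp _)
  comp_id a := arrHom_heq (Category.comp_id _) (Category.comp_id _)
  assoc a b c := arrHom_heq (Category.assoc _ _ _) (Category.assoc _ _ _)

variable {C} {C' : Type u} [Category.{v} C']

/-- The displayed functor between arrow categories induced by a functor. -/
def arrFunctor (F : C ⥤ C') : DispFunctor F (arrDisp C) (arrDisp C') where
  obj X := ArrOb.mk (F.obj X.dom) (F.map X.hom)
  map a := ArrHom.mk (F.map a.top) (by
    dsimp only
    rw [← F.map_comp, a.comm, F.map_comp])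
  map_id X := arrHom_heq (F.map_id _) (F.map_id _)
  map_comp a b := arrHom_heq (F.map_comp _ _) (F.map_comp _ _)

/-- The displayed natural transformation between the displayed functors on arrows induced by a
natural transformation. -/
def arrNatTrans {F G : C ⥤ C'} (τ : F ⟶ G) :
    DispNatTrans τ (arrFunctor F) (arrFunctor G) where
  app X := ArrHom.mk (τ.app X.dom) (τ.naturality X.hom).symm
  naturality a := arrHom_heq (τ.naturality _) (τ.naturality a.top)

theorem arr_isCartesian_iff {x y : C} {f : x ⟶ y} {X : ArrOb x} {Y : ArrOb y}
    (a : ArrHom f X Y) :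
    DispCat.IsCartesian (D := arrDisp C) a ↔ IsPullback a.top X.hom Y.hom f := by
  constructor
  · intro h
    refine ⟨⟨a.comm⟩, ⟨PullbackCone.IsLimit.mk _ (fun s => ?_) ?_ ?_ ?_⟩⟩
    · exact ((h (W := ArrOb.mk s.pt (𝟙 _)) s.snd
        (ArrHom.mk s.fst (by dsimp; rw [s.condition]; simp))).choose).top
    · intro s
      exact congrArg ArrHom.top ((h (W := ArrOb.mk s.pt (𝟙 _)) s.snd
        (ArrHom.mk s.fst (by dsimp; rw [s.condition]; simp))).choose_spec.1)
    · intro s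
      simpa using ((h (W := ArrOb.mk s.pt (𝟙 _)) s.snd
        (ArrHom.mk s.fst (by dsimp; rw [s.condition]; simp))).choose).comm
    · intro s m h₁ h₂
      exact congrArg ArrHom.top ((h (W := ArrOb.mk s.pt (𝟙 _)) s.snd
        (ArrHom.mk s.fst (by dsimp; rw [s.condition]; simp))).choose_spec.2
          (ArrHom.mk m (by dsimp; rw [h₂]; simp)) (ArrHom.ext h₁))
  · intro h w W g b
    have e : b.top ≫ Y.hom = (W.hom ≫ g) ≫ f := by rw [b.comm, Category.assoc]
    refine ⟨ArrHom.mk (h.lift b.top (W.hom ≫ g) e) (h.lift_snd _ _ _),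
      ArrHom.ext (h.lift_fst _ _ _), ?_⟩
    intro k hk
    refine ArrHom.ext (h.hom_ext ?_ ?_)
    · rw [h.lift_fst]
      exact congrArg ArrHom.top hk
    · rw [h.lift_snd]
      exact k.comm

/-- In a category with pullbacks the arrow category has a cleaving. -/
noncomputable def arrCleaving [HasPullbacks C] : (arrDisp C).Cleaving where
  obj f Y := ArrOb.mk (pullback Y.hom f) (pullback.snd Y.hom f)
  lift f Y := ArrHom.mk (pullback.fst Y.hom f) pullback.condition
  cartesian f Y := (arr_isCartesian_iff _).2 (IsPullback.of_hasPullback Y.hom f)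

theorem arrFunctor_isCartesian (F : C ⥤ C') [PreservesLimitsOfShape WalkingCospan F] :
    (arrFunctor F).IsCartesian := by
  intro x y f X Y a h
  exact (arr_isCartesian_iff _).2 (((arr_isCartesian_iff a).1 h).map F)

end Arrow

/-! ### Comprehension categories -/

/-- A comprehension category: a category with a terminal object, a displayed category over it with
a cleaving, and a Cartesian displayed functor (over the identity) to the arrow category. -/
structure CompCat where
  base : Cat.{v, u}
  hasTerminal : HasTerminal base
  types : DispCat.{v, u} base
  cleaving : types.Cleaving
  compr : DispFunctor (𝟭 base) types (arrDisp base)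
  compr_cartesian : compr.IsCartesian

namespace CompCat

variable (X : CompCat.{v, u})

/-- Context extension. -/
def ext {Γ : X.base} (A : X.types.Ob Γ) : X.base := ArrOb.dom (X.compr.obj A)

/-- The projection of a context extension. -/
def pr {Γ : X.base} (A : X.types.Ob Γ) : X.ext A ⟶ Γ := ArrOb.hom (X.compr.obj A)

/-- The action of the comprehension functor on morphisms. -/
def extMap {Γ Γ' : X.base} {f : Γ ⟶ Γ'} {A : X.types.Ob Γ} {B : X.types.Ob Γ'}
    (a : X.types.Hom f A B) : X.ext A ⟶ X.ext B :=
  ArrHom.top (X.compr.map a)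

@[simp]
theorem extMap_id {Γ : X.base} (A : X.types.Ob Γ) : X.extMap (X.types.id A) = 𝟙 _ :=
  congrArg ArrHom.top (eq_of_heq (X.compr.map_id A))

@[simp]
theorem extMap_comp {Γ Γ' Γ'' : X.base} {f : Γ ⟶ Γ'} {g : Γ' ⟶ Γ''} {A : X.types.Ob Γ}
    {B : X.types.Ob Γ'} {C : X.types.Ob Γ''} (a : X.types.Hom f A B) (b : X.types.Hom g B C) :
    X.extMap (X.types.comp a b) = X.extMap a ≫ X.extMap b :=
  congrArg ArrHom.top (eq_of_heq (X.compr.map_comp a b))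

theorem extMap_pr {Γ Γ' : X.base} {f : Γ ⟶ Γ'} {A : X.types.Ob Γ} {B : X.types.Ob Γ'}
    (a : X.types.Hom f A B) : X.extMap a ≫ X.pr B = X.pr A ≫ f :=
  (X.compr.map a).comm

/-- A lax morphism of comprehension categories: a functor preserving terminal objects, a Cartesian
displayed functor over it, and a displayed natural transformation (over the identity) from
`X.compr` followed by the functor on arrows to the displayed functor followed by `Y.compr`.
The latter is given by its components `F (Γ.A) ⟶ (F Γ).(F A)`. -/
structure LaxHom (X Y : CompCat.{v, u}) where
  functor : X.base ⥤ Y.base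
  preservesTerminal : PreservesLimit (Functor.empty.{0} X.base) functor
  disp : DispFunctor functor X.types Y.types
  cartesian : disp.IsCartesian
  comparison : ∀ {Γ : X.base} (A : X.types.Ob Γ),
    functor.obj (X.ext A) ⟶ Y.ext (disp.obj A)
  comparison_pr : ∀ {Γ : X.base} (A : X.types.Ob Γ),
    comparison A ≫ Y.pr (disp.obj A) = functor.map (X.pr A)
  comparison_naturality : ∀ {Γ Γ' : X.base} {f : Γ ⟶ Γ'} {A : X.types.Ob Γ} {B : X.types.Ob Γ'}
    (a : X.types.Hom f A B),
    functor.map (X.extMap a) ≫ comparison B = comparison A ≫ Y.extMap (disp.map a)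

/-- A 2-cell of comprehension categories: a natural transformation and a displayed natural
transformation over it, compatible with the comparison cells. -/
structure Cell {X Y : CompCat.{v, u}} (S T : LaxHom X Y) where
  trans : S.functor ⟶ T.functor
  disp : DispNatTrans trans S.disp T.disp
  comm : ∀ {Γ : X.base} (A : X.types.Ob Γ),
    S.comparison A ≫ Y.extMap (disp.app A) = trans.app (X.ext A) ≫ T.comparison A

variable {X} {Y Z W : CompCat.{v, u}}

theorem Cell.ext' {S T : LaxHom X Y} {s t : Cell S T} (h₁ : ∀ Γ, s.trans.app Γ = t.trans.app Γ)
    (h₂ : ∀ (Γ : X.base) (A : X.types.Ob Γ),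
      Y.types.tot (s.disp.app A) = Y.types.tot (t.disp.app A)) : s = t := by
  obtain ⟨s₁, s₂, s₃⟩ := s
  obtain ⟨t₁, t₂, t₃⟩ := t
  have e : s₁ = t₁ := by
    ext Γ
    exact h₁ Γ
  subst e
  have e' : s₂ = t₂ := by
    ext Γ A
    exact DispCat.tot_inj (h₂ Γ A)
  subst e'
  rfl

/-- The category of lax morphisms and 2-cells. -/
instance : Category (LaxHom X Y) where
  Hom S T := Cell S T
  id S := ⟨𝟙 _, DispNatTrans.id _, fun A => by simp [DispNatTrans.id]⟩
  comp s t := ⟨s.trans ≫ t.trans, s.disp.comp t.disp, fun A => by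
    simp only [DispNatTrans.comp, extMap_comp, NatTrans.comp_app, Category.assoc]
    rw [← t.comm, ← Category.assoc, s.comm, Category.assoc]⟩
  id_comp s := Cell.ext' (fun _ => by simp) (fun _ _ => by
    simp [DispNatTrans.comp, DispNatTrans.id])
  comp_id s := Cell.ext' (fun _ => by simp) (fun _ _ => by
    simp [DispNatTrans.comp, DispNatTrans.id])
  assoc s t r := Cell.ext' (fun _ => by simp) (fun _ _ => by
    simp [DispNatTrans.comp])

/-- The identity morphism. -/
def LaxHom.id (X : CompCat.{v, u}) : LaxHom X X where
  functor := 𝟭 _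
  preservesTerminal := inferInstance
  disp := DispFunctor.id _
  cartesian _ _ _ _ _ _ h := h
  comparison A := 𝟙 (X.ext A)
  comparison_pr _ := Category.id_comp _
  comparison_naturality _ := (Category.comp_id _).trans (Category.id_comp _).symm

/-- Composition of lax morphisms. -/
def LaxHom.comp (S : LaxHom X Y) (T : LaxHom Y Z) : LaxHom X Z where
  functor := S.functor ⋙ T.functor
  preservesTerminal := by
    have := S.preservesTerminal
    have := T.preservesTerminal
    have : PreservesLimit (Functor.empty.{0} X.base ⋙ S.functor) T.functor :=
      preservesLimit_of_iso_diagram T.functor (Functor.emptyExt (Functor.empty.{0} Y.base) _)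
    infer_instance
  disp := S.disp.comp T.disp
  cartesian _ _ _ _ _ a h := T.cartesian _ (S.cartesian a h)
  comparison A := T.functor.map (S.comparison A) ≫ T.comparison (S.disp.obj A)
  comparison_pr A := by
    change (_ ≫ _) ≫ Z.pr (T.disp.obj (S.disp.obj A)) = T.functor.map (S.functor.map (X.pr A))
    rw [Category.assoc, T.comparison_pr, ← Functor.map_comp, S.comparison_pr]
  comparison_naturality {Γ Γ' f A B} a := by
    change T.functor.map (S.functor.map (X.extMap a)) ≫ _ ≫ _ =
      (_ ≫ _) ≫ Z.extMap (T.disp.map (S.disp.map a))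
    rw [Category.assoc, ← T.comparison_naturality, ← Category.assoc, ← Functor.map_comp,
      S.comparison_naturality, Functor.map_comp, Category.assoc]

/-- Left whiskering of 2-cells. -/
def Cell.whiskerLeft (S : LaxHom X Y) {T U : LaxHom Y Z} (t : Cell T U) :
    Cell (S.comp T) (S.comp U) where
  trans := Functor.whiskerLeft S.functor t.trans
  disp := DispNatTrans.whiskerLeft S.disp t.disp
  comm A := by
    change (T.functor.map _ ≫ T.comparison (S.disp.obj A)) ≫ Z.extMap (t.disp.app (S.disp.obj A)) =
      t.trans.app (S.functor.obj (X.ext A)) ≫ U.functor.map _ ≫ U.comparison (S.disp.obj A)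
    rw [Category.assoc, t.comm, NatTrans.naturality_assoc]

/-- Right whiskering of 2-cells. -/
def Cell.whiskerRight {S T : LaxHom X Y} (s : Cell S T) (U : LaxHom Y Z) :
    Cell (S.comp U) (T.comp U) where
  trans := Functor.whiskerRight s.trans U.functor
  disp := DispNatTrans.whiskerRight s.disp U.disp
  comm A := by
    change (U.functor.map _ ≫ U.comparison (S.disp.obj A)) ≫ Z.extMap (U.disp.map (s.disp.app A)) =
      U.functor.map (s.trans.app (X.ext A)) ≫ U.functor.map _ ≫ U.comparison (T.disp.obj A)
    rw [Category.assoc, ← U.comparison_naturality, ← Category.assoc, ← Functor.map_comp, s.comm,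
      Functor.map_comp, Category.assoc]

theorem map_comp_comp {C₁ C₂ : Type*} [Category* C₁] [Category* C₂] (U : C₁ ⥤ C₂) {a b c : C₁}
    {d : C₂} (p : a ⟶ b) (q : b ⟶ c) (r : U.obj c ⟶ d) :
    U.map (p ≫ q) ≫ r = U.map p ≫ U.map q ≫ r := by
  simp

theorem comp_id_eq {C₁ : Type*} [Category* C₁] {a b : C₁} {p q : a ⟶ b} (h : p = q) :
    p ≫ 𝟙 b = 𝟙 a ≫ q := by
  simp [h]

/-- The associator. -/
def associator (S : LaxHom X Y) (T : LaxHom Y Z) (U : LaxHom Z W) :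
    (S.comp T).comp U ≅ S.comp (T.comp U) where
  hom := Cell.mk (S := (S.comp T).comp U) (T := S.comp (T.comp U))
    (Functor.associator S.functor T.functor U.functor).hom
    (DispNatTrans.id ((S.disp.comp T.disp).comp U.disp)) (fun A => by
      change (U.functor.map (T.functor.map _ ≫ _) ≫ _) ≫ W.extMap (W.types.id _) =
        𝟙 _ ≫ U.functor.map (T.functor.map _) ≫ U.functor.map _ ≫ _
      rw [extMap_id]
      exact comp_id_eq (map_comp_comp U.functor _ _ _))
  inv := Cell.mk (T := (S.comp T).comp U) (S := S.comp (T.comp U))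
    (Functor.associator S.functor T.functor U.functor).inv
    (DispNatTrans.id ((S.disp.comp T.disp).comp U.disp)) (fun A => by
      change (U.functor.map (T.functor.map _) ≫ U.functor.map _ ≫ _) ≫ W.extMap (W.types.id _) =
        𝟙 _ ≫ U.functor.map (T.functor.map _ ≫ _) ≫ _
      rw [extMap_id]
      exact comp_id_eq (map_comp_comp U.functor _ _ _).symm)
  hom_inv_id := Cell.ext' (fun _ => Category.id_comp (𝟙 _))
    (fun _ A => Category.id_comp (𝟙 (⟨_, U.disp.obj (T.disp.obj (S.disp.obj A))⟩ : W.types.Tot)))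
  inv_hom_id := Cell.ext' (fun _ => Category.id_comp (𝟙 _))
    (fun _ A => Category.id_comp (𝟙 (⟨_, U.disp.obj (T.disp.obj (S.disp.obj A))⟩ : W.types.Tot)))

/-- The left unitor. -/
def leftUnitor (S : LaxHom X Y) : (LaxHom.id X).comp S ≅ S where
  hom := Cell.mk (S := (LaxHom.id X).comp S) (T := S) (Functor.leftUnitor S.functor).hom
    (DispNatTrans.id S.disp) (fun A => by
      change (S.functor.map (𝟙 _) ≫ _) ≫ Y.extMap (Y.types.id _) = 𝟙 _ ≫ _
      rw [extMap_id, CategoryTheory.Functor.map_id]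
      exact comp_id_eq (Category.id_comp _))
  inv := Cell.mk (T := (LaxHom.id X).comp S) (S := S) (Functor.leftUnitor S.functor).inv
    (DispNatTrans.id S.disp) (fun A => by
      change _ ≫ Y.extMap (Y.types.id _) = 𝟙 _ ≫ S.functor.map (𝟙 _) ≫ _
      rw [extMap_id, CategoryTheory.Functor.map_id]
      exact comp_id_eq (Category.id_comp _).symm)
  hom_inv_id := Cell.ext' (fun _ => Category.id_comp (𝟙 _))
    (fun _ A => Category.id_comp (𝟙 (⟨_, S.disp.obj A⟩ : Y.types.Tot)))
  inv_hom_id := Cell.ext' (fun _ => Category.id_comp (𝟙 _))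
    (fun _ A => Category.id_comp (𝟙 (⟨_, S.disp.obj A⟩ : Y.types.Tot)))

/-- The right unitor. -/
def rightUnitor (S : LaxHom X Y) : S.comp (LaxHom.id Y) ≅ S where
  hom := Cell.mk (S := S.comp (LaxHom.id Y)) (T := S) (Functor.rightUnitor S.functor).hom
    (DispNatTrans.id S.disp) (fun A => by
      change (S.comparison A ≫ 𝟙 _) ≫ Y.extMap (Y.types.id _) = 𝟙 _ ≫ _
      rw [extMap_id]
      exact comp_id_eq (Category.comp_id _))
  inv := Cell.mk (T := S.comp (LaxHom.id Y)) (S := S) (Functor.rightUnitor S.functor).inv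
    (DispNatTrans.id S.disp) (fun A => by
      change _ ≫ Y.extMap (Y.types.id _) = 𝟙 _ ≫ (S.comparison A ≫ 𝟙 _)
      rw [extMap_id]
      exact comp_id_eq (Category.comp_id _).symm)
  hom_inv_id := Cell.ext' (fun _ => Category.id_comp (𝟙 _))
    (fun _ A => Category.id_comp (𝟙 (⟨_, S.disp.obj A⟩ : Y.types.Tot)))
  inv_hom_id := Cell.ext' (fun _ => Category.id_comp (𝟙 _))
    (fun _ A => Category.id_comp (𝟙 (⟨_, S.disp.obj A⟩ : Y.types.Tot)))

theorem id_comp_comp_id {C₁ : Type*} [Category* C₁] {a b : C₁} (p : a ⟶ b) :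
    p = 𝟙 a ≫ p ≫ 𝟙 b := by
  simp

theorem pentagon_aux {C₁ : Type*} [Category* C₁] {a : C₁} {p : a ⟶ a} (h : p = 𝟙 a) :
    p ≫ 𝟙 a ≫ 𝟙 a = 𝟙 a ≫ 𝟙 a := by
  simp [h]

theorem triangle_aux {C₁ : Type*} [Category* C₁] {a : C₁} {p : a ⟶ a} (h : p = 𝟙 a) :
    𝟙 a ≫ 𝟙 a = p := by
  simp [h]

/-- The bicategory of comprehension categories, lax morphisms and 2-cells. -/
instance : Bicategory CompCat.{v, u} where
  Hom X Y := LaxHom X Y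
  id X := LaxHom.id X
  comp S T := LaxHom.comp S T
  whiskerLeft {_ _ _} S {_ _} t := Cell.whiskerLeft S t
  whiskerRight {_ _ _} {_ _} s U := Cell.whiskerRight s U
  associator S T U := associator S T U
  leftUnitor S := leftUnitor S
  rightUnitor S := rightUnitor S
  whiskerLeft_id _ _ := Cell.ext' (fun _ => rfl) (fun _ _ => rfl)
  whiskerLeft_comp _ _ _ _ _ _ := Cell.ext' (fun _ => rfl) (fun _ _ => rfl)
  id_whiskerLeft η := Cell.ext' (fun _ => id_comp_comp_id ((Cell.trans η).app _))
    (fun _ _ => id_comp_comp_id (DispCat.tot _ ((Cell.disp η).app _)))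
  comp_whiskerLeft _ _ _ _ η := Cell.ext' (fun _ => id_comp_comp_id ((Cell.trans η).app _))
    (fun _ _ => id_comp_comp_id (DispCat.tot _ ((Cell.disp η).app _)))
  id_whiskerRight _ U := Cell.ext' (fun _ => U.functor.map_id _) (fun _ _ => U.disp.tot_map_id _)
  comp_whiskerRight s t U := Cell.ext' (fun _ => U.functor.map_comp _ _)
    (fun _ _ => U.disp.tot_map_comp _ _)
  whiskerRight_id η := Cell.ext' (fun _ => id_comp_comp_id ((Cell.trans η).app _))
    (fun _ _ => id_comp_comp_id (DispCat.tot _ ((Cell.disp η).app _)))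
  whiskerRight_comp η S T := Cell.ext'
    (fun _ => id_comp_comp_id (T.functor.map (S.functor.map ((Cell.trans η).app _))))
    (fun _ _ => id_comp_comp_id (DispCat.tot _ (T.disp.map (S.disp.map ((Cell.disp η).app _)))))
  whisker_assoc S _ _ η T := Cell.ext'
    (fun _ => id_comp_comp_id (T.functor.map ((Cell.trans η).app _)))
    (fun _ _ => id_comp_comp_id (DispCat.tot _ (T.disp.map ((Cell.disp η).app _))))
  whisker_exchange s t := Cell.ext' (fun _ => ((Cell.trans t).naturality _).symm)
    (fun _ _ => ((Cell.disp t).tot_naturality _).symm)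
  pentagon S T U V := Cell.ext'
    (fun _ => pentagon_aux (V.functor.map_id _)) (fun _ _ => pentagon_aux (V.disp.tot_map_id _))
  triangle {_ b c} S T := by
    refine Cell.ext' (fun _ => triangle_aux (T.functor.map_id _)) (fun _ A => ?_)
    change 𝟙 (⟨_, T.disp.obj (S.disp.obj A)⟩ : c.types.Tot) ≫ 𝟙 _ =
      c.types.tot (T.disp.map (b.types.id (S.disp.obj A)))
    exact triangle_aux (T.disp.tot_map_id (S.disp.obj A))

end CompCat

/-! ### Bicategories of objects with properties -/

section SubBicategory

universe w₁ v₁ u₁ w₂ v₂ u₂ w₃ v₃ u₃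

/-- Data for a displayed bicategory whose displayed objects and displayed 1-cells are propositions
and whose displayed 2-cells are trivial: a property of objects, and a property of
1-cells that is closed under identities and composition. -/
structure SubData (B : Type u₁) [Bicategory.{w₁, v₁} B] where
  P : B → Prop
  Q : ∀ {x y : B}, (x ⟶ y) → Prop
  id : ∀ {x : B}, P x → Q (𝟙 x)
  comp : ∀ {x y z : B} {f : x ⟶ y} {g : y ⟶ z}, P x → P y → P z → Q f → Q g → Q (f ≫ g)

variable {B : Type u₁} [Bicategory.{w₁, v₁} B] {C : Type u₂} [Bicategory.{w₂, v₂} C]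
  {B' : Type u₃} [Bicategory.{w₃, v₃} B']

/-- The property of all 1-cells. -/
def SubData.full (P : B → Prop) : SubData B where
  P := P
  Q _ := True
  id _ := trivial
  comp _ _ _ _ _ := trivial

/-- The product of displayed bicategories. -/
def SubData.prod (S T : SubData B) : SubData B where
  P x := S.P x ∧ T.P x
  Q f := S.Q f ∧ T.Q f
  id h := ⟨S.id h.1, T.id h.2⟩
  comp hx hy hz hf hg := ⟨S.comp hx.1 hy.1 hz.1 hf.1 hg.1, T.comp hx.2 hy.2 hz.2 hf.2 hg.2⟩

/-- The objects of the total bicategory of a `SubData`. -/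
structure SubBicat (S : SubData B) where
  obj : B
  prop : S.P obj

theorem assoc_aux {a b c d : B} (f : a ⟶ b) (g : b ⟶ c) (h : c ⟶ d) :
    (α_ f g h).hom = 𝟙 ((f ≫ g) ≫ h) ≫ 𝟙 (f ≫ g) ▷ h ≫ (α_ f g h).hom ≫ f ◁ 𝟙 (g ≫ h) ≫
      𝟙 (f ≫ g ≫ h) := by
  simp

theorem left_unitor_aux {a b : B} (f : a ⟶ b) :
    (λ_ f).hom = 𝟙 (𝟙 a ≫ f) ≫ 𝟙 (𝟙 a) ▷ f ≫ (λ_ f).hom := by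
  simp

theorem right_unitor_aux {a b : B} (f : a ⟶ b) :
    (ρ_ f).hom = 𝟙 (f ≫ 𝟙 b) ≫ f ◁ 𝟙 (𝟙 b) ≫ (ρ_ f).hom := by
  simp

namespace SubBicat

/-- The 1-cells of the total bicategory. -/
structure Hom {S : SubData B} (X Y : SubBicat S) where
  hom : X.obj ⟶ Y.obj
  prop : S.Q hom

variable {S : SubData B}

instance : CategoryStruct (SubBicat S) where
  Hom X Y := Hom X Y
  id X := ⟨𝟙 X.obj, S.id X.prop⟩
  comp {X Y Z} f g := ⟨f.hom ≫ g.hom, S.comp X.prop Y.prop Z.prop f.prop g.prop⟩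

/-- The 2-cells of the total bicategory. -/
@[ext]
structure Hom₂ {X Y : SubBicat S} (f g : X ⟶ Y) where
  hom : f.hom ⟶ g.hom

@[simps]
instance (X Y : SubBicat S) : Category (X ⟶ Y) where
  Hom f g := Hom₂ f g
  id f := ⟨𝟙 f.hom⟩
  comp u v := ⟨u.hom ≫ v.hom⟩

@[ext]
theorem hom₂_ext {X Y : SubBicat S} {f g : X ⟶ Y} {η θ : f ⟶ g} (h : η.hom = θ.hom) : η = θ :=
  Hom₂.ext h

/-- Invertible 2-cells of the total bicategory. -/
@[simps]
def isoMk {X Y : SubBicat S} {f g : X ⟶ Y} (φ : f.hom ≅ g.hom) : f ≅ g where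
  hom := ⟨φ.hom⟩
  inv := ⟨φ.inv⟩

/-- The total bicategory of a `SubData`. -/
instance : Bicategory (SubBicat S) where
  whiskerLeft h _ _ η := Hom₂.mk (Hom.hom h ◁ Hom₂.hom η)
  whiskerRight η h := Hom₂.mk (Hom₂.hom η ▷ Hom.hom h)
  associator f g h := isoMk (α_ (Hom.hom f) (Hom.hom g) (Hom.hom h))
  leftUnitor f := isoMk (λ_ (Hom.hom f))
  rightUnitor f := isoMk (ρ_ (Hom.hom f))
  whiskerLeft_id f g := Hom₂.ext (whiskerLeft_id (Hom.hom f) (Hom.hom g))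
  whiskerLeft_comp f _ _ _ η θ :=
    Hom₂.ext (whiskerLeft_comp (Hom.hom f) (Hom₂.hom η) (Hom₂.hom θ))
  id_whiskerLeft η := Hom₂.ext (id_whiskerLeft (Hom₂.hom η))
  comp_whiskerLeft f g _ _ η :=
    Hom₂.ext (comp_whiskerLeft (Hom.hom f) (Hom.hom g) (Hom₂.hom η))
  id_whiskerRight f g := Hom₂.ext (id_whiskerRight (Hom.hom f) (Hom.hom g))
  comp_whiskerRight η θ i :=
    Hom₂.ext (comp_whiskerRight (Hom₂.hom η) (Hom₂.hom θ) (Hom.hom i))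
  whiskerRight_id η := Hom₂.ext (whiskerRight_id (Hom₂.hom η))
  whiskerRight_comp η g h := Hom₂.ext (whiskerRight_comp (Hom₂.hom η) (Hom.hom g) (Hom.hom h))
  whisker_assoc f _ _ η h := Hom₂.ext (whisker_assoc (Hom.hom f) (Hom₂.hom η) (Hom.hom h))
  whisker_exchange η θ := Hom₂.ext (whisker_exchange (Hom₂.hom η) (Hom₂.hom θ))
  pentagon f g h i := Hom₂.ext (pentagon (Hom.hom f) (Hom.hom g) (Hom.hom h) (Hom.hom i))
  triangle f g := Hom₂.ext (triangle (Hom.hom f) (Hom.hom g))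

variable (S) in
/-- The forgetful pseudofunctor. -/
def forget : SubBicat S ⥤ᵖ B where
  obj X := X.obj
  map f := Hom.hom f
  map₂ η := Hom₂.hom η
  map₂_id _ := rfl
  map₂_comp _ _ := rfl
  mapId X := Iso.refl (𝟙 X.obj)
  mapComp f g := Iso.refl (Hom.hom f ≫ Hom.hom g)
  map₂_whisker_left f _ _ η := CompCat.id_comp_comp_id (Hom.hom f ◁ Hom₂.hom η)
  map₂_whisker_right η h := CompCat.id_comp_comp_id (Hom₂.hom η ▷ Hom.hom h)
  map₂_associator f g h := assoc_aux (Hom.hom f) (Hom.hom g) (Hom.hom h)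
  map₂_left_unitor f := left_unitor_aux (Hom.hom f)
  map₂_right_unitor f := right_unitor_aux (Hom.hom f)

/-- `F` sends all objects and 1-cells to objects and 1-cells of the bicategory given by `T`. -/
structure Lifts (F : B ⥤ᵖ C) (T : SubData C) : Prop where
  obj : ∀ x, T.P (F.obj x)
  map : ∀ {x y : B} (f : x ⟶ y), T.Q (F.map f)

/-- The pseudofunctor to a bicategory of objects with properties induced by `F`. -/
def lift (F : B ⥤ᵖ C) {T : SubData C} (h : Lifts F T) : B ⥤ᵖ SubBicat T where
  obj x := ⟨F.obj x, h.obj x⟩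
  map f := ⟨F.map f, h.map f⟩
  map₂ η := Hom₂.mk (F.map₂ η)
  map₂_id f := Hom₂.ext (F.map₂_id f)
  map₂_comp η θ := Hom₂.ext (F.map₂_comp η θ)
  mapId x := isoMk (F.mapId x)
  mapComp f g := isoMk (F.mapComp f g)
  map₂_whisker_left f _ _ η := Hom₂.ext (F.map₂_whisker_left f η)
  map₂_whisker_right η h := Hom₂.ext (F.map₂_whisker_right η h)
  map₂_associator f g h := Hom₂.ext (F.map₂_associator f g h)
  map₂_left_unitor f := Hom₂.ext (F.map₂_left_unitor f)
  map₂_right_unitor f := Hom₂.ext (F.map₂_right_unitor f)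

end SubBicat

/-! ### Biequivalences -/

open scoped CategoryTheory.Pseudofunctor.StrongTrans

/-- A biequivalence given by the pseudofunctors `F` and `G`: adjoint equivalences
`𝟙 ≌ F ∘ G` and `G ∘ F ≌ 𝟙` in the bicategories of pseudofunctors, pseudonatural
transformations and modifications (`G.comp F` is first `G`, then `F`). -/
structure Biequivalence (F : B ⥤ᵖ C) (G : C ⥤ᵖ B) where
  unit : Pseudofunctor.id C ≌ G.comp F
  counit : F.comp G ≌ Pseudofunctor.id B

variable {F : B ⥤ᵖ C} {G : C ⥤ᵖ B}

/-- A displayed biequivalence over the biequivalence `e`, between the displayed bicategories given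
by `S` and `T`: displayed pseudofunctors over `F` and `G`, and displayed pointwise adjoint
equivalences over the unit and the counit of `e`. As displayed objects and 1-cells are
propositions and displayed 2-cells are trivial, all of these are properties. -/
structure DispBiequivalence (e : Biequivalence F G) (S : SubData B) (T : SubData C) : Prop where
  obj : ∀ {x : B}, S.P x → T.P (F.obj x)
  map : ∀ {x y : B} {f : x ⟶ y}, S.P x → S.P y → S.Q f → T.Q (F.map f)
  invObj : ∀ {x : C}, T.P x → S.P (G.obj x)
  invMap : ∀ {x y : C} {f : x ⟶ y}, T.P x → T.P y → T.Q f → S.Q (G.map f)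
  unit : ∀ {x : C}, T.P x → T.Q (e.unit.hom.app x)
  unitInv : ∀ {x : C}, T.P x → T.Q (e.unit.inv.app x)
  counit : ∀ {x : B}, S.P x → S.Q (e.counit.hom.app x)
  counitInv : ∀ {x : B}, S.P x → S.Q (e.counit.inv.app x)

namespace DispBiequivalence

variable {e : Biequivalence F G} {S : SubData B} {T : SubData C}

/-- The total pseudofunctor over `F`. -/
def total (d : DispBiequivalence e S T) : SubBicat S ⥤ᵖ SubBicat T :=
  SubBicat.lift ((SubBicat.forget S).comp F)
    ⟨fun x => d.obj (SubBicat.prop x), fun {x y} f =>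
      d.map (SubBicat.prop x) (SubBicat.prop y) (SubBicat.Hom.prop f)⟩

/-- The total pseudofunctor over `G`. -/
def totalInv (d : DispBiequivalence e S T) : SubBicat T ⥤ᵖ SubBicat S :=
  SubBicat.lift ((SubBicat.forget T).comp G)
    ⟨fun x => d.invObj (SubBicat.prop x), fun {x y} f =>
      d.invMap (SubBicat.prop x) (SubBicat.prop y) (SubBicat.Hom.prop f)⟩

/-- A biequivalence between the total bicategories lies over the biequivalence `e`: the components
of the unit and of the counit and of their inverses are those of `e`. (The pseudofunctors
`d.total` and `d.totalInv` lie over `F` and `G` by definition.) -/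
structure LiesOver {d : DispBiequivalence e S T} (E : Biequivalence d.total d.totalInv) : Prop where
  unit : ∀ x, SubBicat.Hom.hom (E.unit.hom.app x) = e.unit.hom.app x.obj
  unitInv : ∀ x, SubBicat.Hom.hom (E.unit.inv.app x) = e.unit.inv.app x.obj
  counit : ∀ x, SubBicat.Hom.hom (E.counit.hom.app x) = e.counit.hom.app x.obj
  counitInv : ∀ x, SubBicat.Hom.hom (E.counit.inv.app x) = e.counit.inv.app x.obj

end DispBiequivalence

end SubBicategory

/-! ### The arrow and base pseudofunctors -/

open scoped CategoryTheory.Pseudofunctor.StrongTrans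

/-- A category is univalent if every isomorphism comes from a unique equality of objects. -/
def IsUnivalent (C : Type u) [Category.{v} C] : Prop :=
  ∀ x y : C, Function.Bijective (fun e : x = y => (eqToIso e : x ≅ y))

/-- The two readings of "category" that are considered: arbitrary categories, up to equivalence,
and categories in which isomorphic objects are literally equal, in a unique way. -/
inductive CatKind
  | arbitrary
  | univalent

/-- `C` is a category of the given kind. -/
def CatKind.Holds : CatKind → ∀ (C : Type u) [Category.{v} C], Prop
  | .arbitrary, _, _ => True
  | .univalent, C, _ => IsUnivalent C

/-- Categories with finite limits, and functors that preserve finite limits. -/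
def finLimData (k : CatKind) : SubData Cat.{v, u} where
  P C := HasFiniteLimits C ∧ k.Holds C
  Q F := PreservesFiniteLimits F.toFunctor
  id _ := inferInstanceAs (PreservesFiniteLimits (𝟭 _))
  comp {_ _ _ F G} _ _ _ hF hG := by
    have := hF
    have := hG
    exact inferInstanceAs (PreservesFiniteLimits (F.toFunctor ⋙ G.toFunctor))

/-- The bicategory of categories with finite limits. -/
abbrev FinLim (k : CatKind) := SubBicat (finLimData.{v, u} k)

instance {k : CatKind} (C : FinLim.{v, u} k) : HasFiniteLimits C.obj := C.prop.1

instance {k : CatKind} {C D : FinLim.{v, u} k} (F : C ⟶ D) :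
    PreservesFiniteLimits (SubBicat.Hom.hom F).toFunctor := SubBicat.Hom.prop F

namespace CompCat

/-- The comprehension category is full, and (according to `k`) the category of contexts and
the fibres of the displayed category of types are univalent. -/
structure IsFull (k : CatKind) (X : CompCat.{v, u}) : Prop where
  base : k.Holds X.base
  types : ∀ Γ : X.base, k.Holds (X.types.Fiber Γ)
  full : ∀ {Γ Γ' : X.base} (f : Γ ⟶ Γ') (A : X.types.Ob Γ) (B : X.types.Ob Γ'),
    Function.Bijective (fun a : X.types.Hom f A B => X.compr.map a)

/-- The underlying lax morphism of a 1-cell. -/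
def toLax {X Y : CompCat.{v, u}} (S : X ⟶ Y) : LaxHom X Y := S

/-- Full comprehension categories, and pseudo morphisms: the components of the comparison cell are
invertible. -/
def fullData (k : CatKind) : SubData CompCat.{v, u} where
  P X := IsFull k X
  Q S := ∀ ⦃Γ⦄ A, IsIso ((toLax S).comparison (Γ := Γ) A)
  id {X} _ _ A := inferInstanceAs (IsIso (𝟙 (X.ext A)))
  comp {_ _ _ S T} _ _ _ hS hT _ A := by
    have := hS A
    have := hT ((toLax S).disp.obj A)
    exact inferInstanceAs
      (IsIso ((toLax T).functor.map ((toLax S).comparison A) ≫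
        (toLax T).comparison ((toLax S).disp.obj A)))

/-- The bicategory of full comprehension categories. -/
abbrev FullCompCat (k : CatKind) := SubBicat (fullData.{v, u} k)

theorem cat_hom₂_ext {C D : Cat.{v, u}} {F G : C ⟶ D} {s t : F ⟶ G}
    (h : ∀ x, s.toNatTrans.app x = t.toNatTrans.app x) : s = t := by
  ext x
  exact h x

theorem whisker_aux {C₁ : Type*} [Category* C₁] {a b : C₁} (p : a ⟶ b) :
    p = 𝟙 a ≫ p ≫ 𝟙 b := by
  simp

theorem assoc_aux' {C₁ : Type*} [Category* C₁] {a : C₁} {p : a ⟶ a} (h : p = 𝟙 a) :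
    𝟙 a = 𝟙 a ≫ p ≫ 𝟙 a ≫ 𝟙 a ≫ 𝟙 a := by
  simp [h]

theorem unitor_aux {C₁ : Type*} [Category* C₁] {a : C₁} {p : a ⟶ a} (h : p = 𝟙 a) :
    𝟙 a = 𝟙 a ≫ p ≫ 𝟙 a := by
  simp [h]

/-- The functor between categories of contexts. -/
def baseMap {X Y : CompCat.{v, u}} (S : X ⟶ Y) : X.base ⟶ Y.base :=
  Cat.Hom.ofFunctor (toLax S).functor

/-- The base of an identity is an identity. -/
def baseId (X : CompCat.{v, u}) : baseMap (𝟙 X) ≅ 𝟙 X.base :=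
  Iso.refl (𝟙 X.base)

/-- The base of a composite is the composite of the bases. -/
def baseComp {X Y Z : CompCat.{v, u}} (S : X ⟶ Y) (T : Y ⟶ Z) :
    baseMap (S ≫ T) ≅
      baseMap S ≫ baseMap T :=
  Iso.refl (baseMap S ≫ baseMap T)

/-- The base pseudofunctor, which sends a comprehension category to its category of contexts. -/
def basePseudo : CompCat.{v, u} ⥤ᵖ Cat.{v, u} where
  obj X := X.base
  map S := baseMap S
  map₂ s := Cat.Hom₂.ofNatTrans (Cell.trans s)
  map₂_id _ := rfl
  map₂_comp _ _ := rfl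
  mapId X := baseId X
  mapComp S T := baseComp S T
  map₂_whisker_left S _ _ t := cat_hom₂_ext fun x =>
    whisker_aux ((Cell.trans t).app ((toLax S).functor.obj x))
  map₂_whisker_right s T := cat_hom₂_ext fun x =>
    whisker_aux ((toLax T).functor.map ((Cell.trans s).app x))
  map₂_associator S T U := cat_hom₂_ext fun x =>
    assoc_aux' ((toLax U).functor.map_id ((toLax T).functor.obj ((toLax S).functor.obj x)))
  map₂_left_unitor S := cat_hom₂_ext fun x => unitor_aux ((toLax S).functor.map_id x)
  map₂_right_unitor S := cat_hom₂_ext fun x => 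
    unitor_aux (rfl : 𝟙 ((toLax S).functor.obj x) = _)

/-- The comprehension category of arrows of a category with finite limits: the comprehension
functor is the identity. -/
noncomputable def ofArrows (C : Cat.{v, u}) [HasFiniteLimits C] : CompCat.{v, u} where
  base := C
  hasTerminal := inferInstance
  types := arrDisp C
  cleaving := arrCleaving
  compr := DispFunctor.id _
  compr_cartesian _ _ _ _ _ _ h := h

/-- The morphism between comprehension categories of arrows induced by a functor. -/
noncomputable def ofArrowsMap {C D : Cat.{v, u}} [HasFiniteLimits C] [HasFiniteLimits D]
    (F : C ⟶ D) [PreservesFiniteLimits F.toFunctor] : LaxHom (ofArrows C) (ofArrows D) where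
  functor := F.toFunctor
  preservesTerminal := inferInstanceAs (PreservesLimit (Functor.empty.{0} C) F.toFunctor)
  disp := arrFunctor F.toFunctor
  cartesian := arrFunctor_isCartesian F.toFunctor
  comparison A := 𝟙 (F.toFunctor.obj (ArrOb.dom A))
  comparison_pr _ := Category.id_comp _
  comparison_naturality _ := (Category.comp_id _).trans (Category.id_comp _).symm

/-- The 2-cell between morphisms of comprehension categories of arrows induced by a natural
transformation. -/
noncomputable def ofArrowsMap₂ {C D : Cat.{v, u}} [HasFiniteLimits C] [HasFiniteLimits D]
    {F G : C ⟶ D} [PreservesFiniteLimits F.toFunctor] [PreservesFiniteLimits G.toFunctor]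
    (τ : F ⟶ G) : Cell (ofArrowsMap F) (ofArrowsMap G) where
  trans := τ.toNatTrans
  disp := arrNatTrans τ.toNatTrans
  comm _ := (Category.id_comp _).trans (Category.comp_id _).symm

instance {C : Cat.{v, u}} : PreservesFiniteLimits (Cat.Hom.toFunctor (𝟙 C)) :=
  inferInstanceAs (PreservesFiniteLimits (𝟭 _))

instance {C D E : Cat.{v, u}} (F : C ⟶ D) (G : D ⟶ E) [PreservesFiniteLimits F.toFunctor]
    [PreservesFiniteLimits G.toFunctor] : PreservesFiniteLimits (F ≫ G).toFunctor :=
  inferInstanceAs (PreservesFiniteLimits (F.toFunctor ⋙ G.toFunctor))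

theorem Cell.arrows_ext {X : CompCat.{v, u}} {D : Cat.{v, u}} [HasFiniteLimits D]
    {S T : LaxHom X (ofArrows D)} {s t : Cell S T} (h₁ : ∀ Γ, s.trans.app Γ = t.trans.app Γ)
    (h₂ : ∀ (Γ : X.base) (A : X.types.Ob Γ),
      ArrHom.top (s.disp.app A) = ArrHom.top (t.disp.app A)) : s = t :=
  Cell.ext' h₁ fun Γ A => DispCat.tot_of_heq (h₁ Γ) (arrHom_heq (h₁ Γ) (h₂ Γ A))

/-- The functor on arrows preserves identities. -/
noncomputable def ofArrowsId (C : Cat.{v, u}) [HasFiniteLimits C] :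
    ofArrowsMap (𝟙 C) ≅ LaxHom.id (ofArrows C) where
  hom := Cell.mk (S := ofArrowsMap (𝟙 C)) (T := LaxHom.id (ofArrows C)) (𝟙 (𝟭 C))
    (DispNatTrans.id (DispFunctor.id (arrDisp C))) (fun _ => rfl)
  inv := Cell.mk (T := ofArrowsMap (𝟙 C)) (S := LaxHom.id (ofArrows C)) (𝟙 (𝟭 C))
    (DispNatTrans.id (DispFunctor.id (arrDisp C))) (fun _ => rfl)
  hom_inv_id := Cell.arrows_ext (fun x => Category.id_comp (𝟙 x))
    (fun _ A => Category.id_comp (𝟙 (ArrOb.dom A)))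
  inv_hom_id := Cell.arrows_ext (fun x => Category.id_comp (𝟙 x))
    (fun _ A => Category.id_comp (𝟙 (ArrOb.dom A)))

/-- The functor on arrows preserves composition. -/
noncomputable def ofArrowsComp {C D E : Cat.{v, u}} [HasFiniteLimits C] [HasFiniteLimits D]
    [HasFiniteLimits E] (F : C ⟶ D) (G : D ⟶ E) [PreservesFiniteLimits F.toFunctor]
    [PreservesFiniteLimits G.toFunctor] :
    ofArrowsMap (F ≫ G) ≅ (ofArrowsMap F).comp (ofArrowsMap G) where
  hom := Cell.mk (S := ofArrowsMap (F ≫ G)) (T := (ofArrowsMap F).comp (ofArrowsMap G))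
    (𝟙 (F.toFunctor ⋙ G.toFunctor))
    (DispNatTrans.id ((arrFunctor F.toFunctor).comp (arrFunctor G.toFunctor))) (fun _ =>
      (congrArg (𝟙 _ ≫ ·) ((congrArg (· ≫ 𝟙 _) (G.toFunctor.map_id _)).trans
        (Category.id_comp _))).symm)
  inv := Cell.mk (T := ofArrowsMap (F ≫ G)) (S := (ofArrowsMap F).comp (ofArrowsMap G))
    (𝟙 (F.toFunctor ⋙ G.toFunctor))
    (DispNatTrans.id ((arrFunctor F.toFunctor).comp (arrFunctor G.toFunctor))) (fun _ =>
      (congrArg (· ≫ 𝟙 _) ((congrArg (· ≫ 𝟙 _) (G.toFunctor.map_id _)).trans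
        (Category.id_comp _))))
  hom_inv_id := Cell.arrows_ext
    (fun x => Category.id_comp (𝟙 (G.toFunctor.obj (F.toFunctor.obj x))))
    (fun _ A => Category.id_comp (𝟙 (G.toFunctor.obj (F.toFunctor.obj (ArrOb.dom A)))))
  inv_hom_id := Cell.arrows_ext
    (fun x => Category.id_comp (𝟙 (G.toFunctor.obj (F.toFunctor.obj x))))
    (fun _ A => Category.id_comp (𝟙 (G.toFunctor.obj (F.toFunctor.obj (ArrOb.dom A)))))

variable {k : CatKind}

/-- The functor underlying a 1-cell between categories with finite limits. -/
def fn {C D : FinLim.{v, u} k} (F : C ⟶ D) : C.obj ⥤ D.obj := (SubBicat.Hom.hom F).toFunctor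

/-- The natural transformation underlying a 2-cell between categories with finite limits. -/
def nt {C D : FinLim.{v, u} k} {F G : C ⟶ D} (τ : F ⟶ G) : fn F ⟶ fn G :=
  (SubBicat.Hom₂.hom τ).toNatTrans

variable (k) in
/-- The pseudofunctor sending a category with finite limits to its comprehension category of
arrows. -/
noncomputable def arrowPseudo : FinLim.{v, u} k ⥤ᵖ CompCat.{v, u} where
  obj C := ofArrows C.obj
  map F := ofArrowsMap (SubBicat.Hom.hom F)
  map₂ τ := ofArrowsMap₂ (SubBicat.Hom₂.hom τ)
  map₂_id _ := Cell.ext' (fun _ => rfl) (fun _ _ => rfl)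
  map₂_comp _ _ := Cell.ext' (fun _ => rfl) (fun _ _ => rfl)
  mapId C := ofArrowsId C.obj
  mapComp F G := ofArrowsComp (SubBicat.Hom.hom F) (SubBicat.Hom.hom G)
  map₂_whisker_left S _ _ t := Cell.arrows_ext
    (fun x => whisker_aux ((nt t).app ((fn S).obj x)))
    (fun _ A => whisker_aux ((nt t).app ((fn S).obj (ArrOb.dom A))))
  map₂_whisker_right s T := Cell.arrows_ext
    (fun x => whisker_aux ((fn T).map ((nt s).app x)))
    (fun _ A => whisker_aux ((fn T).map ((nt s).app (ArrOb.dom A))))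
  map₂_associator S T U := Cell.arrows_ext
    (fun x => assoc_aux' ((fn U).map_id ((fn T).obj ((fn S).obj x))))
    (fun _ A => assoc_aux' ((fn U).map_id ((fn T).obj ((fn S).obj (ArrOb.dom A)))))
  map₂_left_unitor S := Cell.arrows_ext
    (fun x => unitor_aux ((fn S).map_id x))
    (fun _ A => unitor_aux ((fn S).map_id (ArrOb.dom A)))
  map₂_right_unitor S := Cell.arrows_ext
    (fun x => unitor_aux (rfl : 𝟙 ((fn S).obj x) = _))
    (fun _ A => unitor_aux (rfl : 𝟙 ((fn S).obj (ArrOb.dom A)) = _))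

theorem arr_tr_top {C : Type u} [Category.{v} C] {x y : C} {f g : x ⟶ y} {X : ArrOb x}
    {Y : ArrOb y} (h : f = g) (a : ArrHom f X Y) :
    ArrHom.top ((arrDisp C).tr h a : ArrHom g X Y) = a.top := by
  subst h
  rfl

theorem arr_comp_top {C : Type u} [Category.{v} C] {x : C} {X Y Z : (arrDisp C).Fiber x}
    (a : X ⟶ Y) (b : Y ⟶ Z) :
    ArrHom.top (DispCat.FiberHom.hom (a ≫ b)) =
      ArrHom.top (DispCat.FiberHom.hom a) ≫ ArrHom.top (DispCat.FiberHom.hom b) :=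
  arr_tr_top _ _

theorem arr_isUnivalent {C : Type u} [Category.{v} C] (h : IsUnivalent C) (x : C) :
    IsUnivalent ((arrDisp C).Fiber x) := by
  intro X Y
  refine ⟨fun _ _ _ => rfl, fun i => ?_⟩
  have h₁ := arr_comp_top i.hom i.inv
  have h₂ := arr_comp_top i.inv i.hom
  rw [i.hom_inv_id] at h₁
  rw [i.inv_hom_id] at h₂
  obtain ⟨⟨d, p⟩⟩ := X
  obtain ⟨⟨d', q⟩⟩ := Y
  obtain ⟨e, he⟩ := (h d d').2 ⟨ArrHom.top (DispCat.FiberHom.hom i.hom),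
    ArrHom.top (DispCat.FiberHom.hom i.inv), h₁.symm, h₂.symm⟩
  subst e
  have ht : 𝟙 d = ArrHom.top (DispCat.FiberHom.hom i.hom) := congrArg Iso.hom he
  have hc := ArrHom.comm (DispCat.FiberHom.hom i.hom)
  have hc' : q = p := by
    rw [← ht] at hc
    exact (Category.id_comp q).symm.trans (hc.trans (Category.comp_id p))
  subst hc'
  exact ⟨rfl, Iso.ext (DispCat.FiberHom.ext (ArrHom.ext ht))⟩

theorem ofArrows_isFull {C : Cat.{v, u}} [HasFiniteLimits C] (h : k.Holds C) :
    IsFull k (ofArrows C) where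
  base := h
  types x := by
    cases k with
    | arbitrary => trivial
    | univalent => exact arr_isUnivalent h x
  full _ _ _ := Function.bijective_id

variable (k) in
/-- The pseudofunctor sending a category with finite limits to its full comprehension category of
arrows. -/
noncomputable def arrowFull : FinLim.{v, u} k ⥤ᵖ FullCompCat.{v, u} k :=
  SubBicat.lift (arrowPseudo k)
    { obj := fun C => ofArrows_isFull C.prop.2
      map := fun F _ A => inferInstanceAs (IsIso (𝟙 ((fn F).obj (ArrOb.dom A)))) }

end CompCat

/-! ### The Beck-Chevalley condition -/

section BeckChevalley

theorem id_aux {C₁ C₂ : Type*} [Category* C₁] [Category* C₂] (G : C₁ ⥤ C₂) (a : C₁) :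
    G.map (𝟙 a) ≫ 𝟙 (G.obj a) ≫ 𝟙 (G.obj a) = 𝟙 (G.obj a) := by
  simp

theorem comp_aux {C₁ C₂ : Type*} [Category* C₁] [Category* C₂] (G : C₁ ⥤ C₂) {a : C₁} {b c : C₂}
    (p : G.obj a ⟶ b) (q : b ⟶ c) :
    G.map (𝟙 a) ≫ p ≫ q ≫ 𝟙 c = p ≫ q := by
  simp

universe v₁ v₂ v₃ v₄ v₅ v₆ u₁ u₂ u₃ u₄ u₅ u₆

variable {C₁ : Type u₁} {C₂ : Type u₂} {C₃ : Type u₃} {C₄ : Type u₄} {C₅ : Type u₅}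
  {C₆ : Type u₆} [Category.{v₁} C₁] [Category.{v₂} C₂] [Category.{v₃} C₃] [Category.{v₄} C₄]
  [Category.{v₅} C₅] [Category.{v₆} C₆]
  {F₁ : C₁ ⥤ C₂} {G₁ : C₁ ⥤ C₃} {G₂ : C₂ ⥤ C₄} {F₂ : C₃ ⥤ C₄}

/-- The Beck-Chevalley condition for left adjoints of a square of functors: for all left adjoints
`L₁` of `G₁` and `L₂` of `G₂`, the mate `F₂ ⋙ L₂ ⟶ L₁ ⋙ F₁` of `τ`, whose components are written
out here, is an isomorphism. -/
def LeftBeckChevalley (τ : G₁ ⋙ F₂ ⟶ F₁ ⋙ G₂) : Prop :=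
  ∀ ⦃L₁ : C₃ ⥤ C₁⦄ ⦃L₂ : C₄ ⥤ C₂⦄ (adj₁ : L₁ ⊣ G₁) (adj₂ : L₂ ⊣ G₂) (c : C₃),
    IsIso (L₂.map (F₂.map (adj₁.unit.app c)) ≫ L₂.map (τ.app (L₁.obj c)) ≫
      adj₂.counit.app (F₁.obj (L₁.obj c)))

/-- The Beck-Chevalley condition for right adjoints of a square of functors: for all right adjoints
`R₁` of `G₁` and `R₂` of `G₂`, the mate `R₁ ⋙ F₁ ⟶ F₂ ⋙ R₂` of `τ`, whose components are written
out here, is an isomorphism. -/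
def RightBeckChevalley (τ : F₁ ⋙ G₂ ⟶ G₁ ⋙ F₂) : Prop :=
  ∀ ⦃R₁ : C₃ ⥤ C₁⦄ ⦃R₂ : C₄ ⥤ C₂⦄ (adj₁ : G₁ ⊣ R₁) (adj₂ : G₂ ⊣ R₂) (c : C₃),
    IsIso (adj₂.unit.app (F₁.obj (R₁.obj c)) ≫ R₂.map (τ.app (R₁.obj c)) ≫
      R₂.map (F₂.map (adj₁.counit.app c)))

theorem rightBeckChevalley_comp {K₁ : C₂ ⥤ C₅} {G₃ : C₅ ⥤ C₆} {K₂ : C₄ ⥤ C₆}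
    {τ : F₁ ⋙ G₂ ⟶ G₁ ⋙ F₂} {σ : K₁ ⋙ G₃ ⟶ G₂ ⋙ K₂} {H₁ : C₁ ⥤ C₅} {H₂ : C₃ ⥤ C₆}
    {ρ : H₁ ⋙ G₃ ⟶ G₁ ⋙ H₂} (α : H₁ ≅ F₁ ⋙ K₁) (β : F₂ ⋙ K₂ ≅ H₂)
    (hρ : ∀ c, ρ.app c = G₃.map (α.hom.app c) ≫ σ.app (F₁.obj c) ≫ K₂.map (τ.app c) ≫
      β.hom.app (G₁.obj c))
    (hG : G₂.IsLeftAdjoint) (hτ : RightBeckChevalley τ) (hσ : RightBeckChevalley σ) :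
    RightBeckChevalley ρ := by
  intro R₁ R₃ adj₁ adj₃ c
  obtain ⟨R₂, ⟨adj₂⟩⟩ := hG.exists_rightAdjoint
  have h₁ := hτ adj₁ adj₂ c
  have h₂ := hσ adj₂ adj₃ (F₂.obj c)
  set m := adj₂.unit.app (F₁.obj (R₁.obj c)) ≫ R₂.map (τ.app (R₁.obj c)) ≫
    R₂.map (F₂.map (adj₁.counit.app c)) with hm
  have e : G₂.map m ≫ adj₂.counit.app (F₂.obj c) =
      τ.app (R₁.obj c) ≫ F₂.map (adj₁.counit.app c) := by
    rw [hm, ← R₂.map_comp, G₂.map_comp, Category.assoc]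
    erw [adj₂.counit_naturality, adj₂.left_triangle_components_assoc]
  have key : adj₃.unit.app (H₁.obj (R₁.obj c)) ≫ R₃.map (ρ.app (R₁.obj c)) ≫
      R₃.map (H₂.map (adj₁.counit.app c)) =
      α.hom.app (R₁.obj c) ≫ K₁.map m ≫
        (adj₃.unit.app (K₁.obj (R₂.obj (F₂.obj c))) ≫ R₃.map (σ.app (R₂.obj (F₂.obj c))) ≫
          R₃.map (K₂.map (adj₂.counit.app (F₂.obj c)))) ≫ R₃.map (β.hom.app c) := by
    have hβ : β.hom.app (G₁.obj (R₁.obj c)) ≫ H₂.map (adj₁.counit.app c) =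
        K₂.map (F₂.map (adj₁.counit.app c)) ≫ β.hom.app c :=
      (β.hom.naturality (adj₁.counit.app c)).symm
    have hσn : G₃.map (K₁.map m) ≫ σ.app (R₂.obj (F₂.obj c)) =
        σ.app (F₁.obj (R₁.obj c)) ≫ K₂.map (G₂.map m) := σ.naturality m
    have hu₁ := adj₃.unit.naturality (K₁.map m)
    have hu₂ := adj₃.unit.naturality (α.hom.app (R₁.obj c))
    dsimp only [Functor.comp_obj, Functor.comp_map, Functor.id_obj, Functor.id_map] at hu₁ hu₂
    have inner : ρ.app (R₁.obj c) ≫ H₂.map (adj₁.counit.app c) =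
        G₃.map (α.hom.app (R₁.obj c)) ≫ G₃.map (K₁.map m) ≫ σ.app (R₂.obj (F₂.obj c)) ≫
          K₂.map (adj₂.counit.app (F₂.obj c)) ≫ β.hom.app c := by
      rw [reassoc_of% hσn, ← K₂.map_comp_assoc, e, hρ, K₂.map_comp]
      simp only [Category.assoc, hβ]
    rw [← R₃.map_comp, inner]
    simp only [R₃.map_comp, Category.assoc]
    rw [reassoc_of% hu₁, reassoc_of% hu₂]
  rw [key]
  have h₃ : IsIso (K₁.map m) := Functor.map_isIso K₁ m
  have h₄ : IsIso (α.hom.app (R₁.obj c)) := inferInstance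
  have h₅ : IsIso (R₃.map (β.hom.app c)) := inferInstance
  exact IsIso.comp_isIso' h₄ (IsIso.comp_isIso' h₃ (IsIso.comp_isIso' h₂ h₅))

theorem rightBeckChevalley_id {H₁ : C₁ ⥤ C₁} {H₂ : C₃ ⥤ C₃} {G₂ : C₁ ⥤ C₃}
    {ρ : H₁ ⋙ G₂ ⟶ G₁ ⋙ H₂} (α : H₁ ≅ 𝟭 C₁) (β : 𝟭 C₃ ≅ H₂) (i : G₂ ≅ G₁)
    (hρ : ∀ c, ρ.app c = G₂.map (α.hom.app c) ≫ i.hom.app c ≫ β.hom.app (G₁.obj c)) :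
    RightBeckChevalley ρ := by
  intro R₁ R₂ adj₁ adj₂ c
  have key : adj₂.unit.app (H₁.obj (R₁.obj c)) ≫ R₂.map (ρ.app (R₁.obj c)) ≫
      R₂.map (H₂.map (adj₁.counit.app c)) =
      α.hom.app (R₁.obj c) ≫ (conjugateEquiv adj₁ adj₂ i.hom).app c ≫ R₂.map (β.hom.app c) := by
    have hβ : β.hom.app (G₁.obj (R₁.obj c)) ≫ H₂.map (adj₁.counit.app c) =
        adj₁.counit.app c ≫ β.hom.app c := (β.hom.naturality (adj₁.counit.app c)).symm
    have hu := adj₂.unit.naturality (α.hom.app (R₁.obj c))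
    dsimp only [Functor.comp_obj, Functor.comp_map, Functor.id_obj, Functor.id_map] at hu
    rw [← R₂.map_comp, hρ]
    simp only [Category.assoc, hβ, R₂.map_comp, conjugateEquiv_apply_app]
    rw [reassoc_of% hu]
  rw [key]
  have h₁ : IsIso ((conjugateEquiv adj₁ adj₂ i.hom).app c) := inferInstance
  have h₄ : IsIso (α.hom.app (R₁.obj c)) := inferInstance
  have h₅ : IsIso (R₂.map (β.hom.app c)) := inferInstance
  exact IsIso.comp_isIso' h₄ (IsIso.comp_isIso' h₁ h₅)

end BeckChevalley

/-! ### Type formers -/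

namespace DispFunctor

variable {C₁ C₂ C₃ : Type u} [Category.{v} C₁] [Category.{v} C₂] [Category.{v} C₃]

/-- The identity displayed functor induces identity functors on fibres. -/
def fiberId (D : DispCat.{v, u} C₁) (x : C₁) : (DispFunctor.id D).fiber x ≅ 𝟭 (D.Fiber x) :=
  NatIso.ofComponents (fun X => Iso.refl X) (fun {X Y} a => by
    refine (Category.comp_id _).trans (Eq.trans ?_ (Category.id_comp a).symm)
    exact DispCat.fiber_hom_ext (DispFunctor.tot_fiber_map (DispFunctor.id D) a))

/-- Passing to fibres commutes with composition. -/
def fiberComp {F : C₁ ⥤ C₂} {K : C₂ ⥤ C₃} {D₁ : DispCat.{v, u} C₁} {D₂ : DispCat.{v, u} C₂}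
    {D₃ : DispCat.{v, u} C₃} (G : DispFunctor F D₁ D₂) (H : DispFunctor K D₂ D₃) (x : C₁) :
    (G.comp H).fiber x ≅ G.fiber x ⋙ H.fiber (F.obj x) :=
  NatIso.ofComponents (fun X => Iso.refl ((H.fiber (F.obj x)).obj ((G.fiber x).obj X)))
    (fun {X Y} a => by
      refine (Category.comp_id _).trans (Eq.trans ?_ (Category.id_comp _).symm)
      refine DispCat.fiber_hom_ext ?_
      refine (DispFunctor.tot_fiber_map (G.comp H) a).trans ?_
      refine Eq.trans ?_ (DispFunctor.tot_fiber_map H ((G.fiber x).map a)).symm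
      exact congrArg H.total.map (DispFunctor.tot_fiber_map G a).symm)

end DispFunctor

namespace CompCat

variable {k : CatKind}

/-- The functor between fibres of the categories of types induced by a 1-cell. -/
def fiberMap {X Y : CompCat.{v, u}} (S : X ⟶ Y) (Γ : X.base) :
    X.types.Fiber Γ ⥤ Y.types.Fiber ((toLax S).functor.obj Γ) :=
  (toLax S).disp.fiber Γ

/-- The substitution functor between fibres of the category of types. -/
noncomputable def subst (X : CompCat.{v, u}) {Γ Γ' : X.base} (f : Γ ⟶ Γ') :
    X.types.Fiber Γ' ⥤ X.types.Fiber Γ :=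
  X.cleaving.reindex f

theorem preserves_of_iso {C₁ C₂ J : Type*} [Category* C₁] [Category* C₂] [Category* J]
    {F G : C₁ ⥤ C₂} (e : F ≅ G) (h : PreservesLimitsOfShape J F) : PreservesLimitsOfShape J G :=
  preservesLimitsOfShape_of_natIso e

/-- Fiberwise limits of shape `J` (all fibres have limits of shape `J`, and all
substitution functors preserve them), and 1-cells that preserve them on all fibres. -/
def limitsData (k : CatKind) (J : Type) [SmallCategory J] : SubData (FullCompCat.{v, u} k) where
  P X := (∀ Γ : X.obj.base, HasLimitsOfShape J (X.obj.types.Fiber Γ)) ∧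
    ∀ ⦃Γ Γ' : X.obj.base⦄ (f : Γ ⟶ Γ'), PreservesLimitsOfShape J (X.obj.subst f)
  Q {X _} S := ∀ Γ : X.obj.base, PreservesLimitsOfShape J (fiberMap (SubBicat.Hom.hom S) Γ)
  id {X} _ Γ :=
    have : PreservesLimitsOfShape J (𝟭 (X.obj.types.Fiber Γ)) := inferInstance
    preserves_of_iso (DispFunctor.fiberId X.obj.types Γ).symm this
  comp {X Y Z S T} _ _ _ hS hT Γ := by
    have := hS Γ
    have := hT ((toLax (SubBicat.Hom.hom S)).functor.obj Γ)
    have : PreservesLimitsOfShape J (fiberMap (SubBicat.Hom.hom S) Γ ⋙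
        fiberMap (SubBicat.Hom.hom T) ((toLax (SubBicat.Hom.hom S)).functor.obj Γ)) :=
      inferInstance
    exact preserves_of_iso (DispFunctor.fiberComp
      (toLax (SubBicat.Hom.hom S)).disp (toLax (SubBicat.Hom.hom T)).disp Γ).symm this

/-- Binary product types. -/
abbrev prodData (k : CatKind) : SubData (FullCompCat.{v, u} k) :=
  limitsData k (Discrete WalkingPair)

/-- Equalizer types. -/
abbrev eqData (k : CatKind) : SubData (FullCompCat.{v, u} k) := limitsData k WalkingParallelPair

/-- Unit types: fiberwise terminal objects whose projections `Γ.1 ⟶ Γ` are invertible. -/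
def unitData (k : CatKind) : SubData (FullCompCat.{v, u} k) where
  P X := (limitsData k (Discrete PEmpty.{1})).P X ∧
    ∀ ⦃Γ : X.obj.base⦄ (T : X.obj.types.Fiber Γ), Nonempty (IsTerminal T) → IsIso (X.obj.pr T.ob)
  Q S := (limitsData k (Discrete PEmpty.{1})).Q S
  id h := (limitsData k (Discrete PEmpty.{1})).id h.1
  comp hx hy hz hS hT := (limitsData k (Discrete PEmpty.{1})).comp hx.1 hy.1 hz.1 hS hT

/-- The comprehension category has strong `∑`-types: weakening functors have left adjoints, these
satisfy the Beck-Chevalley condition for every pullback square between projections, and the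
canonical maps `Γ.A.B ⟶ Γ.∑ A B` are invertible. -/
structure HasStrongSigma (X : CompCat.{v, u}) : Prop where
  isRightAdjoint : ∀ {Γ : X.base} (A : X.types.Ob Γ), (X.subst (X.pr A)).IsRightAdjoint
  beckChevalley : ∀ {Γ₁ Γ₂ : X.base} {A₁ : X.types.Ob Γ₁} {A₂ : X.types.Ob Γ₂} {s : Γ₁ ⟶ Γ₂}
    {t : X.ext A₁ ⟶ X.ext A₂} (h : IsPullback t (X.pr A₁) (X.pr A₂) s),
    LeftBeckChevalley (X.cleaving.square h.w)
  strong : ∀ {Γ : X.base} (A : X.types.Ob Γ) (L : X.types.Fiber (X.ext A) ⥤ X.types.Fiber Γ)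
    (adj : L ⊣ X.subst (X.pr A)) (B : X.types.Fiber (X.ext A)),
    IsIso (X.extMap (DispCat.FiberHom.hom (adj.unit.app B)) ≫
      X.extMap (X.cleaving.liftAt (X.pr A) (L.obj B)))

/-- Strong `∑`-types. -/
def sigmaData (k : CatKind) : SubData (FullCompCat.{v, u} k) :=
  SubData.full fun X => HasStrongSigma X.obj

/-- The empty context. -/
noncomputable def emptyCtx (X : CompCat.{v, u}) : X.base :=
  letI := X.hasTerminal
  ⊤_ X.base

/-- Democracy: every context is isomorphic to the extension of the empty context by a type. -/
def IsDemocratic (X : CompCat.{v, u}) : Prop :=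
  ∀ Γ : X.base, ∃ A : X.types.Ob X.emptyCtx, Nonempty (Γ ≅ X.ext A)

/-- Democratic comprehension categories. -/
def demData (k : CatKind) : SubData (FullCompCat.{v, u} k) :=
  SubData.full fun X => IsDemocratic X.obj

/-- DFL comprehension categories over full comprehension categories. -/
def dflData (k : CatKind) : SubData (FullCompCat.{v, u} k) :=
  (unitData k).prod ((prodData k).prod ((eqData k).prod ((sigmaData k).prod (demData k))))

end CompCat

/-- The bicategory of DFL comprehension categories. -/
abbrev DFLCompCat (k : CatKind) := SubBicat (CompCat.dflData.{v, u} k)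

namespace CompCat

variable {k : CatKind}

/-- The comprehension category supports `∏`-types: weakening functors have right adjoints, and these
satisfy the Beck-Chevalley condition for every pullback square between projections. -/
structure HasPi (X : CompCat.{v, u}) : Prop where
  isLeftAdjoint : ∀ {Γ : X.base} (A : X.types.Ob Γ), (X.subst (X.pr A)).IsLeftAdjoint
  beckChevalley : ∀ {Γ₁ Γ₂ : X.base} {A₁ : X.types.Ob Γ₁} {A₂ : X.types.Ob Γ₂} {s : Γ₁ ⟶ Γ₂}
    {t : X.ext A₁ ⟶ X.ext A₂} (h : IsPullback t (X.pr A₁) (X.pr A₂) s),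
    RightBeckChevalley (X.cleaving.square h.w.symm)

/-- For a 1-cell and a substitution `f`, the canonical isomorphism `(F f)^* (F A) ⟶ F (f^* A)`. -/
noncomputable def substSquare {X Y : CompCat.{v, u}} (S : X ⟶ Y) {Γ Γ' : X.base} (f : Γ ⟶ Γ') :
    fiberMap S Γ' ⋙ Y.subst ((toLax S).functor.map f) ⟶ X.subst f ⋙ fiberMap S Γ :=
  (toLax S).disp.reindexSquare (toLax S).cartesian X.cleaving Y.cleaving f

/-- The 1-cell preserves `∏`-types: the Beck-Chevalley condition holds for the squares given by
`F` and by substitution along `f` and `F f`. It is stated for all `f` such that substitution along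
`f` has a right adjoint, and then substitution along `F f` is required to have one as well. Between
DFL comprehension categories with `∏`-types this is a condition on all morphisms `f`, and the
right adjoints always exist, since there every morphism is isomorphic to a projection. -/
def PreservesPi {X Y : CompCat.{v, u}} (S : X ⟶ Y) : Prop :=
  ∀ ⦃Γ Γ' : X.base⦄ (f : Γ ⟶ Γ'), (X.subst f).IsLeftAdjoint →
    (Y.subst ((toLax S).functor.map f)).IsLeftAdjoint ∧ RightBeckChevalley (substSquare S f)

theorem preservesPi_id (X : CompCat.{v, u}) : PreservesPi (𝟙 X) := by
  intro Γ Γ' f hf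
  refine ⟨hf, ?_⟩
  refine rightBeckChevalley_id (DispFunctor.fiberId X.types Γ')
    (DispFunctor.fiberId X.types Γ).symm (Iso.refl (X.subst f)) fun A => ?_
  refine Eq.trans ?_ (id_aux (X.subst f) A).symm
  refine DispCat.FiberHom.ext (DispCat.IsCartesian.hom_ext (X.cleaving.liftAt_cartesian f A) ?_)
  refine (DispFunctor.reindexApp_lift (DispFunctor.id X.types)
    (fun _ _ _ _ _ _ h => h) X.cleaving X.cleaving f A).trans ?_
  exact (Category.id_comp _).symm

theorem preservesPi_comp {X Y Z : CompCat.{v, u}} {S : X ⟶ Y} {T : Y ⟶ Z} (hS : PreservesPi S)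
    (hT : PreservesPi T) : PreservesPi (S ≫ T) := by
  intro Γ Γ' f hf
  obtain ⟨h₁, h₂⟩ := hS f hf
  obtain ⟨h₃, h₄⟩ := hT _ h₁
  refine ⟨h₃, ?_⟩
  refine rightBeckChevalley_comp (DispFunctor.fiberComp (toLax S).disp (toLax T).disp Γ')
    (DispFunctor.fiberComp (toLax S).disp (toLax T).disp Γ).symm (fun A => ?_) h₁ h₂ h₄
  refine Eq.trans ?_ (comp_aux (Z.subst ((toLax T).functor.map ((toLax S).functor.map f)))
    ((substSquare T ((toLax S).functor.map f)).app ((fiberMap S Γ').obj A))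
    ((fiberMap T ((toLax S).functor.obj Γ)).map ((substSquare S f).app A))).symm
  have hc : (toLax (S ≫ T)).disp.IsCartesian := (toLax (S ≫ T)).cartesian
  refine DispCat.FiberHom.ext (DispCat.IsCartesian.hom_ext
    (a := (toLax (S ≫ T)).disp.mapLift X.cleaving f A)
    (hc _ (X.cleaving.liftAt_cartesian f A)) ?_)
  refine (DispFunctor.reindexApp_lift (toLax (S ≫ T)).disp hc X.cleaving Z.cleaving f A).trans ?_
  have e₁ := DispFunctor.reindexApp_lift (toLax S).disp (toLax S).cartesian X.cleaving Y.cleaving f A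
  have e₂ := DispFunctor.reindexApp_lift (toLax T).disp (toLax T).cartesian Y.cleaving Z.cleaving
    ((toLax S).functor.map f) ((fiberMap S Γ').obj A)
  refine e₂.symm.trans ?_
  refine Eq.trans ?_ (congrArg (· ≫ _) (DispCat.fiber_tot_comp _ _).symm)
  refine Eq.trans ?_ (Category.assoc _ _ _).symm
  refine congrArg (_ ≫ ·) ?_
  refine Eq.trans ?_ (congrArg (· ≫ _) (DispFunctor.tot_fiber_map (toLax T).disp _).symm)
  exact (congrArg (toLax T).disp.total.map e₁).symm.trans
    ((toLax T).disp.total.map_comp _ _)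

/-- `∏`-types. -/
def piData (k : CatKind) : SubData (DFLCompCat.{v, u} k) where
  P X := HasPi X.obj.obj
  Q S := PreservesPi (SubBicat.Hom.hom (SubBicat.Hom.hom S))
  id {X} _ := preservesPi_id X.obj.obj
  comp _ _ _ hS hT := preservesPi_comp hS hT

end CompCat

/-- The bicategory of DFL comprehension categories that support `∏`-types. -/
abbrev DFLCompCatPi (k : CatKind) := SubBicat (CompCat.piData.{v, u} k)

/-! ### Locally Cartesian closed categories -/

section LCCC

variable {C D E : Type u} [Category.{v} C] [Category.{v} D] [Category.{v} E]

/-- The image under `F` of the pullback of `g` along `f` is a pullback. -/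
theorem isPullback_map [HasPullbacks C] (F : C ⥤ D) [PreservesLimitsOfShape WalkingCospan F]
    {x y : C} (f : x ⟶ y) (g : Over y) :
    IsPullback (F.map (pullback.fst g.hom f)) (F.map (pullback.snd g.hom f))
      (F.map g.hom) (F.map f) :=
  (IsPullback.of_hasPullback g.hom f).map F

/-- The canonical morphism from the pullback of `F g` along `F f` to the image under `F` of the
pullback of `g` along `f`. -/
noncomputable def overApp [HasPullbacks C] [HasPullbacks D] (F : C ⥤ D)
    [PreservesLimitsOfShape WalkingCospan F] {x y : C} (f : x ⟶ y) (g : Over y) :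
    pullback (F.map g.hom) (F.map f) ⟶ F.obj (pullback g.hom f) :=
  (isPullback_map F f g).lift (pullback.fst (F.map g.hom) (F.map f))
    (pullback.snd (F.map g.hom) (F.map f)) pullback.condition

theorem overApp_fst [HasPullbacks C] [HasPullbacks D] (F : C ⥤ D)
    [PreservesLimitsOfShape WalkingCospan F] {x y : C} (f : x ⟶ y) (g : Over y) :
    overApp F f g ≫ F.map (pullback.fst g.hom f) = pullback.fst (F.map g.hom) (F.map f) :=
  IsPullback.lift_fst _ _ _ _

theorem overApp_snd [HasPullbacks C] [HasPullbacks D] (F : C ⥤ D)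
    [PreservesLimitsOfShape WalkingCospan F] {x y : C} (f : x ⟶ y) (g : Over y) :
    overApp F f g ≫ F.map (pullback.snd g.hom f) = pullback.snd (F.map g.hom) (F.map f) :=
  IsPullback.lift_snd _ _ _ _

theorem over_map_fst [HasPullbacks C] {x y : C} (f : x ⟶ y) {g h : Over y} (a : g ⟶ h) :
    ((Over.pullback f).map a).left ≫ pullback.fst h.hom f = pullback.fst g.hom f ≫ a.left :=
  pullback.lift_fst _ _ _

theorem over_map_snd [HasPullbacks C] {x y : C} (f : x ⟶ y) {g h : Over y} (a : g ⟶ h) :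
    ((Over.pullback f).map a).left ≫ pullback.snd h.hom f = pullback.snd g.hom f :=
  pullback.lift_snd _ _ _

/-- For a functor `F` that preserves pullbacks, the canonical isomorphism
`(F f)^* (F g) ⟶ F (f^* g)` between slice categories. -/
noncomputable def overSquare [HasPullbacks C] [HasPullbacks D] (F : C ⥤ D)
    [PreservesLimitsOfShape WalkingCospan F] {x y : C} (f : x ⟶ y) :
    Over.post F ⋙ Over.pullback (F.map f) ⟶ Over.pullback f ⋙ Over.post F where
  app g := Over.homMk (overApp F f g) (overApp_snd F f g)
  naturality g h a := by
    refine Over.OverMorphism.ext ((isPullback_map F f h).hom_ext ?_ ?_)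
    · have h₁ := over_map_fst (F.map f) ((Over.post F).map a)
      have h₂ := congrArg F.map (over_map_fst f a)
      rw [F.map_comp, F.map_comp] at h₂
      refine (Category.assoc _ _ _).trans ((congrArg (_ ≫ ·) (overApp_fst F f h)).trans ?_)
      refine h₁.trans (Eq.trans ?_ ((Category.assoc _ _ _).trans
        (congrArg (_ ≫ ·) h₂)).symm)
      exact (congrArg (· ≫ F.map a.left) (overApp_fst F f g).symm).trans (Category.assoc _ _ _)
    · have h₁ := over_map_snd (F.map f) ((Over.post F).map a)
      have h₂ := congrArg F.map (over_map_snd f a)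
      rw [F.map_comp] at h₂
      refine (Category.assoc _ _ _).trans ((congrArg (_ ≫ ·) (overApp_snd F f h)).trans ?_)
      refine h₁.trans (Eq.trans ?_ ((Category.assoc _ _ _).trans
        (congrArg (_ ≫ ·) h₂)).symm)
      exact (overApp_snd F f g).symm

/-- Locally Cartesian closed categories: pullback functors between slice categories have right
adjoints. -/
def IsLCC (C : Type u) [Category.{v} C] [HasPullbacks C] : Prop :=
  ∀ ⦃x y : C⦄ (f : x ⟶ y), (Over.pullback f).IsLeftAdjoint

/-- The functor preserves exponentials of slices: the Beck-Chevalley condition holds for the squares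
given by `F` and by pulling back along `f` and `F f`. -/
def PreservesExponentials [HasPullbacks C] [HasPullbacks D] (F : C ⥤ D)
    [PreservesLimitsOfShape WalkingCospan F] : Prop :=
  ∀ ⦃x y : C⦄ (f : x ⟶ y), RightBeckChevalley (overSquare F f)

/-- The identity functor induces identity functors on slices. -/
def overPostId (x : C) : Over.post (X := x) (𝟭 C) ≅ 𝟭 (Over x) :=
  Iso.refl (𝟭 (Over x))

theorem preservesExponentials_id [HasPullbacks C] : PreservesExponentials (𝟭 C) := by
  intro x y f
  refine rightBeckChevalley_id (overPostId y) (overPostId x).symm (Iso.refl (Over.pullback f))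
    fun g => ?_
  refine Eq.trans ?_ (id_aux (Over.pullback f) g).symm
  refine Over.OverMorphism.ext ((isPullback_map (𝟭 C) f g).hom_ext ?_ ?_)
  · exact (overApp_fst (𝟭 C) f g).trans (Category.id_comp _).symm
  · exact (overApp_snd (𝟭 C) f g).trans (Category.id_comp _).symm

theorem preservesExponentials_comp [HasPullbacks C] [HasPullbacks D] [HasPullbacks E] (F : C ⥤ D)
    (G : D ⥤ E) [PreservesLimitsOfShape WalkingCospan F]
    [PreservesLimitsOfShape WalkingCospan G] (hD : IsLCC D) (hF : PreservesExponentials F)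
    (hG : PreservesExponentials G) : PreservesExponentials (F ⋙ G) := by
  intro x y f
  refine rightBeckChevalley_comp (Iso.refl (Over.post F ⋙ Over.post G))
    (Iso.refl (Over.post F ⋙ Over.post G)) (fun g => ?_) (hD (F.map f)) (hF f) (hG (F.map f))
  refine Eq.trans ?_ (comp_aux (Over.pullback (G.map (F.map f)))
    ((overSquare G (F.map f)).app ((Over.post F).obj g))
    ((Over.post G).map ((overSquare F f).app g))).symm
  refine Over.OverMorphism.ext ((isPullback_map (F ⋙ G) f g).hom_ext ?_ ?_)
  · refine (overApp_fst (F ⋙ G) f g).trans (Eq.symm ?_)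
    refine (Category.assoc _ _ _).trans ?_
    refine (congrArg (_ ≫ ·) ((G.map_comp _ _).symm.trans
      (congrArg G.map (overApp_fst F f g)))).trans ?_
    exact overApp_fst G (F.map f) ((Over.post F).obj g)
  · refine (overApp_snd (F ⋙ G) f g).trans (Eq.symm ?_)
    refine (Category.assoc _ _ _).trans ?_
    refine (congrArg (_ ≫ ·) ((G.map_comp _ _).symm.trans
      (congrArg G.map (overApp_snd F f g)))).trans ?_
    exact overApp_snd G (F.map f) ((Over.post F).obj g)

end LCCC

/-- Locally Cartesian closed categories, and functors that preserve exponentials of slices. -/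
def lcccData (k : CatKind) : SubData (FinLim.{v, u} k) where
  P C := IsLCC C.obj
  Q F := PreservesExponentials (SubBicat.Hom.hom F).toFunctor
  id _ := preservesExponentials_id
  comp _ hy _ hF hG := preservesExponentials_comp _ _ hy hF hG

/-- The bicategory of locally Cartesian closed categories. -/
abbrev LCCC (k : CatKind) := SubBicat (lcccData.{v, u} k)

/-! ### The biequivalence for categories with finite limits -/

namespace CompCat

variable {k : CatKind}

variable (k) in
/-- The base pseudofunctor on DFL comprehension categories. -/
def baseDFL : DFLCompCat.{v, u} k ⥤ᵖ Cat.{v, u} :=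
  ((SubBicat.forget (dflData k)).comp (SubBicat.forget (fullData k))).comp basePseudo

variable (k) in
/-- The arrow pseudofunctor takes values in DFL comprehension categories. -/
abbrev ArrowLands : Prop := SubBicat.Lifts (arrowFull.{v, u} k) (dflData k)

variable (k) in
/-- The base pseudofunctor takes values in categories with finite limits. -/
abbrev BaseLands : Prop := SubBicat.Lifts (baseDFL.{v, u} k) (finLimData k)

/-- The pseudofunctor `H` sending a category with finite limits to its arrow category. -/
noncomputable def arrowH (hH : ArrowLands.{v, u} k) : FinLim.{v, u} k ⥤ᵖ DFLCompCat.{v, u} k :=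
  SubBicat.lift (arrowFull k) hH

/-- The pseudofunctor `U` sending a DFL comprehension category to its category of contexts. -/
def baseU (hU : BaseLands.{v, u} k) : DFLCompCat.{v, u} k ⥤ᵖ FinLim.{v, u} k :=
  SubBicat.lift (baseDFL k) hU

/-- The functor from the category of contexts, together with the comprehension functor, as a
morphism of comprehension categories. -/
noncomputable def zetaHom (X : CompCat.{v, u}) [HasFiniteLimits X.base] :
    LaxHom X (ofArrows X.base) where
  functor := 𝟭 X.base
  preservesTerminal := inferInstanceAs (PreservesLimit _ (𝟭 X.base))
  disp := X.compr
  cartesian := X.compr_cartesian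
  comparison A := 𝟙 (X.ext A)
  comparison_pr _ := Category.id_comp _
  comparison_naturality _ := (Category.comp_id _).trans (Category.id_comp _).symm

/-- The naturality cell of `zetaHom`: the identity on contexts, and the comparison cell of `S` on
types. -/
noncomputable def zetaCell {X Y : CompCat.{v, u}} [HasFiniteLimits X.base] [HasFiniteLimits Y.base]
    (S : LaxHom X Y) [PreservesFiniteLimits S.functor] :
    Cell ((zetaHom X).comp (ofArrowsMap (C := X.base) (D := Y.base) (Cat.Hom.ofFunctor S.functor)))
      (S.comp (zetaHom Y)) where
  trans := 𝟙 S.functor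
  disp :=
    { app := fun {Γ} A => ArrHom.mk (x := S.functor.obj Γ) (y := S.functor.obj Γ) (f := 𝟙 _)
        (g := ArrOb.mk (S.functor.obj (X.ext A)) (S.functor.map (X.pr A)))
        (h := Y.compr.obj (S.disp.obj A)) (S.comparison A)
        ((S.comparison_pr A).trans (Category.comp_id _).symm)
      naturality := fun {Γ Γ' f A B} a => arrHom_heq
        ((Category.comp_id _).trans (Category.id_comp _).symm) (S.comparison_naturality a) }
  comm A := by
    change (S.functor.map (𝟙 (X.ext A)) ≫ 𝟙 _) ≫ S.comparison A = 𝟙 _ ≫ S.comparison A ≫ 𝟙 _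
    simp

theorem inv_naturality {C : Type*} [Category* C] {a b c d : C} {p : a ⟶ b} {q : b ⟶ d} {r : a ⟶ c}
    {s : c ⟶ d} [IsIso q] [IsIso r] (h : p ≫ q = r ≫ s) : s ≫ inv q = inv r ≫ p := by
  rw [IsIso.comp_inv_eq, Category.assoc, IsIso.eq_inv_comp, h]

/-- The inverse of the comparison cell. -/
noncomputable def LaxHom.comparisonInv {X Y : CompCat.{v, u}} (S : LaxHom X Y)
    [∀ (Γ : X.base) (A : X.types.Ob Γ), IsIso (S.comparison A)] {Γ : X.base} (A : X.types.Ob Γ) :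
    Y.ext (S.disp.obj A) ⟶ S.functor.obj (X.ext A) :=
  inv (S.comparison A)

theorem LaxHom.comparisonInv_pr {X Y : CompCat.{v, u}} (S : LaxHom X Y)
    [∀ (Γ : X.base) (A : X.types.Ob Γ), IsIso (S.comparison A)] {Γ : X.base} (A : X.types.Ob Γ) :
    S.comparisonInv A ≫ S.functor.map (X.pr A) = Y.pr (S.disp.obj A) :=
  (IsIso.inv_comp_eq (S.comparison A)).2 (S.comparison_pr A).symm

theorem LaxHom.comparisonInv_naturality {X Y : CompCat.{v, u}} (S : LaxHom X Y)
    [∀ (Γ : X.base) (A : X.types.Ob Γ), IsIso (S.comparison A)] {Γ Γ' : X.base} {f : Γ ⟶ Γ'}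
    {A : X.types.Ob Γ} {B : X.types.Ob Γ'} (a : X.types.Hom f A B) :
    Y.extMap (S.disp.map a) ≫ S.comparisonInv B = S.comparisonInv A ≫ S.functor.map (X.extMap a) :=
  inv_naturality (S.comparison_naturality a)

/-- The inverse of the naturality cell of `zetaHom`. -/
noncomputable def zetaCellInv {X Y : CompCat.{v, u}} [HasFiniteLimits X.base]
    [HasFiniteLimits Y.base] (S : LaxHom X Y) [PreservesFiniteLimits S.functor]
    [∀ (Γ : X.base) (A : X.types.Ob Γ), IsIso (S.comparison A)] :
    Cell (S.comp (zetaHom Y))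
      ((zetaHom X).comp
        (ofArrowsMap (C := X.base) (D := Y.base) (Cat.Hom.ofFunctor S.functor))) where
  trans := 𝟙 S.functor
  disp :=
    { app := fun {Γ} A => ArrHom.mk (x := S.functor.obj Γ) (y := S.functor.obj Γ) (f := 𝟙 _)
        (g := Y.compr.obj (S.disp.obj A))
        (h := ArrOb.mk (S.functor.obj (X.ext A)) (S.functor.map (X.pr A)))
        (S.comparisonInv A)
        ((S.comparisonInv_pr A).trans (Category.comp_id _).symm)
      naturality := fun {Γ Γ' f A B} a => arrHom_heq
        ((Category.comp_id _).trans (Category.id_comp _).symm)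
        (S.comparisonInv_naturality a) }
  comm A := by
    change (S.comparison A ≫ 𝟙 _) ≫ inv (S.comparison A) =
      𝟙 _ ≫ S.functor.map (𝟙 (X.ext A)) ≫ 𝟙 _
    simp

/-- The invertible naturality cell of `zetaHom`. -/
noncomputable def zetaIso {X Y : CompCat.{v, u}} [HasFiniteLimits X.base]
    [HasFiniteLimits Y.base] (S : LaxHom X Y) [PreservesFiniteLimits S.functor]
    [∀ (Γ : X.base) (A : X.types.Ob Γ), IsIso (S.comparison A)] :
    S.comp (zetaHom Y) ≅ (zetaHom X).comp
      (ofArrowsMap (C := X.base) (D := Y.base) (Cat.Hom.ofFunctor S.functor)) where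
  hom := zetaCellInv S
  inv := zetaCell S
  hom_inv_id := Cell.arrows_ext (fun Γ => Category.id_comp (𝟙 (S.functor.obj Γ)))
    (fun _ A => IsIso.inv_hom_id (S.comparison A))
  inv_hom_id := Cell.arrows_ext (fun Γ => Category.id_comp (𝟙 (S.functor.obj Γ)))
    (fun _ A => IsIso.hom_inv_id (S.comparison A))

variable (hH : ArrowLands.{v, u} k) (hU : BaseLands.{v, u} k)

/-- `zetaHom` as a morphism of full comprehension categories. -/
noncomputable def zetaFull (X : DFLCompCat.{v, u} k) :
    X.obj ⟶ (arrowFull k).obj ((baseU hU).obj X) :=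
  have : HasFiniteLimits X.obj.obj.base := (hU.obj X).1
  SubBicat.Hom.mk (zetaHom X.obj.obj) fun _ A => inferInstanceAs (IsIso (𝟙 (X.obj.obj.ext A)))

/-- `zetaFull` is a morphism of DFL comprehension categories. -/
abbrev ZetaLands : Prop := ∀ X : DFLCompCat.{v, u} k, (dflData k).Q (zetaFull hU X)

variable (hZ : ZetaLands.{v, u} hU)

/-- The lax morphism underlying a morphism of DFL comprehension categories. -/
def lax {X Y : DFLCompCat.{v, u} k} (S : X ⟶ Y) : LaxHom X.obj.obj Y.obj.obj :=
  SubBicat.Hom.hom (SubBicat.Hom.hom S)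

/-- The cell underlying a 2-cell of DFL comprehension categories. -/
def cell {X Y : DFLCompCat.{v, u} k} {S T : X ⟶ Y} (τ : S ⟶ T) : Cell (lax S) (lax T) :=
  SubBicat.Hom₂.hom (SubBicat.Hom₂.hom τ)

theorem zeta_aux₁ {C₁ : Type*} [Category* C₁] {a b : C₁} (p : a ⟶ b) : p ≫ 𝟙 b = 𝟙 a ≫ p := by
  simp

theorem zeta_aux₂ {C₁ : Type*} [Category* C₁] {a : C₁} {p q : a ⟶ a} (hp : p = 𝟙 a)
    (hq : q = 𝟙 a) : p ≫ ((𝟙 a ≫ 𝟙 a) ≫ 𝟙 a) ≫ 𝟙 a = q ≫ 𝟙 a ≫ 𝟙 a := by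
  simp [hp, hq]

theorem zeta_aux₃ {C₁ : Type*} [Category* C₁] {a : C₁} {p : a ⟶ a} (hp : p = 𝟙 a) :
    𝟙 a ≫ ((𝟙 a ≫ 𝟙 a) ≫ 𝟙 a) ≫ 𝟙 a = 𝟙 a ≫ 𝟙 a ≫ 𝟙 a ≫ 𝟙 a ≫ p ≫ 𝟙 a := by
  simp [hp]

theorem zeta_aux₄ {C₁ C₂ : Type*} [Category* C₁] [Category* C₂] (T : C₁ ⥤ C₂) {a b : C₁} {c : C₂}
    (p : a ⟶ b) (q : T.obj b ⟶ c) (hp : IsIso p)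
    (hq : IsIso q) {r : c ⟶ c} (hr : r = 𝟙 c) :
    inv (T.map p ≫ q) ≫ ((𝟙 (T.obj a) ≫ 𝟙 (T.obj a)) ≫ 𝟙 (T.obj a)) ≫ 𝟙 (T.obj a) =
      r ≫ 𝟙 c ≫ inv q ≫ 𝟙 (T.obj b) ≫ T.map (inv p) ≫ 𝟙 (T.obj a) := by
  simp [hr]

theorem zeta_aux₅ {C : Type*} [Category* C] {a b c d : C} {p : a ⟶ b} {q : b ⟶ d} {r : a ⟶ c}
    {s : c ⟶ d} (hr : IsIso r) (hq : IsIso q) (h : p ≫ q = r ≫ s) : s ≫ inv q = inv r ≫ p :=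
  inv_naturality h

/-- The pseudonatural transformation `ζ`. -/
noncomputable def zeta : Pseudofunctor.id (DFLCompCat.{v, u} k) ⟶ (baseU hU).comp (arrowH hH) where
  app X := SubBicat.Hom.mk (zetaFull hU X) (hZ X)
  naturality {X Y} S :=
    have : HasFiniteLimits X.obj.obj.base := (hU.obj X).1
    have : HasFiniteLimits Y.obj.obj.base := (hU.obj Y).1
    have : PreservesFiniteLimits (lax S).functor := hU.map S
    have : ∀ (Γ : X.obj.obj.base) (A : X.obj.obj.types.Ob Γ),
        IsIso ((lax S).comparison A) :=
      fun _ A => SubBicat.Hom.prop (SubBicat.Hom.hom S) A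
    SubBicat.isoMk (SubBicat.isoMk (zetaIso (lax S)))
  naturality_naturality {X Y S T} τ := SubBicat.Hom₂.ext (SubBicat.Hom₂.ext (by
    have : HasFiniteLimits Y.obj.obj.base := (hU.obj Y).1
    have : ∀ (Γ : X.obj.obj.base) (A : X.obj.obj.types.Ob Γ), IsIso ((lax S).comparison A) :=
      fun _ A => SubBicat.Hom.prop (SubBicat.Hom.hom S) A
    have hT : ∀ (Γ : X.obj.obj.base) (A : X.obj.obj.types.Ob Γ), IsIso ((lax T).comparison A) :=
      fun _ A => SubBicat.Hom.prop (SubBicat.Hom.hom T) A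
    exact Cell.arrows_ext (D := Y.obj.obj.base) (fun Γ => zeta_aux₁ ((cell τ).trans.app Γ))
      (fun _ A => zeta_aux₅ (this _ A) (hT _ A) ((cell τ).comm A).symm)))
  naturality_id X := SubBicat.Hom₂.ext (SubBicat.Hom₂.ext (by
    have : HasFiniteLimits X.obj.obj.base := (hU.obj X).1
    exact Cell.arrows_ext (D := X.obj.obj.base) (fun Γ => zeta_aux₂ rfl rfl)
      (fun _ A => zeta_aux₂ (IsIso.inv_id) (X.obj.obj.extMap_id A))))
  naturality_comp {X Y Z} S T := SubBicat.Hom₂.ext (SubBicat.Hom₂.ext (by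
    have : HasFiniteLimits Z.obj.obj.base := (hU.obj Z).1
    have : ∀ (Γ : X.obj.obj.base) (A : X.obj.obj.types.Ob Γ), IsIso ((lax S).comparison A) :=
      fun _ A => SubBicat.Hom.prop (SubBicat.Hom.hom S) A
    have hT : ∀ (Γ : Y.obj.obj.base) (A : Y.obj.obj.types.Ob Γ), IsIso ((lax T).comparison A) :=
      fun _ A => SubBicat.Hom.prop (SubBicat.Hom.hom T) A
    exact Cell.arrows_ext (D := Z.obj.obj.base)
      (fun Γ => zeta_aux₃ ((lax T).functor.map_id ((lax S).functor.obj Γ)))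
      (fun _ A => zeta_aux₄ (lax T).functor ((lax S).comparison A) ((lax T).comparison _)
        (this _ A) (hT _ _) (Z.obj.obj.extMap_id _))))

/-- The pseudonatural transformation `ξ`, all of whose components are identities. -/
noncomputable def xi : (arrowH hH).comp (baseU hU) ⟶ Pseudofunctor.id (FinLim.{v, u} k) where
  app C := SubBicat.Hom.mk (𝟙 C.obj) ((finLimData k).id C.prop)
  naturality {C D} F := SubBicat.isoMk ((ρ_ (SubBicat.Hom.hom F)) ≪≫ (λ_ (SubBicat.Hom.hom F)).symm)
  naturality_naturality {C D F G} τ := SubBicat.Hom₂.ext (cat_hom₂_ext fun x =>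
    (by simp : ∀ {C₁ : Type u} [Category.{v} C₁] {a b : C₁} (p : a ⟶ b),
      p ≫ 𝟙 b ≫ 𝟙 b = (𝟙 a ≫ 𝟙 a) ≫ p) ((nt τ).app x))
  naturality_id C := SubBicat.Hom₂.ext (cat_hom₂_ext fun x =>
    (by simp : ∀ {C₁ : Type u} [Category.{v} C₁] (a : C₁),
      (𝟙 a ≫ 𝟙 a) ≫ 𝟙 a = (𝟙 a ≫ (𝟙 a ≫ 𝟙 a) ≫ 𝟙 a) ≫ 𝟙 a ≫ 𝟙 a) x)
  naturality_comp {C D E} F G := SubBicat.Hom₂.ext (cat_hom₂_ext fun x =>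
    (by simp : ∀ {C₁ C₂ : Type u} [Category.{v} C₁] [Category.{v} C₂] (G : C₁ ⥤ C₂) (a : C₁),
      (𝟙 (G.obj a) ≫ 𝟙 (G.obj a)) ≫ 𝟙 (G.obj a) =
        (𝟙 (G.obj a) ≫ (𝟙 (G.obj a) ≫ 𝟙 (G.obj a)) ≫ 𝟙 (G.obj a)) ≫ 𝟙 (G.obj a) ≫
          (𝟙 (G.obj a) ≫ 𝟙 (G.obj a)) ≫ 𝟙 (G.obj a) ≫ G.map (𝟙 a ≫ 𝟙 a) ≫ 𝟙 (G.obj a))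
      (fn G) ((fn F).obj x))

end CompCat

end LCCCBiequiv

open LCCCBiequiv
open scoped CategoryTheory.Pseudofunctor.StrongTrans

/-!
In a DFL comprehension category every morphism `f : Θ ⟶ Γ` of contexts is a display map, that is,
isomorphic over `Γ` to a projection (`CompCat.isDisplay_of_isDemocratic`). Indeed `Θ` is the
extension of the empty context by a type, so the projection of `Γ ⨯ Θ` onto `Γ` is the projection of
a weakened type; the graph of `f` is the projection of an equalizer type over `Γ ⨯ Θ`
(`CompCat.exists_isLimit_fork`); and strong dependent sums compose the two projections. Since the
comprehension functor is fully faithful, types over `Γ` therefore form a category equivalent to the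
slice over `Γ`, and substitution corresponds to pulling back.

* Consequently the category of contexts has finite limits and morphisms of DFL comprehension
  categories preserve them (`CompCat.baseLands`). Conversely, if all morphisms are display maps and
  there are finite limits, then the fibrewise limits are those of the slices and dependent sums are
  composites, so the comprehension category is DFL (`CompCat.arrowLands`, `CompCat.zetaLands`).
* A 2-cell into a full comprehension category is the same as a natural transformation between the
  actions on contexts (`CompCat.cellOfTrans`, `CompCat.dfl_hom₂_ext`). All equations between 2-cells
  in the unit and the counit can hence be checked on contexts, where every cell that occurs is an
  identity. The inverse of `CompCat.zeta` sends a morphism to a type whose projection is isomorphic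
  to it (`CompCat.zetaInvHom`).
* Dependent products along a morphism are described by a universal property in the category alone,
  without chosen pullbacks (`IsPiObj`). For any functor that is, up to equivalence, pulling back
  along `f`, universal arrows from it are the same as dependent products along `f`
  (`PullbackModel.isCouniversal_iff`). As the Beck-Chevalley condition says that universal
  arrows are sent to universal arrows (`rightBeckChevalley_of_isCouniversal`), both local Cartesian closure and
  dependent product types amount to the existence of dependent products of contexts, and both
  preservation conditions to their preservation by the functor on contexts (`isLCC_iff`,
  `preservesExponentials_iff`, `CompCat.preservesPi_iff`). This yields the displayed biequivalence
  (`CompCat.dispBiequivalence`).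
* The biequivalence of total bicategories is obtained by lifting units, counits and modifications
  componentwise, since 2-cells carry no further condition
  (`DispBiequivalence.totalBiequivalence`).
-/

namespace LCCCBiequiv

/-! ### Universal arrows and the Beck-Chevalley conditions -/

section UniversalArrows

universe v₁ v₂ v₃ v₄ u₁ u₂ u₃ u₄

variable {C₁ : Type u₁} {C₂ : Type u₂} {C₃ : Type u₃} {C₄ : Type u₄} [Category.{v₁} C₁]
  [Category.{v₂} C₂] [Category.{v₃} C₃] [Category.{v₄} C₄]

/-- `e : G r ⟶ c` is a universal arrow from the functor `G` to `c`. -/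
def IsCouniversal (G : C₁ ⥤ C₂) {r : C₁} {c : C₂} (e : G.obj r ⟶ c) : Prop :=
  ∀ ⦃z : C₁⦄ (g : G.obj z ⟶ c), ∃! h : z ⟶ r, G.map h ≫ e = g

/-- `η : b ⟶ G l` is a universal arrow from `b` to the functor `G`. -/
def IsUniversalArrow (G : C₁ ⥤ C₂) {l : C₁} {b : C₂} (η : b ⟶ G.obj l) : Prop :=
  ∀ ⦃z : C₁⦄ (g : b ⟶ G.obj z), ∃! h : l ⟶ z, η ≫ G.map h = g

section

variable {G : C₁ ⥤ C₂}

theorem isCouniversal_counit {R : C₂ ⥤ C₁} (adj : G ⊣ R) (c : C₂) :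
    IsCouniversal G (adj.counit.app c) := by
  intro z g
  refine ⟨adj.homEquiv _ _ g, ?_, fun h hh => ?_⟩
  · simp [Adjunction.homEquiv_unit]
  · subst hh
    simp [Adjunction.homEquiv_unit]

theorem isUniversalArrow_unit {L : C₂ ⥤ C₁} (adj : L ⊣ G) (b : C₂) :
    IsUniversalArrow G (adj.unit.app b) := by
  intro z g
  refine ⟨(adj.homEquiv _ _).symm g, ?_, fun h hh => ?_⟩
  · simp [Adjunction.homEquiv_counit]
  · subst hh
    simp [Adjunction.homEquiv_counit]

theorem IsCouniversal.isIso {r r' : C₁} {c : C₂} {e : G.obj r ⟶ c} {e' : G.obj r' ⟶ c}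
    (he : IsCouniversal G e) (he' : IsCouniversal G e') {h : r' ⟶ r} (w : G.map h ≫ e = e') :
    IsIso h := by
  obtain ⟨k, hk, -⟩ := he' e
  refine ⟨k, (he' e').unique ?_ (by simp), (he e).unique ?_ (by simp)⟩
  · rw [G.map_comp, Category.assoc, hk, w]
  · rw [G.map_comp, Category.assoc, w, hk]

theorem IsCouniversal.of_isIso {r r' : C₁} {c : C₂} {e : G.obj r ⟶ c} {e' : G.obj r' ⟶ c}
    (he : IsCouniversal G e) {h : r' ⟶ r} (hh : IsIso h) (w : G.map h ≫ e = e') :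
    IsCouniversal G e' := by
  intro z g
  obtain ⟨k, hk, hk'⟩ := he g
  refine ⟨k ≫ inv h, ?_, fun l hl => ?_⟩
  · dsimp only
    rw [← w, ← G.map_comp_assoc, Category.assoc, IsIso.inv_hom_id, Category.comp_id, hk]
  · rw [IsIso.eq_comp_inv]
    refine hk' _ ?_
    dsimp only
    rw [G.map_comp, Category.assoc, w, hl]

theorem IsUniversalArrow.isIso {l l' : C₁} {b : C₂} {η : b ⟶ G.obj l} {η' : b ⟶ G.obj l'}
    (hη : IsUniversalArrow G η) (hη' : IsUniversalArrow G η') {h : l ⟶ l'}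
    (w : η ≫ G.map h = η') : IsIso h := by
  obtain ⟨k, hk, -⟩ := hη' η
  refine ⟨k, (hη η).unique ?_ (by simp), (hη' η').unique ?_ (by simp)⟩
  · rw [G.map_comp, ← Category.assoc, w, hk]
  · rw [G.map_comp, ← Category.assoc, hk, w]

theorem isLeftAdjoint_of_isCouniversal
    (H : ∀ c : C₂, ∃ (r : C₁) (e : G.obj r ⟶ c), IsCouniversal G e) : G.IsLeftAdjoint := by
  have : ∀ c, HasTerminal (CostructuredArrow G c) := fun c => by
    obtain ⟨r, e, h⟩ := H c
    refine (IsTerminal.ofUniqueHom (Y := CostructuredArrow.mk e)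
      (fun Z => CostructuredArrow.homMk (h Z.hom).choose (h Z.hom).choose_spec.1)
      (fun Z m => ?_)).hasTerminal
    exact CostructuredArrow.hom_ext _ _
      ((h Z.hom).choose_spec.2 m.left (CostructuredArrow.w m))
  exact isLeftAdjoint_of_costructuredArrowTerminals G

theorem isRightAdjoint_of_isUniversalArrow
    (H : ∀ b : C₂, ∃ (l : C₁) (η : b ⟶ G.obj l), IsUniversalArrow G η) : G.IsRightAdjoint := by
  have : ∀ b, HasInitial (StructuredArrow b G) := fun b => by
    obtain ⟨l, η, h⟩ := H b
    refine (IsInitial.ofUniqueHom (X := StructuredArrow.mk η)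
      (fun Z => StructuredArrow.homMk (h Z.hom).choose (h Z.hom).choose_spec.1)
      (fun Z m => ?_)).hasInitial
    exact StructuredArrow.hom_ext _ _
      ((h Z.hom).choose_spec.2 m.right (StructuredArrow.w m))
  exact isRightAdjointOfStructuredArrowInitials G

end

variable {F₁ : C₁ ⥤ C₂} {G₁ : C₁ ⥤ C₃} {G₂ : C₂ ⥤ C₄} {F₂ : C₃ ⥤ C₄}

/-- The mate of `τ` is the comparison, from the image of the universal arrow for `G₁` to the
universal arrow for `G₂`, so it is invertible as soon as that image is universal. -/
theorem rightBeckChevalley_of_isCouniversal {τ : F₁ ⋙ G₂ ⟶ G₁ ⋙ F₂}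
    (H : ∀ ⦃r : C₁⦄ ⦃c : C₃⦄ (e : G₁.obj r ⟶ c), IsCouniversal G₁ e →
      IsCouniversal G₂ (c := F₂.obj c) (τ.app r ≫ F₂.map e)) : RightBeckChevalley τ := by
  intro R₁ R₂ adj₁ adj₂ c
  refine (isCouniversal_counit adj₂ (F₂.obj c)).isIso
    (H _ (isCouniversal_counit adj₁ c)) ?_
  rw [← R₂.map_comp, G₂.map_comp, Category.assoc]
  erw [adj₂.counit_naturality, adj₂.left_triangle_components_assoc]

theorem RightBeckChevalley.isCouniversal {τ : F₁ ⋙ G₂ ⟶ G₁ ⋙ F₂} (hτ : RightBeckChevalley τ)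
    (h₁ : G₁.IsLeftAdjoint) (h₂ : G₂.IsLeftAdjoint) {r : C₁} {c : C₃} {e : G₁.obj r ⟶ c}
    (he : IsCouniversal G₁ e) : IsCouniversal G₂ (c := F₂.obj c) (τ.app r ≫ F₂.map e) := by
  obtain ⟨R₁, ⟨adj₁⟩⟩ := h₁.exists_rightAdjoint
  obtain ⟨R₂, ⟨adj₂⟩⟩ := h₂.exists_rightAdjoint
  obtain ⟨h, hh, -⟩ := isCouniversal_counit adj₁ c e
  have hiso : IsIso h := (isCouniversal_counit adj₁ c).isIso he hh
  have key : IsCouniversal G₂ (c := F₂.obj c)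
      (τ.app (R₁.obj c) ≫ F₂.map (adj₁.counit.app c)) := by
    refine (isCouniversal_counit adj₂ (F₂.obj c)).of_isIso (hτ adj₁ adj₂ c) ?_
    rw [← R₂.map_comp, G₂.map_comp, Category.assoc]
    erw [adj₂.counit_naturality, adj₂.left_triangle_components_assoc]
  refine key.of_isIso (h := F₁.map h) (Functor.map_isIso F₁ h) ?_
  have := τ.naturality h
  dsimp only [Functor.comp_map] at this
  rw [reassoc_of% this, ← F₂.map_comp, hh]

theorem leftBeckChevalley_of_isUniversalArrow {τ : G₁ ⋙ F₂ ⟶ F₁ ⋙ G₂}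
    (H : ∀ ⦃l : C₁⦄ ⦃b : C₃⦄ (η : b ⟶ G₁.obj l), IsUniversalArrow G₁ η →
      IsUniversalArrow G₂ (b := F₂.obj b) (F₂.map η ≫ τ.app l)) : LeftBeckChevalley τ := by
  intro L₁ L₂ adj₁ adj₂ b
  refine (isUniversalArrow_unit adj₂ (F₂.obj b)).isIso
    (H _ (isUniversalArrow_unit adj₁ b)) ?_
  rw [← L₂.map_comp_assoc, G₂.map_comp]
  erw [adj₂.unit_naturality_assoc, adj₂.right_triangle_components]
  simp

end UniversalArrows

namespace CompCat

/-! ### Types as objects of slice categories -/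

section Extension

variable (X : CompCat.{v, u})

/-- Context extension as a functor on the total category of types. -/
def extTot : X.types.Tot ⥤ X.base where
  obj T := X.ext T.ob
  map a := X.extMap a.hom
  map_id T := X.extMap_id T.ob
  map_comp a b := X.extMap_comp a.hom b.hom

@[simp]
theorem extMap_fiber_comp {Γ : X.base} {A B C : X.types.Fiber Γ} (a : A ⟶ B) (b : B ⟶ C) :
    X.extMap (DispCat.FiberHom.hom (a ≫ b)) =
      X.extMap (DispCat.FiberHom.hom a) ≫ X.extMap (DispCat.FiberHom.hom b) :=
  (congrArg X.extTot.map (DispCat.fiber_tot_comp a b)).trans (X.extTot.map_comp _ _)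

@[simp]
theorem extMap_fiber_id {Γ : X.base} (A : X.types.Fiber Γ) :
    X.extMap (DispCat.FiberHom.hom (𝟙 A)) = 𝟙 (X.ext A.ob) :=
  X.extMap_id A.ob

theorem extMap_fiber_pr {Γ : X.base} {A B : X.types.Fiber Γ} (a : A ⟶ B) :
    X.extMap a.hom ≫ X.pr B.ob = X.pr A.ob :=
  (X.extMap_pr a.hom).trans (Category.comp_id _)

/-- The functor sending a type over `Γ` to its projection. -/
def toOver (Γ : X.base) : X.types.Fiber Γ ⥤ Over Γ where
  obj A := Over.mk (X.pr A.ob)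
  map a := Over.homMk (X.extMap (DispCat.FiberHom.hom a)) (X.extMap_fiber_pr a)
  map_id A := Over.OverMorphism.ext (X.extMap_fiber_id A)
  map_comp a b := Over.OverMorphism.ext (X.extMap_fiber_comp a b)

instance isIso_extMap {Γ : X.base} {A B : X.types.Fiber Γ} (a : A ⟶ B) [IsIso a] :
    IsIso (X.extMap a.hom) :=
  inferInstanceAs (IsIso ((Over.forget Γ).map ((X.toOver Γ).map a)))

theorem isPullback_of_isCartesian {Γ Γ' : X.base} {f : Γ ⟶ Γ'} {A : X.types.Ob Γ}
    {B : X.types.Ob Γ'} {a : X.types.Hom f A B} (ha : DispCat.IsCartesian a) :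
    IsPullback (X.extMap a) (X.pr A) (X.pr B) f :=
  (arr_isCartesian_iff (X.compr.map a)).1 (X.compr_cartesian a ha)

/-- The Cartesian lift of `f` at a type, as a morphism from its substitution along `f`. -/
def substLift {Γ Γ' : X.base} (f : Γ ⟶ Γ') (B : X.types.Fiber Γ') :
    X.types.Hom f ((X.subst f).obj B).ob B.ob :=
  X.cleaving.liftAt f B

theorem isPullback_lift {Γ Γ' : X.base} (f : Γ ⟶ Γ') (B : X.types.Fiber Γ') :
    IsPullback (X.extMap (X.substLift f B)) (X.pr ((X.subst f).obj B).ob) (X.pr B.ob) f :=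
  X.isPullback_of_isCartesian (a := X.substLift f B) (X.cleaving.liftAt_cartesian f B)

/-- The morphism of extended contexts over `f` given by a morphism to a substitution along `f`. -/
noncomputable def transpose {Γ Γ' : X.base} {f : Γ ⟶ Γ'} {b : X.types.Fiber Γ}
    {l : X.types.Fiber Γ'} (η : b ⟶ (X.subst f).obj l) : X.ext b.ob ⟶ X.ext l.ob :=
  X.extMap η.hom ≫ X.extMap (X.substLift f l)

theorem transpose_pr {Γ Γ' : X.base} {f : Γ ⟶ Γ'} {b : X.types.Fiber Γ}
    {l : X.types.Fiber Γ'} (η : b ⟶ (X.subst f).obj l) :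
    X.transpose η ≫ X.pr l.ob = X.pr b.ob ≫ f := by
  rw [transpose, Category.assoc, (X.isPullback_lift f l).w, ← Category.assoc, extMap_fiber_pr]

theorem extMap_subst_lift {Γ Γ' : X.base} (f : Γ ⟶ Γ') {A B : X.types.Fiber Γ'} (a : A ⟶ B) :
    X.extMap ((X.subst f).map a).hom ≫ X.extMap (X.substLift f B) =
      X.extMap (X.substLift f A) ≫ X.extMap a.hom :=
  (X.extTot.map_comp _ _).symm.trans
    ((congrArg X.extTot.map (X.cleaving.reindex_map_lift f a)).trans (X.extTot.map_comp _ _))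

theorem transpose_comp_subst {Γ Γ' : X.base} {f : Γ ⟶ Γ'} {b : X.types.Fiber Γ}
    {l z : X.types.Fiber Γ'} (η : b ⟶ (X.subst f).obj l) (h : l ⟶ z) :
    X.transpose (η ≫ (X.subst f).map h) = X.transpose η ≫ X.extMap h.hom := by
  rw [transpose, extMap_fiber_comp, Category.assoc, extMap_subst_lift, ← Category.assoc,
    transpose]

theorem transpose_precomp {Γ Γ' : X.base} {f : Γ ⟶ Γ'} {b b' : X.types.Fiber Γ}
    {l : X.types.Fiber Γ'} (a : b' ⟶ b) (η : b ⟶ (X.subst f).obj l) :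
    X.transpose (a ≫ η) = X.extMap a.hom ≫ X.transpose η := by
  rw [transpose, extMap_fiber_comp, Category.assoc, transpose]

end Extension

section Full

/-- The comprehension functor is fully faithful. -/
def IsFullyFaithful (X : CompCat.{v, u}) : Prop :=
  ∀ ⦃Γ Γ' : X.base⦄ (f : Γ ⟶ Γ') (A : X.types.Ob Γ) (B : X.types.Ob Γ'),
    Function.Bijective (fun a : X.types.Hom f A B => X.compr.map a)

theorem ofArrows_isFullyFaithful (C : Cat.{v, u}) [HasFiniteLimits C] :
    IsFullyFaithful (ofArrows C) :=
  fun _ _ _ _ _ => Function.bijective_id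

variable {X : CompCat.{v, u}}

namespace IsFullyFaithful

variable (hX : IsFullyFaithful X)

include hX

theorem hom_ext {Γ Γ' : X.base} {f : Γ ⟶ Γ'} {A : X.types.Ob Γ} {B : X.types.Ob Γ'}
    {a b : X.types.Hom f A B} (h : X.extMap a = X.extMap b) : a = b :=
  (hX f A B).1 (ArrHom.ext h)

theorem exists_hom {Γ Γ' : X.base} {f : Γ ⟶ Γ'} {A : X.types.Ob Γ} {B : X.types.Ob Γ'}
    (t : X.ext A ⟶ X.ext B) (ht : t ≫ X.pr B = X.pr A ≫ f) :
    ∃ a : X.types.Hom f A B, X.extMap a = t := by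
  obtain ⟨a, ha⟩ := (hX f A B).2 (ArrHom.mk t ht)
  exact ⟨a, congrArg ArrHom.top ha⟩

theorem fiber_hom_ext {Γ : X.base} {A B : X.types.Fiber Γ} {a b : A ⟶ B}
    (h : X.extMap a.hom = X.extMap b.hom) : a = b :=
  DispCat.FiberHom.ext (hX.hom_ext h)

theorem exists_fiber_hom {Γ : X.base} {A B : X.types.Fiber Γ}
    (t : X.ext A.ob ⟶ X.ext B.ob) (ht : t ≫ X.pr B.ob = X.pr A.ob) :
    ∃ a : A ⟶ B, X.extMap a.hom = t := by
  obtain ⟨a, ha⟩ := hX.exists_hom (f := 𝟙 Γ) t (ht.trans (Category.comp_id _).symm)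
  exact ⟨⟨a⟩, ha⟩

theorem isCartesian_iff {Γ Γ' : X.base} {f : Γ ⟶ Γ'} {A : X.types.Ob Γ}
    {B : X.types.Ob Γ'} {a : X.types.Hom f A B} :
    DispCat.IsCartesian a ↔ IsPullback (X.extMap a) (X.pr A) (X.pr B) f := by
  refine ⟨X.isPullback_of_isCartesian, fun h W W' g b => ?_⟩
  have e : X.extMap b ≫ X.pr B = (X.pr W' ≫ g) ≫ f := by rw [X.extMap_pr, Category.assoc]
  obtain ⟨k, hk⟩ := hX.exists_hom (f := g) (h.lift _ _ e) (h.lift_snd _ _ _)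
  refine ⟨k, hX.hom_ext ?_, fun l hl => hX.hom_ext (h.hom_ext ?_ ?_)⟩
  · rw [extMap_comp, hk, h.lift_fst]
  · rw [hk, h.lift_fst, ← hl, extMap_comp]
  · rw [X.extMap_pr, X.extMap_pr]

theorem toOver_faithful (Γ : X.base) : (X.toOver Γ).Faithful where
  map_injective h := hX.fiber_hom_ext (congrArg CommaMorphism.left h)

theorem toOver_full (Γ : X.base) : (X.toOver Γ).Full where
  map_surjective t := by
    obtain ⟨a, ha⟩ := hX.exists_fiber_hom t.left (Over.w t)
    exact ⟨a, Over.OverMorphism.ext ha⟩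

theorem transpose_ext {Γ Γ' : X.base} {f : Γ ⟶ Γ'} {b : X.types.Fiber Γ}
    {l : X.types.Fiber Γ'} {a a' : b ⟶ (X.subst f).obj l} (h : X.transpose a = X.transpose a') :
    a = a' := by
  refine hX.fiber_hom_ext ((X.isPullback_lift f l).hom_ext h ?_)
  rw [extMap_fiber_pr, extMap_fiber_pr]

theorem exists_transpose {Γ Γ' : X.base} {f : Γ ⟶ Γ'} {b : X.types.Fiber Γ}
    {l : X.types.Fiber Γ'} (t : X.ext b.ob ⟶ X.ext l.ob) (ht : t ≫ X.pr l.ob = X.pr b.ob ≫ f) :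
    ∃ a : b ⟶ (X.subst f).obj l, X.transpose a = t := by
  obtain ⟨a, ha⟩ := hX.exists_fiber_hom (B := (X.subst f).obj l)
    ((X.isPullback_lift f l).lift t (X.pr b.ob) ht) ((X.isPullback_lift f l).lift_snd _ _ _)
  exact ⟨a, by rw [transpose, ha]; exact (X.isPullback_lift f l).lift_fst _ _ _⟩

/-- Dependent sums are composites: if the transpose of `η` is invertible, then the projection of
`l` is, up to isomorphism, the composite of the projection of `b` with `f`. -/
theorem isUniversalArrow_of_isIso {Γ Γ' : X.base} {f : Γ ⟶ Γ'} {b : X.types.Fiber Γ}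
    {l : X.types.Fiber Γ'} {η : b ⟶ (X.subst f).obj l} (h : IsIso (X.transpose η)) :
    IsUniversalArrow (X.subst f) η := by
  intro z g
  obtain ⟨k, hk⟩ := hX.exists_fiber_hom (A := l) (B := z) (inv (X.transpose η) ≫ X.transpose g) (by
    rw [Category.assoc, IsIso.inv_comp_eq, transpose_pr, transpose_pr])
  refine ⟨k, hX.transpose_ext ?_, fun m hm => hX.fiber_hom_ext ?_⟩
  · rw [transpose_comp_subst, hk, IsIso.hom_inv_id_assoc]
  · rw [hk, IsIso.eq_inv_comp, ← hm, transpose_comp_subst]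

end IsFullyFaithful

variable (X) in
/-- Display maps: morphisms isomorphic over their codomain to a projection. -/
def IsDisplay {Θ Γ : X.base} (f : Θ ⟶ Γ) : Prop :=
  ∃ (A : X.types.Fiber Γ) (i : Θ ≅ X.ext A.ob), i.hom ≫ X.pr A.ob = f

theorem isDisplay_pr {Γ : X.base} (A : X.types.Ob Γ) : X.IsDisplay (X.pr A) :=
  ⟨⟨A⟩, Iso.refl _, Category.id_comp _⟩

theorem ofArrows_isDisplay (C : Cat.{v, u}) [HasFiniteLimits C] {Θ Γ : C} (f : Θ ⟶ Γ) :
    (ofArrows C).IsDisplay f :=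
  isDisplay_pr (X := ofArrows C) (ArrOb.mk Θ f)

theorem toOver_essSurj (h : ∀ {Θ Γ : X.base} (f : Θ ⟶ Γ), X.IsDisplay f) (Γ : X.base) :
    (X.toOver Γ).EssSurj where
  mem_essImage Y := by
    obtain ⟨A, i, hi⟩ := h Y.hom
    exact ⟨A, ⟨(Over.isoMk i hi).symm⟩⟩

theorem IsFullyFaithful.toOver_isEquivalence (hX : IsFullyFaithful X)
    (h : ∀ {Θ Γ : X.base} (f : Θ ⟶ Γ), X.IsDisplay f) (Γ : X.base) :
    (X.toOver Γ).IsEquivalence where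
  faithful := hX.toOver_faithful Γ
  full := hX.toOver_full Γ
  essSurj := toOver_essSurj h Γ

theorem IsFullyFaithful.isIso_transpose (hX : IsFullyFaithful X) {Γ Γ' : X.base} {f : Γ ⟶ Γ'}
    {b : X.types.Fiber Γ} {l : X.types.Fiber Γ'} {η : b ⟶ (X.subst f).obj l}
    (hd : X.IsDisplay (X.pr b.ob ≫ f)) (h : IsUniversalArrow (X.subst f) η) :
    IsIso (X.transpose η) := by
  obtain ⟨s, i, hi⟩ := hd
  obtain ⟨η', hη'⟩ := hX.exists_transpose (f := f) (b := b) (l := s) i.hom hi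
  have hu : IsUniversalArrow (X.subst f) η' :=
    hX.isUniversalArrow_of_isIso (by rw [hη']; infer_instance)
  obtain ⟨k, hk, -⟩ := hu η
  have : IsIso k := hu.isIso h hk
  rw [← hk, transpose_comp_subst, hη']
  infer_instance

theorem isIso_of_isPullback {C : Type*} [Category* C] {P P' x y z : C} {p : P ⟶ x} {q : P ⟶ y}
    {p' : P' ⟶ x} {q' : P' ⟶ y} {f : x ⟶ z} {g : y ⟶ z} (h : IsPullback p q f g)
    (h' : IsPullback p' q' f g) {k : P ⟶ P'} (hp : k ≫ p' = p) (hq : k ≫ q' = q) : IsIso k := by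
  have : k = (IsPullback.isoIsPullback x y h h').hom := h'.hom_ext (by simp [hp]) (by simp [hq])
  rw [this]
  infer_instance

variable (X) in
/-- The component at `Z` of the comparison of composite substitutions along the two paths of a
commuting square. -/
noncomputable def substCompare {w x y z : X.base} {p : w ⟶ x} {q : x ⟶ z}
    {r : w ⟶ y} {s : y ⟶ z} (h : p ≫ q = r ≫ s) (Z : X.types.Fiber z) :
    (X.subst p).obj ((X.subst q).obj Z) ⟶ (X.subst r).obj ((X.subst s).obj Z) :=
  X.cleaving.squareApp h Z

theorem transpose_substCompare {w x y z : X.base} {p : w ⟶ x} {q : x ⟶ z}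
    {r : w ⟶ y} {s : y ⟶ z} (h : p ≫ q = r ≫ s) (Z : X.types.Fiber z) :
    X.transpose (X.substCompare h Z) ≫ X.extMap (X.substLift s Z) =
      X.extMap (X.substLift p ((X.subst q).obj Z)) ≫ X.extMap (X.substLift q Z) := by
  have := congrArg X.extTot.map (X.cleaving.squareApp_lift h Z)
  rw [Functor.map_comp, Functor.map_comp, Functor.map_comp] at this
  rw [transpose, Category.assoc]
  exact this

/-- If every morphism is a display map, then dependent sums satisfy the Beck-Chevalley condition:
both sides are composites with the legs of a pullback square. -/
theorem IsFullyFaithful.leftBeckChevalley (hX : IsFullyFaithful X)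
    (hd : ∀ {Θ Γ : X.base} (f : Θ ⟶ Γ), X.IsDisplay f) {x₁ x₂ y₁ y₂ : X.base}
    {t : x₁ ⟶ x₂} {f₁ : x₁ ⟶ y₁} {f₂ : x₂ ⟶ y₂} {s : y₁ ⟶ y₂} (h : IsPullback t f₁ f₂ s) :
    LeftBeckChevalley (X.cleaving.square h.w) := by
  refine leftBeckChevalley_of_isUniversalArrow (G₁ := X.subst f₂) (G₂ := X.subst f₁)
    fun l b η hη => ?_
  refine hX.isUniversalArrow_of_isIso (η := (X.subst t).map η ≫ X.substCompare h.w l) ?_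
  have := hX.isIso_transpose (hd _) hη
  have h₁ : IsPullback (X.extMap (X.substLift t b) ≫ X.transpose η)
      (X.pr ((X.subst t).obj b).ob ≫ f₁) (X.pr l.ob) s :=
    ((X.isPullback_lift t b).paste_vert h).of_iso (Iso.refl _) (asIso (X.transpose η))
      (Iso.refl _) (Iso.refl _) (by simp) (by simp)
      (by rw [asIso_hom, transpose_pr]; exact Category.comp_id _) (by simp)
  refine isIso_of_isPullback h₁ (X.isPullback_lift s l) ?_ (transpose_pr X _)
  rw [transpose_precomp, Category.assoc, transpose_substCompare, ← Category.assoc,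
    X.extMap_subst_lift, transpose, Category.assoc]

theorem IsFullyFaithful.subst_isRightAdjoint (hX : IsFullyFaithful X)
    (hd : ∀ {Θ Γ : X.base} (f : Θ ⟶ Γ), X.IsDisplay f) {Γ Γ' : X.base} (f : Γ ⟶ Γ') :
    (X.subst f).IsRightAdjoint :=
  isRightAdjoint_of_isUniversalArrow fun b => by
    obtain ⟨s, i, hi⟩ := hd (X.pr b.ob ≫ f)
    obtain ⟨η, hη⟩ := hX.exists_transpose (f := f) (b := b) (l := s) i.hom hi
    exact ⟨s, η, hX.isUniversalArrow_of_isIso (by rw [hη]; infer_instance)⟩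

theorem IsFullyFaithful.hasStrongSigma (hX : IsFullyFaithful X)
    (hd : ∀ {Θ Γ : X.base} (f : Θ ⟶ Γ), X.IsDisplay f) : HasStrongSigma X where
  isRightAdjoint A := hX.subst_isRightAdjoint hd (X.pr A)
  beckChevalley h := hX.leftBeckChevalley hd h
  strong _ _ adj B := hX.isIso_transpose (hd _) (isUniversalArrow_unit adj B)

end Full

/-! ### Finite limits of contexts -/

section Democratic

variable {X : CompCat.{v, u}}

theorem IsDisplay.of_iso {Θ Θ' Γ : X.base} {f : Θ ⟶ Γ} {f' : Θ' ⟶ Γ} (h : X.IsDisplay f)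
    (i : Θ' ≅ Θ) (w : i.hom ≫ f = f') : X.IsDisplay f' := by
  obtain ⟨A, j, hj⟩ := h
  exact ⟨A, i ≪≫ j, by rw [Iso.trans_hom, Category.assoc, hj, w]⟩

/-- Composites of projections are display maps, by strong dependent sums. -/
theorem isDisplay_pr_comp_pr (hs : HasStrongSigma X) {Γ : X.base} (A : X.types.Fiber Γ)
    (B : X.types.Fiber (X.ext A.ob)) : X.IsDisplay (X.pr B.ob ≫ X.pr A.ob) := by
  obtain ⟨L, ⟨adj⟩⟩ := (hs.isRightAdjoint A.ob).exists_leftAdjoint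
  have : IsIso (X.transpose (f := X.pr A.ob) (l := L.obj B) (adj.unit.app B)) :=
    hs.strong A.ob L adj B
  exact ⟨L.obj B, asIso (X.transpose (f := X.pr A.ob) (l := L.obj B) (adj.unit.app B)),
    X.transpose_pr (f := X.pr A.ob) (l := L.obj B) (adj.unit.app B)⟩

/-- Fibrewise terminal objects that are stable under substitution, and whose projections are
invertible. -/
structure HasUnits (X : CompCat.{v, u}) : Prop where
  hasTerminal (Γ : X.base) : HasTerminal (X.types.Fiber Γ)
  preserves {Γ Γ' : X.base} (f : Γ ⟶ Γ') : PreservesLimitsOfShape (Discrete PEmpty.{1}) (X.subst f)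
  isIso {Γ : X.base} (T : X.types.Fiber Γ) : Nonempty (IsTerminal T) → IsIso (X.pr T.ob)

/-- Fibrewise equalizers that are stable under substitution. -/
structure HasEqTypes (X : CompCat.{v, u}) : Prop where
  hasEqualizers (Γ : X.base) : HasEqualizers (X.types.Fiber Γ)
  preserves {Γ Γ' : X.base} (f : Γ ⟶ Γ') : PreservesLimitsOfShape WalkingParallelPair (X.subst f)

/-- The projection of an equalizer type of two terms is the equalizer of the terms: a substitution
that equalizes the terms makes the substituted equalizer type a terminal type. -/
theorem exists_isLimit_fork (hX : IsFullyFaithful X) (hu : HasUnits X) (he : HasEqTypes X)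
    (hd : IsDemocratic X) {Γ B : X.base} (f g : Γ ⟶ B) :
    ∃ (E : X.types.Fiber Γ) (w : X.pr E.ob ≫ f = X.pr E.ob ≫ g),
      Nonempty (IsLimit (Fork.ofι (X.pr E.ob) w)) := by
  have := X.hasTerminal
  have ht : IsTerminal X.emptyCtx := terminalIsTerminal
  obtain ⟨B₀, ⟨j⟩⟩ := hd B
  let B₁ : X.types.Fiber X.emptyCtx := ⟨B₀⟩
  let j' : B ⟶ X.ext B₁.ob := j.hom
  have hj : Mono j' := inferInstanceAs (Mono j.hom)
  have := hu.hasTerminal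
  let T (Γ : X.base) : X.types.Fiber Γ := ⊤_ _
  have hT (Γ : X.base) : IsTerminal (T Γ) := terminalIsTerminal
  have hp (Γ : X.base) : IsIso (X.pr (T Γ).ob) := hu.isIso _ ⟨hT Γ⟩
  -- Up to `j'`, the morphisms `f` and `g` are terms of a weakened type, that is, morphisms `a`
  -- and `b` from the terminal type over `Γ` to it.
  obtain ⟨a, ha⟩ := hX.exists_transpose (f := ht.from Γ) (b := T Γ) (l := B₁)
    (X.pr (T Γ).ob ≫ f ≫ j') (ht.hom_ext _ _)
  obtain ⟨b, hb⟩ := hX.exists_transpose (f := ht.from Γ) (b := T Γ) (l := B₁)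
    (X.pr (T Γ).ob ≫ g ≫ j') (ht.hom_ext _ _)
  have := he.hasEqualizers
  let i := equalizer.ι a b
  have hi : i ≫ a = i ≫ b := equalizer.condition a b
  have hlim : IsLimit (Fork.ofι i hi) := equalizerIsEqualizer a b
  have w : X.pr (equalizer a b).ob ≫ f = X.pr (equalizer a b).ob ≫ g := by
    have h := congrArg (fun m => X.transpose m) hi
    rw [transpose_precomp, transpose_precomp, ha, hb] at h
    simpa only [← Category.assoc, extMap_fiber_pr, cancel_mono] using h
  have hlim' {Θ : X.base} (s : Θ ⟶ Γ) :=
    have := he.preserves s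
    isLimitForkMapOfIsLimit (X.subst s) hi hlim
  have hmono {Θ : X.base} (s : Θ ⟶ Γ) : Mono ((X.subst s).map i) := mono_of_isLimit_fork (hlim' s)
  have hT' {Θ : X.base} (s : Θ ⟶ Γ) : IsTerminal ((X.subst s).obj (T Γ)) :=
    have := hu.preserves s
    IsTerminal.isTerminalObj (X.subst s) _ (hT Γ)
  -- Two lifts of a substitution are terms of the substituted equalizer type, which is a subobject
  -- of the terminal type.
  have hpr : Mono (X.pr (equalizer a b).ob) := by
    refine ⟨fun {Θ} m n hmn => ?_⟩
    obtain ⟨m', hm'⟩ := hX.exists_transpose (f := m ≫ X.pr (equalizer a b).ob) (b := T Θ)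
      (l := equalizer a b) (X.pr (T Θ).ob ≫ m) (Category.assoc _ _ _)
    obtain ⟨n', hn'⟩ := hX.exists_transpose (f := m ≫ X.pr (equalizer a b).ob) (b := T Θ)
      (l := equalizer a b) (X.pr (T Θ).ob ≫ n) (by rw [hmn, Category.assoc])
    have e : m' = n' := (cancel_mono ((X.subst (m ≫ X.pr (equalizer a b).ob)).map i)).1
      ((hT' _).hom_ext _ _)
    rw [e, hn', cancel_epi] at hm'
    exact hm'.symm
  refine ⟨equalizer a b, w, ⟨Fork.IsLimit.mk' _ fun c => ?_⟩⟩
  have key : ∃ u : c.pt ⟶ X.ext (equalizer a b).ob, u ≫ X.pr (equalizer a b).ob = c.ι := by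
    have hs : (X.subst c.ι).map a = (X.subst c.ι).map b := by
      refine hX.transpose_ext ?_
      rw [transpose, transpose, X.extMap_subst_lift, X.extMap_subst_lift]
      refine (X.isPullback_lift (ht.from Γ) B₁).hom_ext ?_ ?_
      · rw [Category.assoc, Category.assoc]
        refine Eq.trans (congrArg (_ ≫ ·) ha) (Eq.trans ?_ (congrArg (_ ≫ ·) hb).symm)
        have hw := (X.isPullback_lift c.ι (T Γ)).w
        rw [reassoc_of% hw, reassoc_of% hw, c.condition_assoc]
      · rw [Category.assoc, Category.assoc, extMap_fiber_pr, extMap_fiber_pr]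
    have : IsIso (X.pr ((X.subst c.ι).obj (T Γ)).ob) := hu.isIso _ ⟨hT' c.ι⟩
    obtain ⟨s, -⟩ := Fork.IsLimit.lift' (hlim' c.ι) (𝟙 _)
      (by rw [Category.id_comp, Category.id_comp, hs])
    let s' : (X.subst c.ι).obj (T Γ) ⟶ (X.subst c.ι).obj (equalizer a b) := s
    exact ⟨inv (X.pr ((X.subst c.ι).obj (T Γ)).ob) ≫ X.transpose s', by
      rw [Category.assoc, transpose_pr, IsIso.inv_hom_id_assoc]⟩
  exact ⟨key.choose, key.choose_spec, fun {m} hm =>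
    hpr.right_cancellation _ _ (hm.trans key.choose_spec.symm)⟩

/-- Every morphism of contexts `f : Θ ⟶ Γ` is a display map: `Γ ⨯ Θ` is the extension of `Γ` by
a weakened type, the graph of `f` is an equalizer type over it, and dependent sums compose the
two projections. -/
theorem isDisplay_of_isDemocratic (hX : IsFullyFaithful X) (hu : HasUnits X) (he : HasEqTypes X)
    (hs : HasStrongSigma X) (hd : IsDemocratic X) {Θ Γ : X.base} (f : Θ ⟶ Γ) : X.IsDisplay f := by
  have := X.hasTerminal
  have ht : IsTerminal X.emptyCtx := terminalIsTerminal
  obtain ⟨A₀, ⟨i⟩⟩ := hd Θ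
  let A₁ : X.types.Fiber X.emptyCtx := ⟨A₀⟩
  let i' : Θ ≅ X.ext A₁.ob := i
  let A := (X.subst (ht.from Γ)).obj A₁
  let q : X.ext A.ob ⟶ Θ := X.extMap (X.substLift (ht.from Γ) A₁) ≫ i'.inv
  have hP := X.isPullback_lift (ht.from Γ) A₁
  obtain ⟨E, w, ⟨hE⟩⟩ := exists_isLimit_fork hX hu he hd (q ≫ f) (X.pr A.ob)
  -- `X.ext A.ob` is the product of `Γ` and `Θ`, and `t` is the graph of `f`, whose image is the
  -- equalizer of `q ≫ f` and the projection to `Γ`.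
  let t : Θ ⟶ X.ext A.ob := hP.lift i'.hom f (ht.hom_ext _ _)
  have ht₁ : t ≫ q = 𝟙 Θ := by
    rw [← Category.assoc, hP.lift_fst, i'.hom_inv_id]
  have ht₂ : t ≫ X.pr A.ob = f := hP.lift_snd _ _ _
  obtain ⟨k, hk⟩ := Fork.IsLimit.lift' hE t (by rw [← Category.assoc, ht₁, ht₂, Category.id_comp])
  have hk' : k ≫ X.pr E.ob = t := hk
  have e₁ : X.pr E.ob ≫ q ≫ t = X.pr E.ob := by
    refine hP.hom_ext ?_ ?_
    · rw [Category.assoc, Category.assoc, hP.lift_fst, Category.assoc, i'.inv_hom_id,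
        Category.comp_id]
    · rw [Category.assoc, Category.assoc]
      exact (congrArg (fun m => _ ≫ q ≫ m) ht₂).trans w
  have e₂ : (X.pr E.ob ≫ q) ≫ k = 𝟙 _ := by
    refine Fork.IsLimit.hom_ext hE ?_
    change ((X.pr E.ob ≫ q) ≫ k) ≫ X.pr E.ob = 𝟙 _ ≫ X.pr E.ob
    rw [Category.assoc, hk', Category.assoc, e₁, Category.id_comp]
  refine (isDisplay_pr_comp_pr hs A E).of_iso
    ⟨k, X.pr E.ob ≫ q, by rw [← Category.assoc, hk', ht₁], e₂⟩ ?_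
  dsimp only
  rw [← Category.assoc, hk', ht₂]

theorem IsDisplay.exists_isPullback {Θ Γ Γ' : X.base} {f : Θ ⟶ Γ} (hf : X.IsDisplay f)
    (s : Γ' ⟶ Γ) : ∃ (A : X.types.Fiber Γ) (i : X.ext A.ob ≅ Θ), i.hom ≫ f = X.pr A.ob ∧
      IsPullback (X.extMap (X.substLift s A) ≫ i.hom) (X.pr ((X.subst s).obj A).ob) f s := by
  obtain ⟨A, i, hi⟩ := hf
  exact ⟨A, i.symm, by simp [← hi], (X.isPullback_lift s A).of_iso (Iso.refl _) i.symm (Iso.refl _)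
    (Iso.refl _) (by simp) (by simp) (by simp [← hi]) (by simp)⟩

theorem hasFiniteLimits_of_isDisplay (hd : ∀ {Θ Γ : X.base} (f : Θ ⟶ Γ), X.IsDisplay f) :
    HasFiniteLimits X.base := by
  have := X.hasTerminal
  have : HasPullbacks X.base := by
    have (x y z : X.base) (f : x ⟶ z) (g : y ⟶ z) : HasPullback f g := by
      obtain ⟨A, i, -, h⟩ := (hd f).exists_isPullback g
      exact h.hasPullback
    exact hasPullbacks_of_hasLimit_cospan _
  exact hasFiniteLimits_of_hasTerminal_and_pullbacks

/-- A morphism of comprehension categories preserves pullbacks of projections, because these are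
images of Cartesian morphisms. -/
theorem LaxHom.map_isPullback {Y : CompCat.{v, u}} (S : LaxHom X Y)
    (hS : ∀ ⦃Γ : X.base⦄ (A : X.types.Ob Γ), IsIso (S.comparison A)) {Γ Γ' : X.base} (s : Γ' ⟶ Γ)
    (A : X.types.Fiber Γ) :
    IsPullback (S.functor.map (X.extMap (X.substLift s A)))
      (S.functor.map (X.pr ((X.subst s).obj A).ob)) (S.functor.map (X.pr A.ob))
      (S.functor.map s) := by
  have h := Y.isPullback_of_isCartesian
    (S.cartesian (X.substLift s A) (X.cleaving.liftAt_cartesian s A))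
  have := hS A.ob
  have := hS ((X.subst s).obj A).ob
  refine h.of_iso (asIso (S.comparison ((X.subst s).obj A).ob)).symm
    (asIso (S.comparison A.ob)).symm (Iso.refl _) (Iso.refl _) ?_ ?_ ?_ ?_
  · simp only [Iso.symm_hom, asIso_inv]
    rw [IsIso.comp_inv_eq, Category.assoc, S.comparison_naturality, IsIso.inv_hom_id_assoc]
  · simp [← S.comparison_pr]
  · simp [← S.comparison_pr]
  · simp

theorem LaxHom.preservesFiniteLimits {Y : CompCat.{v, u}} (S : LaxHom X Y)
    (hS : ∀ ⦃Γ : X.base⦄ (A : X.types.Ob Γ), IsIso (S.comparison A))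
    (hd : ∀ {Θ Γ : X.base} (f : Θ ⟶ Γ), X.IsDisplay f) : PreservesFiniteLimits S.functor := by
  have := hasFiniteLimits_of_isDisplay hd
  have := S.preservesTerminal
  have : PreservesLimitsOfShape (Discrete PEmpty.{1}) S.functor :=
    preservesLimitsOfShape_pempty_of_preservesTerminal S.functor
  have key {x y z : X.base} (f : x ⟶ z) (g : y ⟶ z) : PreservesLimit (cospan f g) S.functor := by
    obtain ⟨A, i, w, h⟩ := (hd f).exists_isPullback g
    refine preservesLimit_of_preserves_limit_cone h.isLimit
      ((isLimitMapConePullbackConeEquiv S.functor h.w).symm (IsPullback.isLimit ?_))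
    refine (S.map_isPullback hS g A).of_iso (Iso.refl _) (S.functor.mapIso i) (Iso.refl _)
      (Iso.refl _) ?_ ?_ ?_ ?_
    · simp
    · simp
    · simp [← w, ← Functor.map_comp]
    · simp
  have : PreservesLimitsOfShape WalkingCospan S.functor :=
    ⟨fun {K} => preservesLimit_of_iso_diagram S.functor (diagramIsoCospan K).symm⟩
  exact preservesFiniteLimits_of_preservesTerminal_and_pullbacks S.functor

end Democratic

/-! ### The comprehension category of arrows -/

section Arrows

theorem IsFullyFaithful.hasLimitsOfShape {X : CompCat.{v, u}} (hX : IsFullyFaithful X)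
    [HasFiniteLimits X.base] (hd : ∀ {Θ Γ : X.base} (f : Θ ⟶ Γ), X.IsDisplay f) (J : Type)
    [SmallCategory J] [FinCategory J] :
    (∀ Γ : X.base, HasLimitsOfShape J (X.types.Fiber Γ)) ∧
      ∀ ⦃Γ Γ' : X.base⦄ (f : Γ ⟶ Γ'), PreservesLimitsOfShape J (X.subst f) := by
  refine ⟨fun Γ => ?_, fun Γ Γ' f => ?_⟩
  · have := hX.toOver_isEquivalence hd Γ
    have : HasFiniteLimits (Over Γ) := inferInstance
    exact Adjunction.hasLimitsOfShape_of_equivalence (X.toOver Γ)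
  · obtain ⟨L, ⟨adj⟩⟩ := (hX.subst_isRightAdjoint hd f).exists_leftAdjoint
    exact adj.rightAdjoint_preservesLimits.preservesLimitsOfShape

theorem IsFullyFaithful.isIso_pr {X : CompCat.{v, u}} (hX : IsFullyFaithful X)
    (hd : ∀ {Θ Γ : X.base} (f : Θ ⟶ Γ), X.IsDisplay f) {Γ : X.base} (T : X.types.Fiber Γ)
    (hT : Nonempty (IsTerminal T)) : IsIso (X.pr T.ob) := by
  have := hX.toOver_isEquivalence hd Γ
  obtain ⟨hT⟩ := hT
  have h : IsTerminal ((X.toOver Γ).obj T) := IsTerminal.isTerminalObj (X.toOver Γ) _ hT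
  have e : (Over.mkIdTerminal.uniqueUpToIso h).inv.left = X.pr T.ob :=
    (Category.comp_id _).symm.trans (Over.w (Over.mkIdTerminal.uniqueUpToIso h).inv)
  rw [← e]
  exact inferInstanceAs (IsIso ((Over.forget Γ).map (Over.mkIdTerminal.uniqueUpToIso h).inv))

/-- If all morphisms are display maps, then a morphism with left exact action on contexts preserves
fibrewise finite limits: its action on types corresponds to that of a left exact functor on
slices. -/
theorem preservesLimitsOfShape_fiberMap {X Y : CompCat.{v, u}} (S : X ⟶ Y)
    (hY : IsFullyFaithful Y) (hdY : ∀ {Θ Γ : Y.base} (f : Θ ⟶ Γ), Y.IsDisplay f)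
    (hX : IsFullyFaithful X) (hdX : ∀ {Θ Γ : X.base} (f : Θ ⟶ Γ), X.IsDisplay f)
    (hS : ∀ ⦃Γ : X.base⦄ (A : X.types.Ob Γ), IsIso ((toLax S).comparison A))
    [HasFiniteLimits X.base] [PreservesFiniteLimits (toLax S).functor]
    (J : Type) [SmallCategory J] [FinCategory J] (Γ : X.base) :
    PreservesLimitsOfShape J (fiberMap S Γ) := by
  have := hX.toOver_isEquivalence hdX Γ
  have := hY.toOver_isEquivalence hdY ((toLax S).functor.obj Γ)
  let i : X.toOver Γ ⋙ Over.post (toLax S).functor ≅ fiberMap S Γ ⋙ Y.toOver _ :=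
    NatIso.ofComponents (fun A =>
      have := hS A.ob
      let c : (toLax S).functor.obj (X.ext A.ob) ≅ Y.ext ((toLax S).disp.obj A.ob) :=
        asIso ((toLax S).comparison A.ob)
      Over.isoMk c ((toLax S).comparison_pr A.ob))
      (fun {A B} a => Over.OverMorphism.ext (by
        refine ((toLax S).comparison_naturality a.hom).trans ?_
        exact congrArg (_ ≫ ·)
          (congrArg Y.extTot.map ((toLax S).disp.tot_fiber_map a)).symm))
  have : PreservesLimitsOfShape J (fiberMap S Γ ⋙ Y.toOver _) :=
    preservesLimitsOfShape_of_natIso i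
  exact preservesLimitsOfShape_of_reflects_of_preserves (fiberMap S Γ) (Y.toOver _)

end Arrows

section DFL

variable {k : CatKind}

theorem isFullyFaithful (X : FullCompCat.{v, u} k) : IsFullyFaithful X.obj :=
  fun _ _ f A B => X.prop.full f A B

theorem isDisplay (X : DFLCompCat.{v, u} k) {Θ Γ : X.obj.obj.base} (f : Θ ⟶ Γ) :
    X.obj.obj.IsDisplay f :=
  have h := X.prop
  isDisplay_of_isDemocratic (isFullyFaithful X.obj)
    ⟨fun Γ => h.1.1.1 Γ, fun f => h.1.1.2 f, fun T => h.1.2 T⟩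
    ⟨fun Γ => h.2.2.1.1 Γ, fun f => h.2.2.1.2 f⟩ h.2.2.2.1 h.2.2.2.2 f

theorem dfl_of_isDisplay (X : FullCompCat.{v, u} k) [HasFiniteLimits X.obj.base]
    (hd : ∀ {Θ Γ : X.obj.base} (f : Θ ⟶ Γ), X.obj.IsDisplay f) : (dflData k).P X := by
  have hX := isFullyFaithful X
  refine ⟨⟨hX.hasLimitsOfShape hd _, fun _ T hT => hX.isIso_pr hd T hT⟩,
    hX.hasLimitsOfShape hd _, hX.hasLimitsOfShape hd _, hX.hasStrongSigma hd, fun Γ => ?_⟩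
  have ht : IsTerminal X.obj.emptyCtx := terminalIsTerminal
  obtain ⟨A, i, -⟩ := hd (ht.from Γ)
  exact ⟨A.ob, ⟨i⟩⟩

theorem dfl_map {X Y : FullCompCat.{v, u} k} (S : X ⟶ Y) [HasFiniteLimits X.obj.base]
    [PreservesFiniteLimits (toLax (SubBicat.Hom.hom S)).functor]
    (hdX : ∀ {Θ Γ : X.obj.base} (f : Θ ⟶ Γ), X.obj.IsDisplay f)
    (hdY : ∀ {Θ Γ : Y.obj.base} (f : Θ ⟶ Γ), Y.obj.IsDisplay f) : (dflData k).Q S := by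
  have h (J : Type) [SmallCategory J] [FinCategory J] (Γ : X.obj.base) :=
    preservesLimitsOfShape_fiberMap (SubBicat.Hom.hom S) (isFullyFaithful Y) hdY
      (isFullyFaithful X) hdX (SubBicat.Hom.prop S) J Γ
  exact ⟨h _, h _, h _, trivial, trivial⟩

theorem arrowLands (k : CatKind) : ArrowLands.{v, u} k where
  obj C :=
    have : HasFiniteLimits ((arrowFull k).obj C).obj.base := C.prop.1
    dfl_of_isDisplay ((arrowFull k).obj C) (ofArrows_isDisplay C.obj)
  map {C D} F :=
    have : HasFiniteLimits ((arrowFull k).obj C).obj.base := C.prop.1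
    have : PreservesFiniteLimits (toLax (SubBicat.Hom.hom ((arrowFull k).map F))).functor :=
      SubBicat.Hom.prop F
    dfl_map ((arrowFull k).map F) (ofArrows_isDisplay C.obj) (ofArrows_isDisplay D.obj)

theorem baseLands (k : CatKind) : BaseLands.{v, u} k where
  obj X := ⟨hasFiniteLimits_of_isDisplay (isDisplay X), X.obj.prop.base⟩
  map {X _} S := (lax S).preservesFiniteLimits (SubBicat.Hom.prop (SubBicat.Hom.hom S))
    (isDisplay X)

theorem zetaLands {k : CatKind} (hU : BaseLands.{v, u} k) : ZetaLands.{v, u} hU := fun X =>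
  have : HasFiniteLimits X.obj.obj.base := (hU.obj X).1
  have : PreservesFiniteLimits (toLax (SubBicat.Hom.hom (zetaFull hU X))).functor :=
    inferInstanceAs (PreservesFiniteLimits (𝟭 X.obj.obj.base))
  dfl_map (zetaFull hU X) (isDisplay X) (ofArrows_isDisplay X.obj.obj.base)

end DFL

/-! ### Cells between morphisms of full comprehension categories -/

section LocallyFullyFaithful

variable {W X : CompCat.{v, u}}

theorem IsFullyFaithful.tot_ext (hX : IsFullyFaithful X) {Γ Γ' : X.base} {f g : Γ ⟶ Γ'}
    {A : X.types.Ob Γ} {B : X.types.Ob Γ'} {a : X.types.Hom f A B} {b : X.types.Hom g A B}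
    (e : f = g) (h : X.extMap a = X.extMap b) : X.types.tot a = X.types.tot b := by
  subst e
  rw [hX.hom_ext h]

/-- A 2-cell into a full comprehension category is determined by its action on contexts. -/
theorem IsFullyFaithful.cell_ext (hX : IsFullyFaithful X) {S T : LaxHom W X}
    (hS : ∀ ⦃Γ : W.base⦄ (A : W.types.Ob Γ), IsIso (S.comparison A)) {s t : Cell S T}
    (h : ∀ Γ, s.trans.app Γ = t.trans.app Γ) : s = t := by
  refine Cell.ext' h fun Γ A => hX.tot_ext (h Γ) ?_
  have := hS A
  rw [← cancel_epi (S.comparison A), s.comm, t.comm, h]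

theorem LaxHom.exists_hom_over (hX : IsFullyFaithful X) (S T : LaxHom W X)
    (hS : ∀ ⦃Γ : W.base⦄ (A : W.types.Ob Γ), IsIso (S.comparison A)) (τ : S.functor ⟶ T.functor)
    {Γ : W.base} (A : W.types.Ob Γ) :
    ∃ a : X.types.Hom (τ.app Γ) (S.disp.obj A) (T.disp.obj A),
      S.comparison A ≫ X.extMap a = τ.app (W.ext A) ≫ T.comparison A := by
  have := hS A
  obtain ⟨a, ha⟩ := hX.exists_hom (f := τ.app Γ) (A := S.disp.obj A) (B := T.disp.obj A)
    (inv (S.comparison A) ≫ τ.app (W.ext A) ≫ T.comparison A) (by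
      rw [Category.assoc, Category.assoc, T.comparison_pr, IsIso.inv_comp_eq, ← τ.naturality,
        ← S.comparison_pr, Category.assoc])
  exact ⟨a, by rw [ha, IsIso.hom_inv_id_assoc]⟩

/-- The 2-cell into a full comprehension category given by its action on contexts. -/
noncomputable def cellOfTrans (hX : IsFullyFaithful X) (S T : LaxHom W X)
    (hS : ∀ ⦃Γ : W.base⦄ (A : W.types.Ob Γ), IsIso (S.comparison A))
    (τ : S.functor ⟶ T.functor) : Cell S T where
  trans := τ
  disp :=
    { app := fun A => (LaxHom.exists_hom_over hX S T hS τ A).choose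
      naturality := fun {Γ Γ' f A B} a => by
        refine DispCat.heq_of_tot (hX.tot_ext (τ.naturality f) ?_)
        have h₁ := (LaxHom.exists_hom_over hX S T hS τ A).choose_spec
        have h₂ := (LaxHom.exists_hom_over hX S T hS τ B).choose_spec
        have := hS A
        rw [← cancel_epi (S.comparison A), extMap_comp, extMap_comp, ← Category.assoc,
          ← S.comparison_naturality, Category.assoc, h₂, reassoc_of% h₁, τ.naturality_assoc,
          T.comparison_naturality] }
  comm A := (LaxHom.exists_hom_over hX S T hS τ A).choose_spec

/-- The invertible 2-cell into a full comprehension category given by its action on contexts. -/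
noncomputable def isoOfTrans (hX : IsFullyFaithful X) (S T : LaxHom W X)
    (hS : ∀ ⦃Γ : W.base⦄ (A : W.types.Ob Γ), IsIso (S.comparison A))
    (hT : ∀ ⦃Γ : W.base⦄ (A : W.types.Ob Γ), IsIso (T.comparison A))
    (i : S.functor ≅ T.functor) : S ≅ T where
  hom := cellOfTrans hX S T hS i.hom
  inv := cellOfTrans hX T S hT i.inv
  hom_inv_id := hX.cell_ext hS fun Γ => i.hom_inv_id_app Γ
  inv_hom_id := hX.cell_ext hT fun Γ => i.inv_hom_id_app Γ

variable {k : CatKind} {Y Z : DFLCompCat.{v, u} k}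

theorem isIso_comparison (S : Y ⟶ Z) ⦃Γ : Y.obj.obj.base⦄ (A : Y.obj.obj.types.Ob Γ) :
    IsIso ((lax S).comparison A) :=
  SubBicat.Hom.prop (SubBicat.Hom.hom S) A

/-- The base pseudofunctor is locally faithful on DFL comprehension categories. -/
theorem dfl_hom₂_ext {S T : Y ⟶ Z} {s t : S ⟶ T}
    (h : ∀ Γ : Y.obj.obj.base, (cell s).trans.app Γ = (cell t).trans.app Γ) : s = t :=
  SubBicat.Hom₂.ext (SubBicat.Hom₂.ext
    ((isFullyFaithful Z.obj).cell_ext (isIso_comparison S) (s := cell s) (t := cell t) h))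

/-- The base pseudofunctor is locally full on invertible 2-cells of DFL comprehension
categories. -/
noncomputable def dflIso {S T : Y ⟶ Z} (i : (lax S).functor ≅ (lax T).functor) : S ≅ T :=
  SubBicat.isoMk (SubBicat.isoMk (isoOfTrans (isFullyFaithful Z.obj) (lax S) (lax T)
    (isIso_comparison S) (isIso_comparison T) i))

end LocallyFullyFaithful

/-! ### The inverse of the unit -/

section ZetaInv

/-- The quasi-inverse of the comprehension functor, as a morphism of comprehension categories over
the identity: it sends a morphism to a type whose projection is isomorphic to it. -/
noncomputable def zetaInvHom (X : CompCat.{v, u}) [HasFiniteLimits X.base]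
    (hX : IsFullyFaithful X) (hd : ∀ {Θ Γ : X.base} (f : Θ ⟶ Γ), X.IsDisplay f) :
    LaxHom (ofArrows X.base) X :=
  let A {Γ : X.base} (a : ArrOb Γ) : X.types.Fiber Γ := (hd a.hom).choose
  let i {Γ : X.base} (a : ArrOb Γ) : a.dom ≅ X.ext (A a).ob := (hd a.hom).choose_spec.choose
  have hi {Γ : X.base} (a : ArrOb Γ) : (i a).hom ≫ X.pr (A a).ob = a.hom :=
    (hd a.hom).choose_spec.choose_spec
  have key {Γ Γ' : X.base} {f : Γ ⟶ Γ'} {a : ArrOb Γ} {b : ArrOb Γ'} (t : ArrHom f a b) :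
      ∃ m : X.types.Hom f (A a).ob (A b).ob, X.extMap m = (i a).inv ≫ t.top ≫ (i b).hom :=
    hX.exists_hom _ (by
      rw [Category.assoc, Category.assoc, hi, t.comm, ← hi, Category.assoc,
        Iso.inv_hom_id_assoc])
  let D : DispFunctor (𝟭 X.base) (arrDisp X.base) X.types :=
    { obj := fun a => (A a).ob
      map := fun t => (key t).choose
      map_id := fun a => heq_of_eq (hX.hom_ext (by
        refine (key _).choose_spec.trans ?_
        rw [extMap_id]
        exact ((i a).inv ≫= Category.id_comp _).trans (i a).inv_hom_id))
      map_comp := fun s t => heq_of_eq (hX.hom_ext (by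
        refine (key _).choose_spec.trans ?_
        rw [extMap_comp]
        refine Eq.trans ?_ (congrArg₂ (· ≫ ·) (key s).choose_spec (key t).choose_spec).symm
        simp only [Category.assoc, Iso.hom_inv_id_assoc]
        exact (i _).inv ≫= Category.assoc _ _ _)) }
  { functor := 𝟭 X.base
    preservesTerminal := inferInstanceAs (PreservesLimit (Functor.empty.{0} X.base) (𝟭 X.base))
    disp := D
    cartesian := fun {Γ Γ' f a b} t ht => by
      refine hX.isCartesian_iff.2 ?_
      refine ((arr_isCartesian_iff t).1 ht).of_iso (i a) (i b) (Iso.refl _) (Iso.refl _)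
        ?_ ?_ ?_ ?_
      · refine Eq.trans ?_ ((i a).hom ≫= (key t).choose_spec).symm
        rw [Iso.hom_inv_id_assoc]
      · exact (Category.comp_id _).trans (hi a).symm
      · exact (Category.comp_id _).trans (hi b).symm
      · exact (Category.comp_id _).trans (Category.id_comp _).symm
    comparison := fun {Γ} a => (i a).hom
    comparison_pr := fun {Γ} a => hi a
    comparison_naturality := fun {Γ Γ' f a b} t => by
      refine Eq.trans ?_ ((i a).hom ≫= (key t).choose_spec).symm
      rw [Iso.hom_inv_id_assoc]
      rfl }

variable {k : CatKind}

/-- The component at `X` of the inverse of `zeta`. -/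
noncomputable def zetaInvApp (hH : ArrowLands.{v, u} k) (hU : BaseLands.{v, u} k)
    (X : DFLCompCat.{v, u} k) : (arrowH hH).obj ((baseU hU).obj X) ⟶ X :=
  have : HasFiniteLimits X.obj.obj.base := (hU.obj X).1
  let S : ((arrowH hH).obj ((baseU hU).obj X)).obj ⟶ X.obj :=
    SubBicat.Hom.mk (zetaInvHom X.obj.obj (isFullyFaithful X.obj) (isDisplay X)) fun _ a =>
      Iso.isIso_hom _
  SubBicat.Hom.mk S <| by
    have : HasFiniteLimits ((arrowH hH).obj ((baseU hU).obj X)).obj.obj.base := (hU.obj X).1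
    have : PreservesFiniteLimits (toLax (SubBicat.Hom.hom S)).functor :=
      inferInstanceAs (PreservesFiniteLimits (𝟭 X.obj.obj.base))
    exact dfl_map S (ofArrows_isDisplay X.obj.obj.base) (isDisplay X)

variable (hH : ArrowLands.{v, u} k) (hU : BaseLands.{v, u} k)

theorem id_comp_id {C : Type*} [Category* C] {a : C} {p q : a ⟶ a} (hp : p = 𝟙 a) (hq : q = 𝟙 a) :
    p ≫ q = 𝟙 a := by
  simp [hp, hq]

/-- The inverse of `zeta`. Its naturality cells are identities on contexts. -/
noncomputable def zetaInv :
    (baseU hU).comp (arrowH hH) ⟶ Pseudofunctor.id (DFLCompCat.{v, u} k) where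
  app X := zetaInvApp hH hU X
  naturality {X Y} S := dflIso (Iso.refl (lax S).functor)
  naturality_naturality {X Y S T} τ := dfl_hom₂_ext fun Γ => zeta_aux₁ ((cell τ).trans.app Γ)
  naturality_id X := dfl_hom₂_ext fun Γ => by
    refine Eq.trans (b := 𝟙 Γ) ?_ (Eq.symm ?_) <;>
      repeat' first | rfl | refine id_comp_id ?_ ?_
  naturality_comp {X Y Z} S T := dfl_hom₂_ext fun Γ => by
    refine Eq.trans (b := 𝟙 ((lax T).functor.obj ((lax S).functor.obj Γ))) ?_ (Eq.symm ?_) <;>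
      repeat' first | rfl | exact (lax T).functor.map_id _ | refine id_comp_id ?_ ?_

variable (hZ : ZetaLands.{v, u} hU)

/-- The unit of the biequivalence, as an adjoint equivalence. The cells of the invertible
modifications are identities on contexts, so their coherence equations reduce to compositions of
identities. -/
noncomputable def zetaEquivalence :
    Pseudofunctor.id (DFLCompCat.{v, u} k) ≌ (baseU hU).comp (arrowH hH) where
  hom := zeta hH hU hZ
  inv := zetaInv hH hU
  unit := Pseudofunctor.StrongTrans.isoMk (fun X => dflIso (Iso.refl (𝟭 X.obj.obj.base)))
    fun {X Y} S => dfl_hom₂_ext fun Γ => by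
      refine Eq.trans (b := 𝟙 ((lax S).functor.obj Γ)) ?_ (Eq.symm ?_) <;>
        repeat' first | rfl | exact (lax S).functor.map_id _ | refine id_comp_id ?_ ?_
  counit := Pseudofunctor.StrongTrans.isoMk (fun X => dflIso (Iso.refl (𝟭 X.obj.obj.base)))
    fun {X Y} S => dfl_hom₂_ext fun Γ => by
      refine Eq.trans (b := 𝟙 ((lax S).functor.obj Γ)) ?_ (Eq.symm ?_) <;>
        repeat' first | rfl | exact (lax S).functor.map_id _ | refine id_comp_id ?_ ?_
  left_triangle := by
    refine Iso.ext (Pseudofunctor.StrongTrans.homCategory.ext fun X => ?_)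
    refine dfl_hom₂_ext fun Γ => ?_
    refine Eq.trans (b := 𝟙 Γ) ?_ (Eq.symm ?_) <;>
      repeat' first | rfl | refine id_comp_id ?_ ?_

end ZetaInv

/-! ### The counit -/

section XiInv

variable {k : CatKind}

theorem finLim_hom₂_ext {C D : FinLim.{v, u} k} {F G : C ⟶ D} {s t : F ⟶ G}
    (h : ∀ x, (nt s).app x = (nt t).app x) : s = t :=
  SubBicat.Hom₂.ext (cat_hom₂_ext h)

/-- The invertible 2-cell of `FinLim` given by a natural isomorphism. -/
def finLimIso {C D : FinLim.{v, u} k} {F G : C ⟶ D} (i : fn F ≅ fn G) : F ≅ G :=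
  SubBicat.isoMk
    { hom := Cat.Hom₂.ofNatTrans i.hom
      inv := Cat.Hom₂.ofNatTrans i.inv
      hom_inv_id := cat_hom₂_ext fun x => i.hom_inv_id_app x
      inv_hom_id := cat_hom₂_ext fun x => i.inv_hom_id_app x }

variable (hH : ArrowLands.{v, u} k) (hU : BaseLands.{v, u} k)

/-- The inverse of `xi`, all of whose components are identities. -/
noncomputable def xiInv : Pseudofunctor.id (FinLim.{v, u} k) ⟶ (arrowH hH).comp (baseU hU) where
  app C := SubBicat.Hom.mk (𝟙 C.obj) ((finLimData k).id C.prop)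
  naturality {C D} F := finLimIso (Iso.refl (fn F))
  naturality_naturality {C D F G} τ := finLim_hom₂_ext fun x => zeta_aux₁ ((nt τ).app x)
  naturality_id C := finLim_hom₂_ext fun (x : C.obj) => by
    refine Eq.trans (b := 𝟙 x) ?_ (Eq.symm ?_) <;>
      repeat' first | rfl | refine id_comp_id ?_ ?_
  naturality_comp {C D E} F G := finLim_hom₂_ext fun x => by
    refine Eq.trans (b := 𝟙 ((fn G).obj ((fn F).obj x))) ?_ (Eq.symm ?_) <;>
      repeat' first | rfl | exact (fn G).map_id _ | refine id_comp_id ?_ ?_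

/-- The counit of the biequivalence, as an adjoint equivalence. As for the unit, all components of
the cells involved are identities. -/
noncomputable def xiEquivalence :
    (arrowH hH).comp (baseU hU) ≌ Pseudofunctor.id (FinLim.{v, u} k) where
  hom := xi hH hU
  inv := xiInv hH hU
  unit := Pseudofunctor.StrongTrans.isoMk (fun C => finLimIso (Iso.refl (𝟭 C.obj)))
    fun {C D} F => finLim_hom₂_ext fun x => by
      refine Eq.trans (b := 𝟙 ((fn F).obj x)) ?_ (Eq.symm ?_) <;>
        repeat' first | rfl | exact (fn F).map_id _ | refine id_comp_id ?_ ?_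
  counit := Pseudofunctor.StrongTrans.isoMk (fun C => finLimIso (Iso.refl (𝟭 C.obj)))
    fun {C D} F => finLim_hom₂_ext fun x => by
      refine Eq.trans (b := 𝟙 ((fn F).obj x)) ?_ (Eq.symm ?_) <;>
        repeat' first | rfl | exact (fn F).map_id _ | refine id_comp_id ?_ ?_
  left_triangle := by
    refine Iso.ext (Pseudofunctor.StrongTrans.homCategory.ext fun C => ?_)
    refine finLim_hom₂_ext fun (x : C.obj) => ?_
    refine Eq.trans (b := 𝟙 x) ?_ (Eq.symm ?_) <;>
      repeat' first | rfl | refine id_comp_id ?_ ?_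

end XiInv

end CompCat

/-! ### Dependent products in a category -/

section PiObj

/-- For morphisms `f : x ⟶ y` and `c' : c ⟶ x`, the morphism `r' : r ⟶ y` is a dependent product of
`c'` along `f`: the pullback `p` of `r'` along `f` comes with a morphism `e : p ⟶ c` over `x` that
is universal among such morphisms. The pullbacks are not chosen. -/
structure IsPiObj {C : Type u} [Category.{v} C] {x y r c p : C} (f : x ⟶ y) (r' : r ⟶ y)
    (c' : c ⟶ x) (fst : p ⟶ r) (snd : p ⟶ x) (e : p ⟶ c) : Prop where
  isPullback : IsPullback fst snd r' f
  w : e ≫ c' = snd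
  existsUnique : ∀ ⦃z q : C⦄ (z' : z ⟶ y) (a : q ⟶ z) (b : q ⟶ x), IsPullback a b z' f →
    ∀ g : q ⟶ c, g ≫ c' = b →
      ∃! h : z ⟶ r, h ≫ r' = z' ∧ ∀ k : q ⟶ p, k ≫ fst = a ≫ h → k ≫ snd = b → k ≫ e = g

/-- Every morphism with codomain `x` has a dependent product along `f : x ⟶ y`. -/
def HasPiObj {C : Type u} [Category.{v} C] {x y : C} (f : x ⟶ y) : Prop :=
  ∀ ⦃c : C⦄ (c' : c ⟶ x), ∃ (r p : C) (r' : r ⟶ y) (fst : p ⟶ r) (snd : p ⟶ x) (e : p ⟶ c),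
    IsPiObj f r' c' fst snd e

/-- The functor preserves dependent products along `f`. -/
def PreservesPiObj {C D : Type u} [Category.{v} C] [Category.{v} D] (F : C ⥤ D) {x y : C}
    (f : x ⟶ y) : Prop :=
  ∀ ⦃r c p : C⦄ ⦃r' : r ⟶ y⦄ ⦃c' : c ⟶ x⦄ ⦃fst : p ⟶ r⦄ ⦃snd : p ⟶ x⦄ ⦃e : p ⟶ c⦄,
    IsPiObj f r' c' fst snd e →
      IsPiObj (F.map f) (F.map r') (F.map c') (F.map fst) (F.map snd) (F.map e)

theorem preservesPiObj_id {C : Type u} [Category.{v} C] {x y : C} (f : x ⟶ y) :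
    PreservesPiObj (𝟭 C) f :=
  fun _ _ _ _ _ _ _ _ h => h

namespace IsPiObj

variable {C : Type u} [Category.{v} C]

theorem of_iso {x x₁ y r r₁ c c₁ p p₁ : C} {f : x ⟶ y} {f₁ : x₁ ⟶ y} {r' : r ⟶ y} {r₁' : r₁ ⟶ y}
    {c' : c ⟶ x} {c₁' : c₁ ⟶ x₁} {fst : p ⟶ r} {fst₁ : p₁ ⟶ r₁} {snd : p ⟶ x} {snd₁ : p₁ ⟶ x₁}
    {e : p ⟶ c} {e₁ : p₁ ⟶ c₁} (H : IsPiObj f r' c' fst snd e) (ix : x ≅ x₁) (ir : r ≅ r₁)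
    (ic : c ≅ c₁) (ip : p ≅ p₁) (hf : ix.hom ≫ f₁ = f) (hr : ir.hom ≫ r₁' = r')
    (hc : ic.hom ≫ c₁' = c' ≫ ix.hom) (hfst : ip.hom ≫ fst₁ = fst ≫ ir.hom)
    (hsnd : ip.hom ≫ snd₁ = snd ≫ ix.hom) (he : ip.hom ≫ e₁ = e ≫ ic.hom) :
    IsPiObj f₁ r₁' c₁' fst₁ snd₁ e₁ where
  isPullback := H.isPullback.of_iso ip ir ix (Iso.refl _) hfst.symm hsnd.symm (by simp [hr])
    (by simp [hf])
  w := by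
    rw [← cancel_epi ip.hom, reassoc_of% he, hc, hsnd, reassoc_of% H.w]
  existsUnique z q z' a b hq g hg := by
    have hc' : ic.inv ≫ c' = c₁' ≫ ix.inv := by
      rw [Iso.inv_comp_eq, reassoc_of% hc, Iso.hom_inv_id, Category.comp_id]
    have hq' : IsPullback a (b ≫ ix.inv) z' f :=
      hq.of_iso (Iso.refl _) (Iso.refl _) ix.symm (Iso.refl _) (by simp) (by simp) (by simp)
        (by simp [← hf])
    obtain ⟨h, ⟨h₁, h₂⟩, h₃⟩ := H.existsUnique z' a (b ≫ ix.inv) hq' (g ≫ ic.inv) (by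
      rw [Category.assoc, hc', reassoc_of% hg])
    have hfst' : ip.inv ≫ fst = fst₁ ≫ ir.inv := by
      rw [Iso.inv_comp_eq, reassoc_of% hfst, Iso.hom_inv_id, Category.comp_id]
    have hsnd' : ip.inv ≫ snd = snd₁ ≫ ix.inv := by
      rw [Iso.inv_comp_eq, reassoc_of% hsnd, Iso.hom_inv_id, Category.comp_id]
    have he' : ip.inv ≫ e = e₁ ≫ ic.inv := by
      rw [Iso.inv_comp_eq, reassoc_of% he, Iso.hom_inv_id, Category.comp_id]
    refine ⟨h ≫ ir.hom, ⟨by rw [Category.assoc, hr, h₁], fun k hk₁ hk₂ => ?_⟩,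
      fun h' ⟨h₁', h₂'⟩ => ?_⟩
    · have := h₂ (k ≫ ip.inv) (by rw [Category.assoc, hfst', reassoc_of% hk₁]; simp)
        (by rw [Category.assoc, hsnd', reassoc_of% hk₂])
      rw [Category.assoc, he', ← Category.assoc, cancel_mono] at this
      exact this
    · rw [← Iso.comp_inv_eq]
      refine h₃ _ ⟨by rw [Category.assoc, Iso.inv_comp_eq _ |>.2 hr.symm, h₁'], fun k hk₁ hk₂ => ?_⟩
      have := h₂' (k ≫ ip.hom) (by rw [Category.assoc, hfst, reassoc_of% hk₁]; simp)
        (by rw [Category.assoc, hsnd, reassoc_of% hk₂]; simp)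
      rw [← this, Category.assoc, Category.assoc, ← he', ip.hom_inv_id_assoc]

/-- Dependent products are stable under pullback. -/
theorem baseChange {x₁ x₂ y₁ y₂ r c p r₁ c₁ p₁ : C} {f₁ : x₁ ⟶ y₁} {f₂ : x₂ ⟶ y₂} {s : y₁ ⟶ y₂}
    {t : x₁ ⟶ x₂} (hs : IsPullback t f₁ f₂ s) {r' : r ⟶ y₂} {c' : c ⟶ x₂} {fst : p ⟶ r}
    {snd : p ⟶ x₂} {e : p ⟶ c} (H : IsPiObj f₂ r' c' fst snd e) {r₁' : r₁ ⟶ y₁} {ρ : r₁ ⟶ r}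
    (hr : IsPullback ρ r₁' r' s) {c₁' : c₁ ⟶ x₁} {γ : c₁ ⟶ c} (hc : IsPullback γ c₁' c' t)
    {fst₁ : p₁ ⟶ r₁} {snd₁ : p₁ ⟶ x₁} (hp : IsPullback fst₁ snd₁ r₁' f₁) {e₁ : p₁ ⟶ c₁}
    (he : e₁ ≫ c₁' = snd₁) (m : p₁ ⟶ p) (hm₁ : m ≫ fst = fst₁ ≫ ρ) (hm₂ : m ≫ snd = snd₁ ≫ t)
    (hm : m ≫ e = e₁ ≫ γ) : IsPiObj f₁ r₁' c₁' fst₁ snd₁ e₁ where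
  isPullback := hp
  w := he
  existsUnique z q z' a b hq g hg := by
    obtain ⟨h₀, ⟨h₁, h₂⟩, h₃⟩ := H.existsUnique (z' ≫ s) a (b ≫ t) (hq.paste_vert hs.flip) (g ≫ γ)
      (by rw [Category.assoc, hc.w, reassoc_of% hg])
    refine ⟨hr.lift h₀ z' h₁, ⟨hr.lift_snd _ _ _, fun k hk₁ hk₂ => hc.hom_ext ?_ ?_⟩,
      fun h' ⟨h₁', h₂'⟩ => hr.hom_ext ?_ ?_⟩
    · rw [Category.assoc, ← hm, ← Category.assoc]
      refine h₂ _ ?_ ?_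
      · rw [Category.assoc, hm₁, reassoc_of% hk₁, hr.lift_fst]
      · rw [Category.assoc, hm₂, reassoc_of% hk₂]
    · rw [Category.assoc, he, hk₂, hg]
    · rw [hr.lift_fst]
      refine h₃ _ ⟨by rw [Category.assoc, hr.w, reassoc_of% h₁'], fun k hk₁ hk₂ => ?_⟩
      have e₁ : (a ≫ h') ≫ r₁' = b ≫ f₁ := by rw [Category.assoc, h₁', hq.w]
      have e₂ : k = hp.lift (a ≫ h') b e₁ ≫ m := by
        refine H.isPullback.hom_ext ?_ ?_
        · rw [hk₁, Category.assoc, hm₁, hp.lift_fst_assoc, Category.assoc]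
        · rw [hk₂, Category.assoc, hm₂, hp.lift_snd_assoc]
      rw [e₂, Category.assoc, hm, ← Category.assoc,
        h₂' _ (hp.lift_fst _ _ _) (hp.lift_snd _ _ _)]
    · rw [hr.lift_snd, h₁']

end IsPiObj

universe v₁ v₂ v₃ v₄ u₁ u₂ u₃ u₄

/-- A presentation of the functor `G` as pulling back along `f`: the source and the target of `G`
are equivalent to slices, and `G` sends each object to a pullback along `f`. -/
structure PullbackModel {C : Type u} [Category.{v} C] {x y : C} (f : x ⟶ y) {A : Type u₁}
    {B : Type u₂} [Category.{v₁} A] [Category.{v₂} B] (G : A ⥤ B) where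
  source : A ⥤ Over y
  target : B ⥤ Over x
  source_equiv : source.IsEquivalence
  target_equiv : target.IsEquivalence
  lift (a : A) : (target.obj (G.obj a)).left ⟶ (source.obj a).left
  isPullback (a : A) : IsPullback (lift a) (target.obj (G.obj a)).hom (source.obj a).hom f
  naturality {a b : A} (h : a ⟶ b) :
    (target.map (G.map h)).left ≫ lift b = lift a ≫ (source.map h).left

namespace PullbackModel

variable {C : Type u} [Category.{v} C] {x y : C} {f : x ⟶ y} {C₁ : Type u₁}
  {C₃ : Type u₃} [Category.{v₁} C₁] [Category.{v₃} C₃] {G : C₁ ⥤ C₃}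

/-- The universal property for objects in the image of `M.source` and the chosen pullbacks extends
to all objects over `y` and all pullbacks, by transport along isomorphisms. -/
theorem isCouniversal_iff (M : PullbackModel f G) {r : C₁} {c : C₃} (e : G.obj r ⟶ c) :
    IsCouniversal G e ↔ IsPiObj f (M.source.obj r).hom (M.target.obj c).hom (M.lift r)
      (M.target.obj (G.obj r)).hom (M.target.map e).left := by
  have := M.source_equiv
  have := M.target_equiv
  constructor
  · intro H
    refine ⟨M.isPullback r, Over.w _, fun z q z' a b hq g hg => ?_⟩
    let s := M.source.objPreimage (Over.mk z')
    let i : M.source.obj s ≅ Over.mk z' := M.source.objObjPreimageIso (Over.mk z')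
    have hi : i.hom.left ≫ z' = (M.source.obj s).hom := Over.w i.hom
    have hi' : i.inv.left ≫ (M.source.obj s).hom = z' := Over.w i.inv
    have hii : i.hom.left ≫ i.inv.left = 𝟙 _ := congrArg CommaMorphism.left i.hom_inv_id
    have hii' : i.inv.left ≫ i.hom.left = 𝟙 z := congrArg CommaMorphism.left i.inv_hom_id
    have hs := M.isPullback s
    -- the two pullbacks of `z'` along `f`
    let j : (M.target.obj (G.obj s)).left ⟶ q :=
      hq.lift (M.lift s ≫ i.hom.left) (M.target.obj (G.obj s)).hom
        (by rw [Category.assoc, hi, hs.w])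
    have hj₁ : j ≫ a = M.lift s ≫ i.hom.left := hq.lift_fst _ _ _
    have hj₂ : j ≫ b = (M.target.obj (G.obj s)).hom := hq.lift_snd _ _ _
    let l : q ⟶ (M.target.obj (G.obj s)).left :=
      hs.lift (a ≫ i.inv.left) b (by rw [Category.assoc, hi', hq.w])
    have hl₁ : l ≫ M.lift s = a ≫ i.inv.left := hs.lift_fst _ _ _
    have hl₂ : l ≫ (M.target.obj (G.obj s)).hom = b := hs.lift_snd _ _ _
    have hlj : l ≫ j = 𝟙 q := hq.hom_ext
      (by rw [Category.assoc, hj₁, reassoc_of% hl₁, hii', Category.comp_id, Category.id_comp])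
      (by rw [Category.assoc, hj₂, hl₂, Category.id_comp])
    obtain ⟨g₁, hg₁⟩ := M.target.map_surjective
      (Over.homMk (j ≫ g) (by rw [Category.assoc, hg, hj₂]) :
        M.target.obj (G.obj s) ⟶ M.target.obj c)
    have hg₁' : (M.target.map g₁).left = j ≫ g := congrArg CommaMorphism.left hg₁
    obtain ⟨h, hh, hu⟩ := H g₁
    have hh' : (M.target.map (G.map h)).left ≫ (M.target.map e).left = j ≫ g := by
      rw [← hg₁', ← hh, Functor.map_comp, Over.comp_left]
    refine ⟨i.inv.left ≫ (M.source.map h).left, ⟨?_, fun k hk₁ hk₂ => ?_⟩,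
      fun h' ⟨h₁, h₂⟩ => ?_⟩
    · rw [Category.assoc, Over.w, hi']
    · have : k = l ≫ (M.target.map (G.map h)).left := by
        refine (M.isPullback r).hom_ext ?_ ?_
        · rw [hk₁, Category.assoc, M.naturality, reassoc_of% hl₁]
        · rw [hk₂, Category.assoc, Over.w, hl₂]
      rw [this, Category.assoc, hh', reassoc_of% hlj]
    · obtain ⟨h'', hh''⟩ := M.source.map_surjective
        (Over.homMk (i.hom.left ≫ h') (by rw [Category.assoc, h₁, hi]) :
          M.source.obj s ⟶ M.source.obj r)
      have e₁ : (M.source.map h'').left = i.hom.left ≫ h' := congrArg CommaMorphism.left hh''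
      have hii'' : i.inv.left ≫ i.hom.left ≫ h' = h' :=
        (Category.assoc _ _ _).symm.trans ((congrArg (· ≫ h') hii').trans (Category.id_comp h'))
      have e₂ : h'' = h := by
        refine hu _ (M.target.map_injective (Over.OverMorphism.ext ?_))
        rw [Functor.map_comp, Over.comp_left, hg₁']
        have := h₂ (l ≫ (M.target.map (G.map h'')).left)
          (by rw [Category.assoc, M.naturality, reassoc_of% hl₁, e₁, hii''])
          (by rw [Category.assoc, Over.w, hl₂])
        have hjl : j ≫ l = 𝟙 _ := hs.hom_ext
          (by rw [Category.assoc, hl₁, reassoc_of% hj₁, hii, Category.comp_id, Category.id_comp])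
          (by rw [Category.assoc, hl₂, hj₂, Category.id_comp])
        rw [← this, Category.assoc, reassoc_of% hjl]
      rw [← e₂, e₁, hii'']
  · intro H z g
    obtain ⟨h, ⟨h₁, h₂⟩, h₃⟩ := H.existsUnique (M.source.obj z).hom (M.lift z)
      (M.target.obj (G.obj z)).hom (M.isPullback z) (M.target.map g).left (Over.w _)
    obtain ⟨k, hk⟩ := M.source.map_surjective
      (Over.homMk h h₁ : M.source.obj z ⟶ M.source.obj r)
    have hk' : (M.source.map k).left = h := congrArg CommaMorphism.left hk
    refine ⟨k, M.target.map_injective (Over.OverMorphism.ext ?_), fun k' hk₁ => ?_⟩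
    · rw [Functor.map_comp, Over.comp_left]
      exact h₂ _ (by rw [M.naturality, hk']) (Over.w _)
    · refine M.source.map_injective (Over.OverMorphism.ext ?_)
      rw [hk']
      refine h₃ _ ⟨Over.w _, fun m hm₁ hm₂ => ?_⟩
      have : m = (M.target.map (G.map k')).left := by
        refine (M.isPullback r).hom_ext ?_ ?_
        · rw [hm₁, M.naturality]
        · rw [hm₂, Over.w]
      rw [this, ← hk₁, Functor.map_comp, Over.comp_left]

/-- Every dependent product along `f` is isomorphic to one given by a universal arrow from `G`. -/
theorem exists_of_isPiObj (M : PullbackModel f G) {r p d : C} {r' : r ⟶ y} {d' : d ⟶ x}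
    {fst : p ⟶ r} {snd : p ⟶ x} {e : p ⟶ d} (H : IsPiObj f r' d' fst snd e) {c : C₃}
    (i : M.target.obj c ≅ Over.mk d') :
    ∃ (a : C₁) (j : M.source.obj a ≅ Over.mk r') (ip : (M.target.obj (G.obj a)).left ≅ p)
      (e' : G.obj a ⟶ c), IsCouniversal G e' ∧ ip.hom ≫ fst = M.lift a ≫ j.hom.left ∧
        ip.hom ≫ snd = (M.target.obj (G.obj a)).hom ∧
        ip.hom ≫ e = (M.target.map e').left ≫ i.hom.left := by
  have := M.source_equiv
  have := M.target_equiv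
  let a := M.source.objPreimage (Over.mk r')
  let j : M.source.obj a ≅ Over.mk r' := M.source.objObjPreimageIso (Over.mk r')
  have hj : j.hom.left ≫ r' = (M.source.obj a).hom := Over.w j.hom
  have hi : i.hom.left ≫ d' = (M.target.obj c).hom := Over.w i.hom
  have hi' : i.inv.left ≫ (M.target.obj c).hom = d' := Over.w i.inv
  have hii' : i.inv.left ≫ i.hom.left = 𝟙 d := congrArg CommaMorphism.left i.inv_hom_id
  let jl : (M.source.obj a).left ≅ r := (Over.forget y).mapIso j
  have ha : IsPullback (M.lift a ≫ j.hom.left) (M.target.obj (G.obj a)).hom r' f :=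
    (M.isPullback a).of_iso (Iso.refl _) jl (Iso.refl _) (Iso.refl _) (by simp [jl]) (by simp)
      (by simp [jl, hj]) (by simp)
  let ip := IsPullback.isoIsPullback _ _ ha H.isPullback
  have h₁ : ip.hom ≫ fst = M.lift a ≫ j.hom.left := IsPullback.isoIsPullback_hom_fst ..
  have h₂ : ip.hom ≫ snd = (M.target.obj (G.obj a)).hom := IsPullback.isoIsPullback_hom_snd ..
  obtain ⟨e', he'⟩ := M.target.map_surjective
    (Over.homMk (ip.hom ≫ e ≫ i.inv.left) (by
      rw [Category.assoc, Category.assoc, hi', H.w, h₂]) : M.target.obj (G.obj a) ⟶ M.target.obj c)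
  have he₁ : (M.target.map e').left = ip.hom ≫ e ≫ i.inv.left := congrArg CommaMorphism.left he'
  have he₂ : ip.hom ≫ e = (M.target.map e').left ≫ i.hom.left := by
    rw [he₁, Category.assoc, Category.assoc, hii', Category.comp_id]
  refine ⟨a, j, ip, e', (M.isCouniversal_iff e').2 ?_, h₁, h₂, he₂⟩
  refine H.of_iso (Iso.refl _) jl.symm ((Over.forget x).mapIso i.symm) ip.symm
    (Category.id_comp _) ?_ ?_ ?_ ?_ ?_
  · rw [Iso.symm_hom, Iso.inv_comp_eq]
    exact hj.symm
  · exact hi'.trans (Category.comp_id _).symm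
  · rw [Iso.symm_hom, Iso.inv_comp_eq, reassoc_of% h₁]
    exact (Category.comp_id _).symm.trans ((M.lift a) ≫= jl.hom_inv_id).symm |>.trans rfl
  · rw [Iso.symm_hom, Iso.inv_comp_eq, Iso.refl_hom, Category.comp_id, h₂]
  · rw [Iso.symm_hom, Iso.inv_comp_eq, he₁]
    rfl

theorem isLeftAdjoint_iff (M : PullbackModel f G) : G.IsLeftAdjoint ↔ HasPiObj f := by
  have := M.target_equiv
  constructor
  · intro h d d'
    obtain ⟨R, ⟨adj⟩⟩ := h.exists_rightAdjoint
    let c := M.target.objPreimage (Over.mk d')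
    let i : M.target.obj c ≅ Over.mk d' := M.target.objObjPreimageIso (Over.mk d')
    have hi : i.hom.left ≫ d' = (M.target.obj c).hom := Over.w i.hom
    have H := (M.isCouniversal_iff _).1 (isCouniversal_counit adj c)
    refine ⟨_, _, _, M.lift (R.obj c), (M.target.obj (G.obj (R.obj c))).hom,
      (M.target.map (adj.counit.app c)).left ≫ i.hom.left,
      H.of_iso (Iso.refl _) (Iso.refl _) ((Over.forget x).mapIso i) (Iso.refl _)
        (Category.id_comp _) (Category.id_comp _) ?_ ?_ ?_ ?_⟩
    · exact hi.trans (Category.comp_id _).symm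
    · exact (Category.id_comp _).trans (Category.comp_id _).symm
    · exact (Category.id_comp _).trans (Category.comp_id _).symm
    · exact Category.id_comp _
  · intro h
    refine isLeftAdjoint_of_isCouniversal fun c => ?_
    obtain ⟨r, p, r', fst, snd, e, H⟩ := h (M.target.obj c).hom
    obtain ⟨a, j, ip, e', he', -⟩ := M.exists_of_isPiObj H (c := c) (Iso.refl _)
    exact ⟨a, e', he'⟩

variable {D : Type u} [Category.{v} D] {F : C ⥤ D} {C₂ : Type u₂} {C₄ : Type u₄}
  [Category.{v₂} C₂] [Category.{v₄} C₄] {G₂ : C₂ ⥤ C₄} {F₁ : C₁ ⥤ C₂} {F₂ : C₃ ⥤ C₄}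

/-- A square `τ` of functors presents the comparison of pullbacks along `f` and along `F f`: under
the presentations `M` and `N` of its vertical sides as pullback functors, the horizontal sides
correspond to the action of `F` on slices, and `τ` to the canonical comparison. -/
structure Comparison (M : PullbackModel f G) (N : PullbackModel (F.map f) G₂)
    (τ : F₁ ⋙ G₂ ⟶ G ⋙ F₂) where
  source (a : C₁) : F.obj (M.source.obj a).left ≅ (N.source.obj (F₁.obj a)).left
  source_hom (a : C₁) :
    (source a).hom ≫ (N.source.obj (F₁.obj a)).hom = F.map (M.source.obj a).hom
  target (b : C₃) : F.obj (M.target.obj b).left ≅ (N.target.obj (F₂.obj b)).left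
  target_hom (b : C₃) :
    (target b).hom ≫ (N.target.obj (F₂.obj b)).hom = F.map (M.target.obj b).hom
  naturality {b b' : C₃} (h : b ⟶ b') :
    F.map (M.target.map h).left ≫ (target b').hom =
      (target b).hom ≫ (N.target.map (F₂.map h)).left
  compat (a : C₁) :
    (N.target.map (τ.app a)).left ≫ (target (G.obj a)).inv ≫ F.map (M.lift a) ≫
      (source a).hom = N.lift (F₁.obj a)

variable [PreservesLimitsOfShape WalkingCospan F] {M : PullbackModel f G}
  {N : PullbackModel (F.map f) G₂} {τ : F₁ ⋙ G₂ ⟶ G ⋙ F₂}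

namespace Comparison

theorem exists_iso (K : Comparison M N τ) (a : C₁) :
    ∃ i : (N.target.obj (G₂.obj (F₁.obj a))).left ≅ F.obj (M.target.obj (G.obj a)).left,
      i.hom ≫ (K.target (G.obj a)).hom = (N.target.map (τ.app a)).left := by
  have h₁ : IsPullback (F.map (M.lift a) ≫ (K.source a).hom) (F.map (M.target.obj (G.obj a)).hom)
      (N.source.obj (F₁.obj a)).hom (F.map f) :=
    ((M.isPullback a).map F).of_iso (Iso.refl _) (K.source a) (Iso.refl _) (Iso.refl _)
      (by simp) (by simp) (by simp [K.source_hom]) (by simp)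
  have h₂ := N.isPullback (F₁.obj a)
  have hi : IsIso ((N.target.map (τ.app a)).left ≫ (K.target (G.obj a)).inv) := by
    refine CompCat.isIso_of_isPullback h₂ h₁ ?_ ?_
    · rw [Category.assoc]
      exact K.compat a
    · rw [Category.assoc, (Iso.inv_comp_eq _).2 (K.target_hom _).symm]
      exact Over.w (N.target.map (τ.app a))
  exact ⟨asIso ((N.target.map (τ.app a)).left ≫ (K.target (G.obj a)).inv), by
    rw [asIso_hom, Category.assoc, Iso.inv_hom_id, Category.comp_id]⟩

/-- The universal property of the image under `τ` and `F₂` of an arrow is that of its image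
under `F`. -/
theorem isCouniversal_iff (K : Comparison M N τ) {r : C₁} {c : C₃} (e : G.obj r ⟶ c) :
    IsCouniversal G₂ (c := F₂.obj c) (τ.app r ≫ F₂.map e) ↔
      IsPiObj (F.map f) (F.map (M.source.obj r).hom) (F.map (M.target.obj c).hom)
        (F.map (M.lift r)) (F.map (M.target.obj (G.obj r)).hom) (F.map (M.target.map e).left) := by
  obtain ⟨i, hi⟩ := K.exists_iso r
  have hi' : i.hom = (N.target.map (τ.app r)).left ≫ (K.target (G.obj r)).inv := by
    rw [Iso.eq_comp_inv, hi]
  have h₁ : i.hom ≫ F.map (M.lift r) ≫ (K.source r).hom = N.lift (F₁.obj r) := by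
    rw [hi', Category.assoc]
    exact K.compat r
  have h₂ : i.hom ≫ F.map (M.target.obj (G.obj r)).hom =
      (N.target.obj (G₂.obj (F₁.obj r))).hom := by
    rw [← K.target_hom, reassoc_of% hi]
    exact Over.w (N.target.map (τ.app r))
  have h₃ : (N.target.map (τ.app r ≫ F₂.map e)).left =
      i.hom ≫ F.map (M.target.map e).left ≫ (K.target c).hom := by
    rw [K.naturality, reassoc_of% hi, Functor.map_comp, Over.comp_left]
  refine (N.isCouniversal_iff _).trans ⟨fun H => ?_, fun H => ?_⟩
  · refine H.of_iso (Iso.refl _) (K.source r).symm (K.target c).symm i (Category.id_comp _) ?_ ?_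
      ?_ ?_ ?_
    · rw [Iso.symm_hom, Iso.inv_comp_eq, K.source_hom]
    · rw [Iso.symm_hom, Iso.inv_comp_eq, Iso.refl_hom, Category.comp_id, K.target_hom]
    · rw [Iso.symm_hom, Iso.eq_comp_inv, Category.assoc, h₁]
    · rw [Iso.refl_hom, Category.comp_id, h₂]
    · rw [Iso.symm_hom, Iso.eq_comp_inv, Category.assoc, ← h₃]
  · refine H.of_iso (Iso.refl _) (K.source r) (K.target c) i.symm (Category.id_comp _) ?_ ?_
      ?_ ?_ ?_
    · exact K.source_hom r
    · rw [Iso.refl_hom, Category.comp_id, K.target_hom]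
    · rw [Iso.symm_hom, Iso.inv_comp_eq, h₁]
    · rw [Iso.symm_hom, Iso.inv_comp_eq, Iso.refl_hom, Category.comp_id, h₂]
    · rw [Iso.symm_hom, Iso.inv_comp_eq, ← h₃]

theorem rightBeckChevalley (K : Comparison M N τ) (hF : PreservesPiObj F f) :
    RightBeckChevalley τ :=
  rightBeckChevalley_of_isCouniversal fun _ _ e he =>
    (K.isCouniversal_iff e).2 (hF ((M.isCouniversal_iff e).1 he))

theorem preservesPiObj (K : Comparison M N τ) (h₁ : G.IsLeftAdjoint) (h₂ : G₂.IsLeftAdjoint)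
    (hτ : RightBeckChevalley τ) : PreservesPiObj F f := by
  intro r d p r' d' fst snd e H
  have := M.target_equiv
  let c := M.target.objPreimage (Over.mk d')
  let i : M.target.obj c ≅ Over.mk d' := M.target.objObjPreimageIso (Over.mk d')
  have hi : i.hom.left ≫ d' = (M.target.obj c).hom := Over.w i.hom
  obtain ⟨a, j, ip, e', he', w₁, w₂, w₃⟩ := M.exists_of_isPiObj H i
  have hj : j.hom.left ≫ r' = (M.source.obj a).hom := Over.w j.hom
  refine ((K.isCouniversal_iff e').1 (hτ.isCouniversal h₁ h₂ he')).of_iso (Iso.refl _)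
    (F.mapIso ((Over.forget y).mapIso j)) (F.mapIso ((Over.forget x).mapIso i)) (F.mapIso ip)
    (Category.id_comp _) ?_ ?_ ?_ ?_ ?_
  · exact (F.map_comp _ _).symm.trans (congrArg F.map hj)
  · exact ((F.map_comp _ _).symm.trans (congrArg F.map hi)).trans (Category.comp_id _).symm
  · exact ((F.map_comp _ _).symm.trans (congrArg F.map w₁)).trans (F.map_comp _ _)
  · exact ((F.map_comp _ _).symm.trans (congrArg F.map w₂)).trans (Category.comp_id _).symm
  · exact ((F.map_comp _ _).symm.trans (congrArg F.map w₃)).trans (F.map_comp _ _)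

end Comparison

end PullbackModel

/-! ### Locally Cartesian closed categories and dependent product types -/

variable {C D : Type u} [Category.{v} C] [Category.{v} D]

/-- Pullback functors between slices are presented by themselves. -/
noncomputable def overModel [HasPullbacks C] {x y : C} (f : x ⟶ y) :
    PullbackModel f (Over.pullback f) where
  source := 𝟭 _
  target := 𝟭 _
  source_equiv := inferInstance
  target_equiv := inferInstance
  lift g := pullback.fst g.hom f
  isPullback g := IsPullback.of_hasPullback g.hom f
  naturality a := over_map_fst f a

/-- The comparison of pullback functors between slices along `f` and along `F f`, for a functor `F`
that preserves pullbacks. -/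
noncomputable def overComparison [HasPullbacks C] [HasPullbacks D] (F : C ⥤ D)
    [PreservesLimitsOfShape WalkingCospan F] {x y : C} (f : x ⟶ y) :
    (overModel f).Comparison (overModel (F.map f)) (overSquare F f) where
  source g := Iso.refl (F.obj g.left)
  source_hom _ := Category.id_comp _
  target g := Iso.refl (F.obj g.left)
  target_hom _ := Category.id_comp _
  naturality _ := (Category.comp_id _).trans (Category.id_comp _).symm
  compat g := by
    refine Eq.trans ?_ (overApp_fst F f g)
    exact congrArg (overApp F f g ≫ ·) ((Category.id_comp _).trans (Category.comp_id _))

theorem isLCC_iff [HasPullbacks C] : IsLCC C ↔ ∀ ⦃x y : C⦄ (f : x ⟶ y), HasPiObj f :=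
  forall₃_congr fun _ _ f => (overModel f).isLeftAdjoint_iff

theorem preservesExponentials_iff [HasPullbacks C] [HasPullbacks D] (F : C ⥤ D)
    [PreservesLimitsOfShape WalkingCospan F] (hC : IsLCC C) (hD : IsLCC D) :
    PreservesExponentials F ↔ ∀ ⦃x y : C⦄ (f : x ⟶ y), PreservesPiObj F f :=
  ⟨fun h _ _ f => (overComparison F f).preservesPiObj (hC f) (hD (F.map f)) (h f),
    fun h _ _ f => (overComparison F f).rightBeckChevalley (h f)⟩

theorem HasPiObj.of_iso {x x' y : C} {f : x ⟶ y} (h : HasPiObj f) (i : x' ≅ x) :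
    HasPiObj (i.hom ≫ f) := by
  intro c c'
  obtain ⟨r, p, r', fst, snd, e, H⟩ := h (c' ≫ i.hom)
  exact ⟨r, p, r', fst, snd ≫ i.inv, e, H.of_iso i.symm (Iso.refl _) (Iso.refl _) (Iso.refl _)
    (by simp) (by simp) (by simp) (by simp) (by simp) (by simp)⟩

namespace CompCat

variable {X Y : CompCat.{v, u}}

/-- Substitution is presented as pulling back along `f`, if types are equivalent to objects of
slices. -/
noncomputable def substModel (hX : IsFullyFaithful X)
    (hd : ∀ {Θ Γ : X.base} (f : Θ ⟶ Γ), X.IsDisplay f) {Γ Γ' : X.base} (f : Γ ⟶ Γ') :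
    PullbackModel f (X.subst f) where
  source := X.toOver Γ'
  target := X.toOver Γ
  source_equiv := hX.toOver_isEquivalence hd Γ'
  target_equiv := hX.toOver_isEquivalence hd Γ
  lift A := X.extMap (X.substLift f A)
  isPullback A := X.isPullback_lift f A
  naturality a := X.extMap_subst_lift f a

theorem toOver_fiberMap (S : X ⟶ Y) {Γ : X.base} {A B : X.types.Fiber Γ} (a : A ⟶ B) :
    Y.extMap ((fiberMap S Γ).map a).hom = Y.extMap ((toLax S).disp.map a.hom) :=
  congrArg Y.extTot.map ((toLax S).disp.tot_fiber_map a)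

/-- The comparison of substitution along `f` and along its image under a morphism `S` of
comprehension categories: the comparison cell of `S` identifies its action on types with the action
on slices of its functor on contexts. -/
noncomputable def substComparison (S : X ⟶ Y)
    (hS : ∀ ⦃Γ : X.base⦄ (A : X.types.Ob Γ), IsIso ((toLax S).comparison A))
    (hX : IsFullyFaithful X) (hdX : ∀ {Θ Γ : X.base} (f : Θ ⟶ Γ), X.IsDisplay f)
    (hY : IsFullyFaithful Y) (hdY : ∀ {Θ Γ : Y.base} (f : Θ ⟶ Γ), Y.IsDisplay f)
    {Γ Γ' : X.base} (f : Γ ⟶ Γ') :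
    (substModel hX hdX f).Comparison (substModel hY hdY ((toLax S).functor.map f))
      (substSquare S f) where
  source A := @asIso _ _ _ _ ((toLax S).comparison A.ob) (hS A.ob)
  source_hom A := (toLax S).comparison_pr A.ob
  target A := @asIso _ _ _ _ ((toLax S).comparison A.ob) (hS A.ob)
  target_hom A := (toLax S).comparison_pr A.ob
  naturality {A B} a := ((toLax S).comparison_naturality a.hom).trans
    (congrArg (_ ≫ ·) (toOver_fiberMap S a).symm)
  compat A := by
    have := hS A.ob
    have := hS ((X.subst f).obj A).ob
    have h := congrArg Y.extTot.map ((toLax S).disp.reindexApp_lift (toLax S).cartesian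
      X.cleaving Y.cleaving f A)
    rw [Functor.map_comp] at h
    refine Eq.trans ?_ h
    refine congrArg (_ ≫ ·) ?_
    refine (IsIso.inv_comp_eq ((toLax S).comparison ((X.subst f).obj A).ob)).2 ?_
    exact (toLax S).comparison_naturality (X.substLift f A)

theorem preservesPi_iff (S : X ⟶ Y)
    (hS : ∀ ⦃Γ : X.base⦄ (A : X.types.Ob Γ), IsIso ((toLax S).comparison A))
    (hX : IsFullyFaithful X) (hdX : ∀ {Θ Γ : X.base} (f : Θ ⟶ Γ), X.IsDisplay f)
    (hY : IsFullyFaithful Y) (hdY : ∀ {Θ Γ : Y.base} (f : Θ ⟶ Γ), Y.IsDisplay f)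
    [PreservesLimitsOfShape WalkingCospan (toLax S).functor]
    (hpX : ∀ ⦃x y : X.base⦄ (f : x ⟶ y), HasPiObj f)
    (hpY : ∀ ⦃x y : Y.base⦄ (f : x ⟶ y), HasPiObj f) :
    PreservesPi S ↔ ∀ ⦃x y : X.base⦄ (f : x ⟶ y), PreservesPiObj (toLax S).functor f :=
  ⟨fun h _ _ f =>
    have hf := (substModel hX hdX f).isLeftAdjoint_iff.2 (hpX f)
    (substComparison S hS hX hdX hY hdY f).preservesPiObj hf (h f hf).1 (h f hf).2,
  fun h _ _ f _ => ⟨(substModel hY hdY _).isLeftAdjoint_iff.2 (hpY _),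
    (substComparison S hS hX hdX hY hdY f).rightBeckChevalley (h f)⟩⟩

theorem HasPi.hasPiObj (h : HasPi X) (hX : IsFullyFaithful X)
    (hd : ∀ {Θ Γ : X.base} (f : Θ ⟶ Γ), X.IsDisplay f) ⦃x y : X.base⦄ (f : x ⟶ y) :
    HasPiObj f := by
  obtain ⟨A, i, hi⟩ := hd f
  have := ((substModel hX hd _).isLeftAdjoint_iff.1 (h.isLeftAdjoint A.ob)).of_iso i
  rwa [hi] at this

/-- If every morphism is a display map and has dependent products, then dependent product types
exist; their Beck-Chevalley condition is the stability of dependent products under pullback. -/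
theorem IsFullyFaithful.hasPi (hX : IsFullyFaithful X)
    (hd : ∀ {Θ Γ : X.base} (f : Θ ⟶ Γ), X.IsDisplay f)
    (h : ∀ ⦃x y : X.base⦄ (f : x ⟶ y), HasPiObj f) : HasPi X where
  isLeftAdjoint A := (substModel hX hd (X.pr A)).isLeftAdjoint_iff.2 (h _)
  beckChevalley {Γ₁ Γ₂ A₁ A₂ s t} hs := by
    refine rightBeckChevalley_of_isCouniversal (G₁ := X.subst (X.pr A₂)) (G₂ := X.subst (X.pr A₁))
      fun r c e he => ?_
    have H := ((substModel hX hd _).isCouniversal_iff e).1 he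
    refine ((substModel hX hd _).isCouniversal_iff
      (X.substCompare hs.w.symm r ≫ (X.subst t).map e)).2 ?_
    refine H.baseChange hs (X.isPullback_lift s r) (X.isPullback_lift t c)
      (X.isPullback_lift _ _) (Over.w _)
      (X.transpose (X.substCompare hs.w.symm r)) ?_ (X.transpose_pr _) ?_
    · exact transpose_substCompare hs.w.symm r
    · have := X.transpose_comp_subst (X.substCompare hs.w.symm r) e
      exact this.symm

end CompCat

end PiObj

/-! ### Lifting biequivalences to bicategories of objects with properties -/

section Total

universe w₁ v₁ u₁ w₂ v₂ u₂

variable {B : Type u₁} [Bicategory.{w₁, v₁} B] {C : Type u₂} [Bicategory.{w₂, v₂} C]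
  {S : SubData B} {T : SubData C} {F : B ⥤ᵖ C} {G : C ⥤ᵖ B}

namespace SubBicat

variable (hF : Lifts ((forget S).comp F) T) (hG : Lifts ((forget T).comp G) S)

/-- The composite of two lifted pseudofunctors. -/
abbrev liftComp : SubBicat S ⥤ᵖ SubBicat S :=
  (lift ((forget S).comp F) hF).comp (lift ((forget T).comp G) hG)

theorem liftComp_mapId (X : SubBicat S) :
    Hom₂.hom ((liftComp hF hG).mapId X).hom = ((F.comp G).mapId X.obj).hom := by
  change G.map₂ (F.map₂ (𝟙 _) ≫ (F.mapId X.obj).hom) ≫ G.map₂ (𝟙 _) ≫ (G.mapId _).hom =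
    G.map₂ (F.mapId X.obj).hom ≫ (G.mapId _).hom
  simp

theorem liftComp_mapComp {X Y Z : SubBicat S} (f : X ⟶ Y) (g : Y ⟶ Z) :
    Hom₂.hom ((liftComp hF hG).mapComp f g).hom =
      ((F.comp G).mapComp (Hom.hom f) (Hom.hom g)).hom := by
  change G.map₂ (F.map₂ (𝟙 _) ≫ (F.mapComp (Hom.hom f) (Hom.hom g)).hom) ≫ G.map₂ (𝟙 _) ≫
      (G.mapComp _ _).hom = G.map₂ (F.mapComp (Hom.hom f) (Hom.hom g)).hom ≫ (G.mapComp _ _).hom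
  simp

/-- A pseudonatural transformation from the identity to `F.comp G`, whose components satisfy the
property of 1-cells, as a transformation to the composite of the lifts. -/
def idToLift (η : Pseudofunctor.id B ⟶ F.comp G) (h : ∀ X : SubBicat S, S.Q (η.app X.obj)) :
    Pseudofunctor.id (SubBicat S) ⟶ liftComp hF hG where
  app X := Hom.mk (η.app X.obj) (h X)
  naturality f := isoMk (η.naturality (Hom.hom f))
  naturality_naturality θ := Hom₂.ext (η.naturality_naturality (Hom₂.hom θ))
  naturality_id X := Hom₂.ext (by
    refine Eq.trans ?_ (η.naturality_id X.obj)
    exact congrArg (fun m => (η.naturality (𝟙 X.obj)).hom ≫ η.app X.obj ◁ m)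
      (liftComp_mapId hF hG X))
  naturality_comp {X Y Z} f g := Hom₂.ext (by
    refine Eq.trans ?_ (η.naturality_comp (Hom.hom f) (Hom.hom g))
    exact congrArg (fun m => (η.naturality (Hom.hom f ≫ Hom.hom g)).hom ≫ η.app X.obj ◁ m)
      (liftComp_mapComp hF hG f g))

/-- A pseudonatural transformation from `F.comp G` to the identity, whose components satisfy the
property of 1-cells, as a transformation from the composite of the lifts. -/
def liftToId (η : F.comp G ⟶ Pseudofunctor.id B) (h : ∀ X : SubBicat S, S.Q (η.app X.obj)) :
    liftComp hF hG ⟶ Pseudofunctor.id (SubBicat S) where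
  app X := Hom.mk (η.app X.obj) (h X)
  naturality f := isoMk (η.naturality (Hom.hom f))
  naturality_naturality θ := Hom₂.ext (η.naturality_naturality (Hom₂.hom θ))
  naturality_id X := Hom₂.ext (by
    refine (η.naturality_id X.obj).trans ?_
    exact congrArg (fun m => m ▷ η.app X.obj ≫ (λ_ (η.app X.obj)).hom ≫ (ρ_ (η.app X.obj)).inv)
      (liftComp_mapId hF hG X).symm)
  naturality_comp {X Y Z} f g := Hom₂.ext (by
    refine (η.naturality_comp (Hom.hom f) (Hom.hom g)).trans ?_
    exact congrArg (fun m => m ▷ η.app Z.obj ≫ (α_ _ _ _).hom ≫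
      (F.comp G).map (Hom.hom f) ◁ (η.naturality (Hom.hom g)).hom ≫ (α_ _ _ _).inv ≫
        (η.naturality (Hom.hom f)).hom ▷ Hom.hom g ≫ (α_ _ _ _).hom)
      (liftComp_mapComp hF hG f g).symm)

/-- The components of an invertible modification. -/
def modIso {P Q : B ⥤ᵖ B} {η θ : P ⟶ Q} (m : η ≅ θ) (x : B) : η.app x ≅ θ.app x where
  hom := m.hom.as.app x
  inv := m.inv.as.app x
  hom_inv_id := congrArg (fun n : η ⟶ η => n.as.app x) m.hom_inv_id
  inv_hom_id := congrArg (fun n : θ ⟶ θ => n.as.app x) m.inv_hom_id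

/-- The lift of an adjoint equivalence from the identity to `F.comp G`. -/
def idEquivLift (e : Pseudofunctor.id B ≌ F.comp G)
    (h : ∀ X : SubBicat S, S.Q (e.hom.app X.obj)) (h' : ∀ X : SubBicat S, S.Q (e.inv.app X.obj)) :
    Pseudofunctor.id (SubBicat S) ≌ liftComp hF hG where
  hom := idToLift hF hG e.hom h
  inv := liftToId hF hG e.inv h'
  unit := Pseudofunctor.StrongTrans.isoMk (fun X => isoMk (modIso e.unit X.obj))
    fun f => Hom₂.ext (e.unit.hom.as.naturality (Hom.hom f))
  counit := Pseudofunctor.StrongTrans.isoMk (fun X => isoMk (modIso e.counit X.obj))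
    fun f => Hom₂.ext (e.counit.hom.as.naturality (Hom.hom f))
  left_triangle := Iso.ext (Pseudofunctor.StrongTrans.homCategory.ext fun X =>
    Hom₂.ext (congrArg (fun n => n.hom.as.app X.obj) e.left_triangle))

/-- The lift of an adjoint equivalence from `F.comp G` to the identity. -/
def liftEquivId (e : F.comp G ≌ Pseudofunctor.id B)
    (h : ∀ X : SubBicat S, S.Q (e.hom.app X.obj)) (h' : ∀ X : SubBicat S, S.Q (e.inv.app X.obj)) :
    liftComp hF hG ≌ Pseudofunctor.id (SubBicat S) where
  hom := liftToId hF hG e.hom h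
  inv := idToLift hF hG e.inv h'
  unit := Pseudofunctor.StrongTrans.isoMk (fun X => isoMk (modIso e.unit X.obj))
    fun f => Hom₂.ext (e.unit.hom.as.naturality (Hom.hom f))
  counit := Pseudofunctor.StrongTrans.isoMk (fun X => isoMk (modIso e.counit X.obj))
    fun f => Hom₂.ext (e.counit.hom.as.naturality (Hom.hom f))
  left_triangle := Iso.ext (Pseudofunctor.StrongTrans.homCategory.ext fun X =>
    Hom₂.ext (congrArg (fun n => n.hom.as.app X.obj) e.left_triangle))

end SubBicat

/-- The biequivalence between total bicategories given by a displayed biequivalence. -/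
def DispBiequivalence.totalBiequivalence {e : Biequivalence F G} (d : DispBiequivalence e S T) :
    Biequivalence d.total d.totalInv where
  unit := SubBicat.idEquivLift _ _ e.unit (fun X => d.unit X.prop) (fun X => d.unitInv X.prop)
  counit := SubBicat.liftEquivId _ _ e.counit (fun X => d.counit X.prop)
    (fun X => d.counitInv X.prop)

end Total

/-! ### The displayed biequivalence -/

namespace CompCat

variable {k : CatKind}

theorem dfl_preservesPi_iff {X Y : DFLCompCat.{v, u} k} (S : X ⟶ Y)
    [PreservesLimitsOfShape WalkingCospan (lax S).functor]
    (hX : ∀ ⦃x y : X.obj.obj.base⦄ (f : x ⟶ y), HasPiObj f)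
    (hY : ∀ ⦃x y : Y.obj.obj.base⦄ (f : x ⟶ y), HasPiObj f) :
    (piData k).Q S ↔ ∀ ⦃x y : X.obj.obj.base⦄ (f : x ⟶ y), PreservesPiObj (lax S).functor f :=
  have : PreservesLimitsOfShape WalkingCospan
      (toLax (SubBicat.Hom.hom (SubBicat.Hom.hom S))).functor :=
    inferInstanceAs (PreservesLimitsOfShape WalkingCospan (lax S).functor)
  preservesPi_iff (SubBicat.Hom.hom (SubBicat.Hom.hom S)) (isIso_comparison S)
    (isFullyFaithful X.obj) (isDisplay X) (isFullyFaithful Y.obj) (isDisplay Y) hX hY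

theorem piData_hasPiObj {X : DFLCompCat.{v, u} k} (h : (piData k).P X)
    ⦃x y : X.obj.obj.base⦄ (f : x ⟶ y) : HasPiObj f :=
  HasPi.hasPiObj h (isFullyFaithful X.obj) (isDisplay X) f

/-- The biequivalence between categories with finite limits and DFL comprehension categories. -/
noncomputable def dflBiequivalence (hH : ArrowLands.{v, u} k) (hU : BaseLands.{v, u} k)
    (hZ : ZetaLands.{v, u} hU) : Biequivalence (arrowH hH) (baseU hU) where
  unit := zetaEquivalence hH hU hZ
  counit := xiEquivalence hH hU

/-- Local Cartesian closure and dependent product types both amount to the existence and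
preservation of dependent products in the category of contexts. -/
theorem dispBiequivalence (hH : ArrowLands.{v, u} k) (hU : BaseLands.{v, u} k)
    (hZ : ZetaLands.{v, u} hU) :
    DispBiequivalence (dflBiequivalence hH hU hZ) (lcccData k) (piData k) where
  obj {C} h := (ofArrows_isFullyFaithful C.obj).hasPi (ofArrows_isDisplay C.obj)
    ((isLCC_iff (C := C.obj)).1 h)
  map {C D F} hC hD hF :=
    have hF' : PreservesLimitsOfShape WalkingCospan (SubBicat.Hom.hom F).toFunctor :=
      inferInstance
    have : PreservesLimitsOfShape WalkingCospan (lax ((arrowH hH).map F)).functor := hF'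
    (dfl_preservesPi_iff ((arrowH hH).map F)
      ((isLCC_iff (C := C.obj)).1 hC) ((isLCC_iff (C := D.obj)).1 hD)).2
      ((preservesExponentials_iff (SubBicat.Hom.hom F).toFunctor hC hD).1 hF)
  invObj {X} h := by
    have : HasFiniteLimits X.obj.obj.base := (hU.obj X).1
    exact isLCC_iff.2 (piData_hasPiObj h)
  invMap {X Y S} hX hY hS := by
    have : HasFiniteLimits X.obj.obj.base := (hU.obj X).1
    have : HasFiniteLimits Y.obj.obj.base := (hU.obj Y).1
    have : PreservesFiniteLimits (lax S).functor := hU.map S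
    exact (preservesExponentials_iff (lax S).functor (isLCC_iff.2 (piData_hasPiObj hX))
      (isLCC_iff.2 (piData_hasPiObj hY))).2
        ((dfl_preservesPi_iff S (piData_hasPiObj hX) (piData_hasPiObj hY)).1 hS)
  unit {X} hX :=
    have : PreservesLimitsOfShape WalkingCospan (lax ((zeta hH hU hZ).app X)).functor :=
      inferInstanceAs (PreservesLimitsOfShape WalkingCospan (𝟭 X.obj.obj.base))
    (dfl_preservesPi_iff ((zeta hH hU hZ).app X) (piData_hasPiObj (X := X) hX)
      (piData_hasPiObj (X := X) hX)).2 fun _ _ f => preservesPiObj_id f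
  unitInv {X} hX :=
    have : PreservesLimitsOfShape WalkingCospan (lax ((zetaInv hH hU).app X)).functor :=
      inferInstanceAs (PreservesLimitsOfShape WalkingCospan (𝟭 X.obj.obj.base))
    (dfl_preservesPi_iff ((zetaInv hH hU).app X) (piData_hasPiObj (X := X) hX)
      (piData_hasPiObj (X := X) hX)).2 fun _ _ f => preservesPiObj_id f
  counit h := (lcccData k).id h
  counitInv h := (lcccData k).id h

end CompCat

end LCCCBiequiv

theorem mainTheorem2 (k : CatKind) :
    ∃ (hH : CompCat.ArrowLands.{v, u} k) (hU : CompCat.BaseLands.{v, u} k)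
      (hZ : CompCat.ZetaLands.{v, u} hU)
      (e : Biequivalence (CompCat.arrowH.{v, u} hH) (CompCat.baseU.{v, u} hU)),
      e.unit.hom = CompCat.zeta hH hU hZ ∧ e.counit.hom = CompCat.xi hH hU ∧
      ∃ (d : DispBiequivalence e (lcccData.{v, u} k) (CompCat.piData.{v, u} k))
        (E : Biequivalence (B := LCCC.{v, u} k) (C := DFLCompCatPi.{v, u} k)
          d.total d.totalInv), DispBiequivalence.LiesOver E :=
  have d := CompCat.dispBiequivalence (CompCat.arrowLands k) (CompCat.baseLands k)
    (CompCat.zetaLands (CompCat.baseLands k))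
  ⟨CompCat.arrowLands k, CompCat.baseLands k, CompCat.zetaLands _,
    CompCat.dflBiequivalence _ _ _, rfl, rfl, d, d.totalBiequivalence,
    fun _ => rfl, fun _ => rfl, fun _ => rfl, fun _ => rfl⟩
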